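/- **Setting.** Let $d\ge 3$. For $m\ge2$ let $P_{(m)}=\frac1m\sum_{i,j}|ii\rangle\langle jj|$ and $\tilde Q_{(m)}=(1-P_{(m)})/(m^2-1)$ on $\mathbb C^m\otimes\mathbb C^m$; write $P=P_{(d)}$, $\tilde Q=\tilde Q_{(d)}$, $P_2=P_{(2)}$, $\tilde Q_2=\tilde Q_{(2)}$. Let $F=\sum_{i,j}|ij\rangle\langle ji|$ and let $\rho_\beta=(1+\beta F)/(d^2+\beta d)$ be the Werner states on $\mathbb C^d\otimes\mathbb C^d$. A state $\rho$ is *$n$-distillable* if there are projectors $A,B$ (operators with $AA^\dagger=BB^\dagger=1$) from the local spaces $(\mathbb C^d)^{\otimes n}$ of the two parties onto $\mathbb C^2$ such that the two-qubit operator $(A\otimes B)\rho^{\otimes n}(A\otimes B)^\dagger$ does not have a positive semidefinite partial transpose. Let $\mathcal U_n$ be the statement "no $\rho_\beta$ with $-\frac12\le\beta\le1$ is $n$-distillable". A bipartite operator is *separable* if it is a finite sum $\sum_i p_i\,\rho^A_i\otimes\rho^B_i$ with $p_i>0$ and density operators $\rho_i^A,\rho_i^B$, and *entangled* otherwise; it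 is PPT if its partial transpose is positive semidefinite. Normalisation of states is ignored. For $c=(y_1,\dots,y_n;x_0,\dots,x_n)\in\mathbb R^{2n+1}$ put $$\rho(c)=\tilde Q_2\otimes\Big(L_0+\sum_{j=1}^n y_jL_j\Big)+P_2\otimes\sum_{i=0}^n x_iL_i ,$$ where $L_j$ is the sum of the $\binom nj$ tensor products with $P$ in $j$ of the $n$ factors and $\tilde Q$ in the others; each party holds one half of the qubit pair and of each of the $n$ pairs. These operators are invariant under all $U\otimes U^*\otimes\bigotimes_i(V_i\otimes V_i^*)$ with $U\in U(2)$, $V_i\in U(d)$, and under permutations of the $n$ pairs. *Twirling* is averaging over this group. The *normalised* coordinates are $\tilde y_j=(\frac d2-1)^jy_j$ and $\tilde x_i=(\frac d2-1)^ix_i$. Let $e$ be the unit vector of the coordinate $x_1$. **Theorem.** (I) For every $n\ge1$: 1. The following are equivalent: $\mathcal U_n$; $\rho_{-1/2}$ is not $n$-distillable; there is $\eta>0$ such that no $\rho_\beta$ with $-\frac12<\beta<-\frac12+\eta$ is $n$-distillable; there is no vector $\psi$ of Schmidt rank two with $\langle\psi|(\rho_{-1/2}^{T_B})^{\otimes n}|\psi\rangle<0$.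 2. Consider the $2n+1$ product vectors (with respect to the two parties) $|01\rangle|00\rangle^{\otimes k}|01\rangle^{\otimes(n-k)}$, $0\le k\le n$, and $\sum_{i,j=0}^1|ij\rangle|ij\rangle|00\rangle^{\otimes(n-k-1)}|01\rangle^{\otimes k}$, $0\le k\le n-1$. Up to positive factors their twirls are separable operators $\rho(c_k)$ and $\rho(c'_k)$. Here $c_k$ has $y_j=\binom kj\binom nj^{-1}(d-1)^{-j}$ and $x_i=0$; and, with $m=n-1-k$, $c'_k$ has $y_j=\binom mj\binom nj^{-1}(d-1)^{-j}$ and $x_i$ given by $\sum_{i=0}^n\binom nix_iz^i=\frac{1}{3d}(d-2+2z)\big(1+\frac z{d-1}\big)^m$. These $2n+1$ points are affinely independent and their affine span is the hyperplane $$\Big\{c:\ \operatorname{Tr}\Big[P_2\otimes\big((1-P)+(1-\tfrac d2)P\big)^{\otimes n}\,\rho(c)\Big]=0\Big\}.$$ 3. If $p$ is any convex combination of these $2n+1$ points with all weights strictly positive, then $\mathcal U_n$ holds if and only if $\rho(p+\delta e)$ is entangled for all $\delta>0$. 4. There is $\varepsilon_0>0$ (depending on $d$ and $n$) such that for every $0<\varepsilon<\varepsilon_0$: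 $\mathcal U_n$ holds if and only if for all $\delta>0$ the state with normalised coordinates $$\tilde y_j=\varepsilon^j\ (1\le j\le n),\qquad \tilde x_i=\tfrac in\,\varepsilon^i+\big(1-\tfrac in\big)\varepsilon^{i+1}+\delta\,[i=1]\ \ (0\le i\le n)$$ is entangled. (For $n=1$ this reads $\tilde y_1=\tilde x_0=\varepsilon$, $\tilde x_1=\varepsilon+\delta$.) 5. If $\mathcal U_n$ holds, then for all $\varepsilon,\delta>0$ the state with normalised coordinates $\tilde y_j=\varepsilon$ $(1\le j\le n)$, $\tilde x_i=\varepsilon$ $(i\ne1)$, $\tilde x_1=\varepsilon+\delta$ is entangled. (II) One copy. For $x,y,z\ge0$ let $\rho=\tilde Q_2\otimes\tilde Q+xP_2\otimes\tilde Q+y\tilde Q_2\otimes P+zP_2\otimes P$. It is PPT if and only if $$3z\le\tfrac{1+3x}{d-1}-y,\qquad z\le\tfrac{1-x}{d+1}+y,\qquad z\ge\tfrac{x-1}{d-1}+y .$$ It is entangled if $z>2x/(d-2)$. In the tetrahedron with vertices, in coordinates $(x,y,z)$, $O=(0,0,0)$, $A=(0,\frac1{d-1},0)$, $B=(0,0,\frac1{3(d-1)})$,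 $C=(\frac{d-2}{3d},0,\frac2{3d})$ all states are PPT, and a state in it is separable if and only if it lies on the face $OAC$. (III) Two copies. $\mathcal U_2$ holds if and only if for all $\varepsilon>0$ the state with (not normalised) coordinates $$y_1=\tfrac{d(2d-3)}{5(d-1)(d^2-d-1)},\quad y_2=\tfrac1{5(d^2-d-1)},\quad x_0=\tfrac{2(d-2)}{15d},\quad x_1=\tfrac{5d-6}{30d(d-1)}+\varepsilon,\quad x_2=\tfrac2{15d(d-1)}$$ is entangled. -/

import Mathlib

open scoped Matrix Kronecker Topology ComplexOrder

noncomputable section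

namespace Distill

/-! ### Bipartite operators: separability, partial transposition -/

/-- A (not necessarily normalised) bipartite operator is separable if it is a finite sum
`∑ i, p i • (ρA i ⊗ ρB i)` with `p i > 0` and density operators `ρA i`, `ρB i`.
The first index is the party `A`, the second one the party `B`. -/
def SeparableOp {α β : Type} [Fintype α] [Fintype β]
    (ρ : Matrix (α × β) (α × β) ℂ) : Prop :=
  ∃ (m : ℕ) (p : Fin m → ℝ) (ρA : Fin m → Matrix α α ℂ) (ρB : Fin m → Matrix β β ℂ),
    (∀ i, 0 < p i ∧ (ρA i).PosSemidef ∧ (ρA i).trace = 1 ∧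
      (ρB i).PosSemidef ∧ (ρB i).trace = 1) ∧
    ρ = ∑ i, (p i : ℂ) • (ρA i ⊗ₖ ρB i)

/-- Partial transposition with respect to the second party. -/
def partialTranspose {α β : Type} (M : Matrix (α × β) (α × β) ℂ) :
    Matrix (α × β) (α × β) ℂ :=
  fun p q => M (p.1, q.2) (q.1, p.2)

/-! ### One pair `ℂ^m ⊗ ℂ^m` -/

/-- The projector `P = (1/m) ∑ i j, |ii⟩⟨jj|` onto the maximally entangled vector. -/
def maxEnt (m : ℕ) : Matrix (Fin m × Fin m) (Fin m × Fin m) ℂ :=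
  fun p q => if p.1 = p.2 ∧ q.1 = q.2 then 1 / (m : ℂ) else 0

/-- The normalised complement `(1 - P) / (m² - 1)`. -/
def complEnt (m : ℕ) : Matrix (Fin m × Fin m) (Fin m × Fin m) ℂ :=
  ((m : ℂ) ^ 2 - 1)⁻¹ • (1 - maxEnt m)

/-- The flip operator `F = ∑ i j, |ij⟩⟨ji|`. -/
def flip (m : ℕ) : Matrix (Fin m × Fin m) (Fin m × Fin m) ℂ :=
  fun p q => if p.1 = q.2 ∧ p.2 = q.1 then 1 else 0

/-- The Werner state `(1 + β F) / (d² + β d)`. -/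
def werner (d : ℕ) (β : ℝ) : Matrix (Fin d × Fin d) (Fin d × Fin d) ℂ :=
  ((d : ℂ) ^ 2 + (β : ℂ) * d)⁻¹ • (1 + (β : ℂ) • flip d)

/-! ### `n` pairs, and a further pair of qubits -/

/-- The tensor product of `n` operators on `ℂ^d ⊗ ℂ^d`, regrouped as an operator on
`(ℂ^d)^{⊗n} ⊗ (ℂ^d)^{⊗n}`, so that `A` holds the first half of every pair. -/
def pairTensor {d n : ℕ} (X : Fin n → Matrix (Fin d × Fin d) (Fin d × Fin d) ℂ) :
    Matrix ((Fin n → Fin d) × (Fin n → Fin d)) ((Fin n → Fin d) × (Fin n → Fin d)) ℂ :=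
  fun p q => ∏ i, X i (p.1 i, p.2 i) (q.1 i, q.2 i)

/-- The local space `ℂ² ⊗ (ℂ^d)^{⊗n}` of one party, as an index type. -/
abbrev Party (d n : ℕ) : Type := Fin 2 × (Fin n → Fin d)

/-- Operators on the bipartite space of two such parties. -/
abbrev Op (d n : ℕ) : Type := Matrix (Party d n × Party d n) (Party d n × Party d n) ℂ

/-- `X ⊗ Y` with `X` acting on the pair of qubits and `Y` on the `n` pairs, regrouped so that
each party holds its half of all the pairs. -/
def withQubits {d n : ℕ} (X : Matrix (Fin 2 × Fin 2) (Fin 2 × Fin 2) ℂ)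
    (Y : Matrix ((Fin n → Fin d) × (Fin n → Fin d)) ((Fin n → Fin d) × (Fin n → Fin d)) ℂ) :
    Op d n :=
  fun p q => X (p.1.1, p.2.1) (q.1.1, q.2.1) * Y (p.1.2, p.2.2) (q.1.2, q.2.2)

/-- `ρ` is (pseudo-)`n`-copy distillable: there are projectors `A`, `B` of the two local spaces of
`n` copies onto a qubit such that the two-qubit operator `(A ⊗ B) ρ^{⊗n} (A ⊗ B)†` has a partial
transpose that is not positive. -/
def NDistillable {d : ℕ} (n : ℕ) (ρ : Matrix (Fin d × Fin d) (Fin d × Fin d) ℂ) : Prop :=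
  ∃ A B : Matrix (Fin 2) (Fin n → Fin d) ℂ, A * Aᴴ = 1 ∧ B * Bᴴ = 1 ∧
    ¬ (partialTranspose ((A ⊗ₖ B) * pairTensor (fun _ : Fin n => ρ) * (A ⊗ₖ B)ᴴ)).PosSemidef

/-- The conjecture for `n` copies: no Werner state with `-1/2 ≤ β ≤ 1` is `n`-distillable. -/
def WernerUndistillable (d n : ℕ) : Prop :=
  ∀ β ∈ Set.Icc (-1 / 2 : ℝ) 1, ¬ NDistillable n (werner d β)

/-! ### The invariant states and their coordinates -/

/-- The sum, over all ways to choose `j` of the `n` pairs, of the tensor product with `P` on the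
chosen pairs and the normalised complement of `P` on the others. -/
def layer (d n j : ℕ) :
    Matrix ((Fin n → Fin d) × (Fin n → Fin d)) ((Fin n → Fin d) × (Fin n → Fin d)) ℂ :=
  ∑ S ∈ Finset.powersetCard j (Finset.univ : Finset (Fin n)),
    pairTensor (fun i => if i ∈ S then maxEnt d else complEnt d)

/-- Coordinates `(y₁, …, yₙ ; x₀, …, xₙ)`; the entry `j : Fin n` of the first component
is `y_{j+1}`. -/
abbrev Coord (n : ℕ) : Type := (Fin n → ℝ) × (Fin (n + 1) → ℝ)

/-- The (unnormalised) invariant state with the given coordinates. -/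
def invState (d : ℕ) {n : ℕ} (c : Coord n) : Op d n :=
  withQubits (complEnt 2) (layer d n 0 + ∑ j : Fin n, (c.1 j : ℂ) • layer d n (j + 1)) +
    withQubits (maxEnt 2) (∑ i : Fin (n + 1), (c.2 i : ℂ) • layer d n i)

/-- Passage from the normalised coordinates `(d/2 - 1)^j y_j`, `(d/2 - 1)^i x_i` to the
coordinates `y_j`, `x_i`. -/
def ofNormalised (d : ℕ) {n : ℕ} (c : Coord n) : Coord n :=
  (fun j => c.1 j / ((d : ℝ) / 2 - 1) ^ ((j : ℕ) + 1),
    fun i => c.2 i / ((d : ℝ) / 2 - 1) ^ (i : ℕ))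

/-- Add `δ` to the coordinate `x₁`. -/
def addX1 {n : ℕ} (c : Coord n) (δ : ℝ) : Coord n :=
  (c.1, c.2 + Pi.single 1 δ)

/-- The operator `P₂ ⊗ (Q + (1 - d/2) P)^{⊗n}`, where `Q = 1 - P`; here `Q + (1 - d/2) P` is the
partial transpose of `1 - F/2`. -/
def witness (d n : ℕ) : Op d n :=
  withQubits (maxEnt 2)
    (pairTensor (fun _ : Fin n => (1 - maxEnt d) + (1 - (d : ℂ) / 2) • maxEnt d))

/-! ### The symmetry group and twirling -/

/-- The local unitary `U ⊗ V₁ ⊗ ⋯ ⊗ Vₙ` composed with a permutation of the `n` factors. -/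
def localUnitary {d n : ℕ} (U : Matrix.unitaryGroup (Fin 2) ℂ)
    (V : Fin n → Matrix.unitaryGroup (Fin d) ℂ) (π : Equiv.Perm (Fin n)) :
    Matrix (Party d n) (Party d n) ℂ :=
  fun p q => (U : Matrix (Fin 2) (Fin 2) ℂ) p.1 q.1 *
    ∏ i, (V i : Matrix (Fin d) (Fin d) ℂ) (p.2 i) (q.2 (π i))

/-- The group of all `g ⊗ g*`, with `g` as above and `g*` its entrywise conjugate. -/
def symmetries (d n : ℕ) : Set (Op d n) :=
  {G | ∃ U V π, G = localUnitary (d := d) (n := n) U V π ⊗ₖ (localUnitary U V π).map star}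

/-- `σ` is the twirl (group average) of `ρ`: the point of the convex hull of the orbit of `ρ` that
is invariant under the group. (The Haar average is such a point, and it is the only one.) -/
def IsTwirl {d n : ℕ} (ρ σ : Op d n) : Prop :=
  (∀ G ∈ symmetries d n, G * σ * Gᴴ = σ) ∧
    σ ∈ convexHull ℝ {τ : Op d n | ∃ G ∈ symmetries d n, τ = G * ρ * Gᴴ}

/-! ### The `2n + 1` explicit product vectors and the coordinates of their twirls -/

/-- The basis vector `|s⟩ |g 0⟩ ⋯ |g (n-1)⟩` of one party. -/
def ket (d n : ℕ) (s : ℕ) (g : ℕ → ℕ) : Party d n → ℂ :=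
  fun p => if (p.1 : ℕ) = s ∧ ∀ i : Fin n, (p.2 i : ℕ) = g i then 1 else 0

/-- The rank-one operator `|a ⊗ b⟩⟨a ⊗ b|`. -/
def prodProj {d n : ℕ} (a b : Party d n → ℂ) : Op d n :=
  Matrix.vecMulVec a (star a) ⊗ₖ Matrix.vecMulVec b (star b)

/-- The product vectors, as projectors: `|01⟩ |00⟩^{⊗k} |01⟩^{⊗(n-k)}` for `k = 0, …, n`, and
`∑_{i,j ∈ {0,1}} |ij⟩ |ij⟩ |00⟩^{⊗(n-k-1)} |01⟩^{⊗k}` for `k = 0, …, n-1`; in each pair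
the first entry belongs to `A`. -/
def productState (d n : ℕ) : Fin (n + 1) ⊕ Fin n → Op d n
  | .inl k => prodProj (ket d n 0 fun _ => 0) (ket d n 1 fun i => if i < k then 0 else 1)
  | .inr k => prodProj
      (∑ s ∈ Finset.range 2, ket d n s fun i => if i = 0 then s else 0)
      (∑ s ∈ Finset.range 2,
        ket d n s fun i => if i = 0 then s else if i < n - k then 0 else 1)

/-- The `y`-coordinates `binom(m,j) / binom(n,j) · (d-1)^{-j}`. -/
def pointY (d n m : ℕ) : Fin n → ℝ := fun j =>
  (m.choose (j + 1) : ℝ) / (n.choose (j + 1)) / ((d : ℝ) - 1) ^ ((j : ℕ) + 1)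

/-- The `x`-coordinates given by
`∑ i, binom(n,i) x_i z^i = (d - 2 + 2 z) (1 + z / (d-1))^m / (3 d)`. -/
def pointX (d n m : ℕ) : Fin (n + 1) → ℝ := fun i =>
  (((d : ℝ) - 2) * m.choose i / ((d : ℝ) - 1) ^ (i : ℕ) +
    (if (i : ℕ) = 0 then 0 else 2 * m.choose (i - 1) / ((d : ℝ) - 1) ^ ((i : ℕ) - 1))) /
      (3 * d * n.choose i)

/-- The coordinates of the twirls of the `2n + 1` product vectors. -/
def point (d n : ℕ) : Fin (n + 1) ⊕ Fin n → Coord n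
  | .inl k => (pointY d n k, 0)
  | .inr k => (pointY d n (n - 1 - k), pointX d n (n - 1 - k))

/-! ### Explicit base points, in normalised coordinates -/

/-- `y_j = ε^j` and `x_i = (i/n) ε^i + (1 - i/n) ε^{i+1}`. -/
def basePoint (n : ℕ) (ε : ℝ) : Coord n :=
  (fun j => ε ^ ((j : ℕ) + 1),
    fun i => (i : ℝ) / n * ε ^ (i : ℕ) + (1 - (i : ℝ) / n) * ε ^ ((i : ℕ) + 1))

/-- All coordinates equal to `ε`. -/
def constPoint (n : ℕ) (ε : ℝ) : Coord n := (fun _ => ε, fun _ => ε)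

end Distill

end

open Distill

/-!
Everything is governed by the operator `W = P₂ ⊗ X^{⊗n}` with `X = (1 - P) + (1 - d/2) P`, the
partial transpose of `1 - F/2`. Call `X^{⊗n}` block positive (`BlockPositive`) if it has
nonnegative expectation values in all vectors of Schmidt rank at most two.

Block positivity is equivalent to undistillability (`wernerUndistillable_tfae`). A vector of
Schmidt rank two with negative expectation value gives a distillation protocol by projecting onto
its local supports, and by continuity this persists for `β` slightly above `-1/2`. Conversely, for
`-1/2 ≤ β ≤ 1` the operator `1 + β d P`, the partial transpose of `1 + β F`, is a positive
combination of local images of `X`, since it is obtained from `X` by mixing with twirls of `|00⟩`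
and `|01⟩`; these preserve positivity on vectors of Schmidt rank two.

For a product vector `a ⊗ b` of the two parties, contracting the qubit pair with `P₂` turns
`⟨a ⊗ b| W |a ⊗ b⟩` into half an expectation value of `X^{⊗n}` in a vector of Schmidt rank at most two,
and all such vectors arise. So block positivity means exactly that `tr (W σ) ≥ 0` for all
separable `σ`. On the invariant states `tr (W ρ(c))` is the affine function `witnessValue` of the
coordinates.

Twirling maps every operator to the span of the invariant states, and separable ones to separable
ones. It is realised here by a finite average over local unitaries and permutations
(`exists_isTwirlMap`), which rests on explicit finite twirls for a single pair. The twirls of the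
`2n + 1` product vectors, computed through generating polynomials, lie on the hyperplane
`witnessValue = 0` and are affinely independent, so they span it and the convex combinations with
positive weights are interior to a simplex of separable states in that hyperplane. Increasing `x₁`
makes `witnessValue` negative. If `X^{⊗n}` is block positive all the states beyond the
hyperplane are therefore entangled. If it is not, there is a separable invariant state beyond the hyperplane;
mixing a little of it with suitable points of the simplex reaches `p + δ e` for some `δ > 0`
(`blockPositive_iff_not_separableOp`).

The explicit base points are such interior points: the one in normalised coordinates comes from
binomial weights (`ofNormalised_basePoint`). For one copy, the partial transpose is diagonalised
by the operators `(1 ± F) ⊗ (1 ± F)`, and block positivity is the inequality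
`|tr M|² ≤ 2 tr (M† M)` for matrices of rank two (`blockPositive_one`).
-/

namespace Distill
open Matrix

/-! ### Products of local operators -/

section Tensor

variable {d n : ℕ}

theorem sum_pairs (g : (Fin n → Fin d) × (Fin n → Fin d) → ℂ) :
    ∑ r, g r = ∑ s : Fin n → Fin d × Fin d, g (fun i => (s i).1, fun i => (s i).2) :=
  Fintype.sum_equiv (Equiv.arrowProdEquivProdArrow (Fin n) (fun _ => Fin d) (fun _ => Fin d)).symm
    _ _ (fun _ => rfl)

theorem pairTensor_mul (X Y : Fin n → Matrix (Fin d × Fin d) (Fin d × Fin d) ℂ) :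
    pairTensor X * pairTensor Y = pairTensor (fun i => X i * Y i) := by
  ext p q
  simp only [pairTensor, mul_apply]
  rw [Finset.prod_univ_sum, Fintype.piFinset_univ, sum_pairs]
  simp only [Finset.prod_mul_distrib]

theorem pairTensor_conjTranspose (X : Fin n → Matrix (Fin d × Fin d) (Fin d × Fin d) ℂ) :
    (pairTensor X)ᴴ = pairTensor (fun i => (X i)ᴴ) := by
  ext p q
  simp [pairTensor, conjTranspose_apply]

theorem trace_pairTensor (X : Fin n → Matrix (Fin d × Fin d) (Fin d × Fin d) ℂ) :
    (pairTensor X).trace = ∏ i, (X i).trace := by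
  simp only [pairTensor, trace, diag_apply]
  rw [Finset.prod_univ_sum, Fintype.piFinset_univ, sum_pairs]

theorem pairTensor_sum {κ : Type} [Fintype κ]
    (X : Fin n → κ → Matrix (Fin d × Fin d) (Fin d × Fin d) ℂ) :
    pairTensor (fun i => ∑ k, X i k) = ∑ K : Fin n → κ, pairTensor (fun i => X i (K i)) := by
  classical
  ext p q
  simp only [pairTensor, Matrix.sum_apply]
  rw [Finset.prod_univ_sum, Fintype.piFinset_univ]

theorem pairTensor_smul (c : Fin n → ℂ)
    (X : Fin n → Matrix (Fin d × Fin d) (Fin d × Fin d) ℂ) :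
    pairTensor (fun i => c i • X i) = (∏ i, c i) • pairTensor X := by
  ext p q
  simp [pairTensor, Finset.prod_mul_distrib]

/-- Expansion of a product of sums; `S` is the set of pairs on which the first summand is chosen. -/
theorem pairTensor_add (X Y : Fin n → Matrix (Fin d × Fin d) (Fin d × Fin d) ℂ) :
    pairTensor (fun i => X i + Y i) =
      ∑ S : Finset (Fin n), pairTensor (fun i => if i ∈ S then X i else Y i) := by
  ext p q
  simp only [pairTensor, Matrix.sum_apply, Matrix.add_apply]
  rw [Finset.prod_add, Finset.powerset_univ]
  refine Finset.sum_congr rfl fun S _ => ?_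
  rw [← Finset.prod_mul_prod_compl S]
  congr 1
  · exact Finset.prod_congr rfl fun i hi => by simp [hi]
  · rw [Finset.compl_eq_univ_sdiff]
    exact Finset.prod_congr rfl fun i hi => by simp [(Finset.mem_sdiff.1 hi).2]

theorem partialTranspose_pairTensor (X : Fin n → Matrix (Fin d × Fin d) (Fin d × Fin d) ℂ) :
    partialTranspose (pairTensor X) = pairTensor (fun i => partialTranspose (X i)) := rfl

/-- The tensor product of `n` operators of one party. -/
def tens {ι : Type} (C : Fin n → Matrix ι ι ℂ) : Matrix (Fin n → ι) (Fin n → ι) ℂ :=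
  fun f g => ∏ i, C i (f i) (g i)

theorem tens_kronecker (C D : Fin n → Matrix (Fin d) (Fin d) ℂ) :
    tens C ⊗ₖ tens D = pairTensor (fun i => C i ⊗ₖ D i) := by
  ext p q
  simp [tens, pairTensor, kroneckerMap_apply, Finset.prod_mul_distrib]

theorem withQubits_eq (X : Matrix (Fin 2 × Fin 2) (Fin 2 × Fin 2) ℂ)
    (Y : Matrix ((Fin n → Fin d) × (Fin n → Fin d)) ((Fin n → Fin d) × (Fin n → Fin d)) ℂ) :
    withQubits X Y = (X ⊗ₖ Y).submatrix (Equiv.prodProdProdComm _ _ _ _)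
      (Equiv.prodProdProdComm _ _ _ _) := rfl

theorem withQubits_mul (X X' : Matrix (Fin 2 × Fin 2) (Fin 2 × Fin 2) ℂ)
    (Y Y' : Matrix ((Fin n → Fin d) × (Fin n → Fin d)) ((Fin n → Fin d) × (Fin n → Fin d)) ℂ) :
    withQubits X Y * withQubits X' Y' = withQubits (X * X') (Y * Y') := by
  simp only [withQubits_eq, submatrix_mul_equiv, mul_kronecker_mul]

theorem withQubits_conjTranspose (X : Matrix (Fin 2 × Fin 2) (Fin 2 × Fin 2) ℂ)
    (Y : Matrix ((Fin n → Fin d) × (Fin n → Fin d)) ((Fin n → Fin d) × (Fin n → Fin d)) ℂ) :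
    (withQubits X Y)ᴴ = withQubits Xᴴ Yᴴ := by
  ext p q
  simp [withQubits]

theorem trace_withQubits (X : Matrix (Fin 2 × Fin 2) (Fin 2 × Fin 2) ℂ)
    (Y : Matrix ((Fin n → Fin d) × (Fin n → Fin d)) ((Fin n → Fin d) × (Fin n → Fin d)) ℂ) :
    (withQubits X Y).trace = X.trace * Y.trace := by
  rw [withQubits_eq, ← trace_kronecker]
  simp only [trace, diag_apply, submatrix_apply]
  exact Fintype.sum_equiv (Equiv.prodProdProdComm _ _ _ _) _ _ (fun _ => rfl)

theorem withQubits_add_left (X X' : Matrix (Fin 2 × Fin 2) (Fin 2 × Fin 2) ℂ)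
    (Y : Matrix ((Fin n → Fin d) × (Fin n → Fin d)) ((Fin n → Fin d) × (Fin n → Fin d)) ℂ) :
    withQubits (X + X') Y = withQubits X Y + withQubits X' Y := by
  ext p q; simp [withQubits, add_mul]

theorem withQubits_add_right (X : Matrix (Fin 2 × Fin 2) (Fin 2 × Fin 2) ℂ)
    (Y Y' : Matrix ((Fin n → Fin d) × (Fin n → Fin d)) ((Fin n → Fin d) × (Fin n → Fin d)) ℂ) :
    withQubits X (Y + Y') = withQubits X Y + withQubits X Y' := by
  ext p q; simp [withQubits, mul_add]

theorem withQubits_smul_left (c : ℂ) (X : Matrix (Fin 2 × Fin 2) (Fin 2 × Fin 2) ℂ)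
    (Y : Matrix ((Fin n → Fin d) × (Fin n → Fin d)) ((Fin n → Fin d) × (Fin n → Fin d)) ℂ) :
    withQubits (c • X) Y = c • withQubits X Y := by
  ext p q; simp [withQubits, mul_assoc]

theorem withQubits_smul_right (c : ℂ) (X : Matrix (Fin 2 × Fin 2) (Fin 2 × Fin 2) ℂ)
    (Y : Matrix ((Fin n → Fin d) × (Fin n → Fin d)) ((Fin n → Fin d) × (Fin n → Fin d)) ℂ) :
    withQubits X (c • Y) = c • withQubits X Y := by
  ext p q; simp [withQubits]; ring

theorem withQubits_sum_right {κ : Type} (s : Finset κ)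
    (X : Matrix (Fin 2 × Fin 2) (Fin 2 × Fin 2) ℂ)
    (Y : κ → Matrix ((Fin n → Fin d) × (Fin n → Fin d)) ((Fin n → Fin d) × (Fin n → Fin d)) ℂ) :
    withQubits X (∑ k ∈ s, Y k) = ∑ k ∈ s, withQubits X (Y k) := by
  ext p q; simp [withQubits, Matrix.sum_apply, Finset.mul_sum]

theorem withQubits_sum_left {κ : Type} (s : Finset κ)
    (X : κ → Matrix (Fin 2 × Fin 2) (Fin 2 × Fin 2) ℂ)
    (Y : Matrix ((Fin n → Fin d) × (Fin n → Fin d)) ((Fin n → Fin d) × (Fin n → Fin d)) ℂ) :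
    withQubits (∑ k ∈ s, X k) Y = ∑ k ∈ s, withQubits (X k) Y := by
  ext p q; simp [withQubits, Matrix.sum_apply, Finset.sum_mul]

theorem single_eq_withQubits (a b : Party d n × Party d n) (c : ℂ) :
    Matrix.single a b c = withQubits (Matrix.single (a.1.1, a.2.1) (b.1.1, b.2.1) c)
      (pairTensor fun i => Matrix.single (a.1.2 i, a.2.2 i) (b.1.2 i, b.2.2 i) 1) := by
  ext x y
  have key : (∏ i, (Matrix.single (a.1.2 i, a.2.2 i) (b.1.2 i, b.2.2 i) (1 : ℂ))
      (x.1.2 i, x.2.2 i) (y.1.2 i, y.2.2 i)) =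
      if a.1.2 = x.1.2 ∧ a.2.2 = x.2.2 ∧ b.1.2 = y.1.2 ∧ b.2.2 = y.2.2 then 1 else 0 := by
    simp only [Matrix.single, of_apply, Finset.prod_ite_zero, Finset.prod_const_one,
      Prod.mk.injEq, Finset.mem_univ, true_imp_iff, forall_and, funext_iff, and_assoc]
  rw [withQubits, pairTensor, key]
  obtain ⟨⟨a1, a2⟩, a3, a4⟩ := a
  obtain ⟨⟨b1, b2⟩, b3, b4⟩ := b
  obtain ⟨⟨x1, x2⟩, x3, x4⟩ := x
  obtain ⟨⟨y1, y2⟩, y3, y4⟩ := y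
  simp only [Matrix.single, of_apply, Prod.mk.injEq]
  split_ifs <;> first | rfl | (simp; done) | (exfalso; tauto)

/-- The operators that are products over all pairs span the space of all operators. -/
theorem op_induction {p : Op d n → Prop} (M : Op d n)
    (add : ∀ M N, p M → p N → p (M + N))
    (prod : ∀ X Y, p (withQubits X (pairTensor Y))) : p M := by
  induction M using Matrix.induction_on' with
  | h_zero =>
    have h : withQubits (d := d) (n := n) 0 (pairTensor 0) = 0 := by ext; simp [withQubits]
    exact h ▸ prod 0 0
  | h_add M N hM hN => exact add _ _ hM hN
  | h_std_basis a b c =>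
    rw [single_eq_withQubits]
    exact prod _ _

end Tensor

/-! ### The twirl of one pair as a finite average -/

section SinglePair

variable {m : ℕ}

/-- Conjugation of an operator on one pair by `V ⊗ V*`, with `V*` the entrywise conjugate. -/
def conjPair (V : Matrix (Fin m) (Fin m) ℂ) (Y : Matrix (Fin m × Fin m) (Fin m × Fin m) ℂ) :
    Matrix (Fin m × Fin m) (Fin m × Fin m) ℂ :=
  (V ⊗ₖ V.map star) * Y * (V ⊗ₖ V.map star)ᴴ

theorem conjPair_sum {κ : Type} (s : Finset κ) (V : Matrix (Fin m) (Fin m) ℂ)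
    (Y : κ → Matrix (Fin m × Fin m) (Fin m × Fin m) ℂ) :
    conjPair V (∑ k ∈ s, Y k) = ∑ k ∈ s, conjPair V (Y k) := by
  simp [conjPair, Matrix.mul_sum, Matrix.sum_mul]

theorem conjPair_add (V : Matrix (Fin m) (Fin m) ℂ)
    (Y Z : Matrix (Fin m × Fin m) (Fin m × Fin m) ℂ) :
    conjPair V (Y + Z) = conjPair V Y + conjPair V Z := by
  simp [conjPair, Matrix.mul_add, Matrix.add_mul]

theorem conjPair_smul (c : ℂ) (V : Matrix (Fin m) (Fin m) ℂ)
    (Y : Matrix (Fin m × Fin m) (Fin m × Fin m) ℂ) :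
    conjPair V (c • Y) = c • conjPair V Y := by
  simp [conjPair]

theorem map_star_mul (V W : Matrix (Fin m) (Fin m) ℂ) :
    (V * W).map star = V.map star * W.map star := by
  ext i j
  simp [mul_apply]

theorem map_star_conjTranspose (V : Matrix (Fin m) (Fin m) ℂ) :
    Vᴴ.map star = (V.map star)ᴴ := by
  ext i j
  simp

theorem conjPair_mul (V W : Matrix (Fin m) (Fin m) ℂ)
    (Y : Matrix (Fin m × Fin m) (Fin m × Fin m) ℂ) :
    conjPair (V * W) Y = conjPair V (conjPair W Y) := by
  simp only [conjPair, map_star_mul, mul_kronecker_mul, conjTranspose_mul, Matrix.mul_assoc]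

theorem conjPair_apply (V : Matrix (Fin m) (Fin m) ℂ)
    (Y : Matrix (Fin m × Fin m) (Fin m × Fin m) ℂ) (p q : Fin m × Fin m) :
    conjPair V Y p q = ∑ r, ∑ s, V p.1 r.1 * star (V p.2 r.2) * Y r s *
      (star (V q.1 s.1) * V q.2 s.2) := by
  simp only [conjPair, mul_apply, conjTranspose_apply, kroneckerMap_apply, Matrix.map_apply,
    Finset.sum_mul]
  rw [Finset.sum_comm]
  simp

theorem conjPair_diagonal (z : Fin m → ℂ)
    (Y : Matrix (Fin m × Fin m) (Fin m × Fin m) ℂ) (p q : Fin m × Fin m) :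
    conjPair (diagonal z) Y p q = z p.1 * star (z p.2) * Y p q * (star (z q.1) * z q.2) := by
  have h : (diagonal z).map star = diagonal (fun i => star (z i)) := by
    ext i j
    by_cases hij : i = j <;> simp [hij, diagonal]
  rw [conjPair, h, diagonal_kronecker_diagonal, diagonal_conjTranspose, mul_diagonal, diagonal_mul]
  simp

/-- The unitary that sends the basis vector `π i` to the basis vector `i`. -/
def permUnitary (π : Equiv.Perm (Fin m)) : Matrix.unitaryGroup (Fin m) ℂ :=
  ⟨of fun i a => if π i = a then 1 else 0, by
    rw [mem_unitaryGroup_iff]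
    ext i j
    simp [mul_apply, star_apply, one_apply, eq_comm]⟩

theorem conjPair_perm (π : Equiv.Perm (Fin m))
    (Y : Matrix (Fin m × Fin m) (Fin m × Fin m) ℂ) (p q : Fin m × Fin m) :
    conjPair (permUnitary π).1 Y p q =
      Y (π p.1, π p.2) (π q.1, π q.2) := by
  rw [conjPair_apply, Finset.sum_eq_single (π p.1, π p.2), Finset.sum_eq_single (π q.1, π q.2)]
  · simp [permUnitary]
  · rintro ⟨a, b⟩ - h
    have : π q.1 ≠ a ∨ π q.2 ≠ b := by
      by_contra! h'
      exact h (by rw [h'.1, h'.2])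
    rcases this with h | h <;> simp [permUnitary, h]
  · simp
  · rintro ⟨a, b⟩ - h
    have : π p.1 ≠ a ∨ π p.2 ≠ b := by
      by_contra! h'
      exact h (by rw [h'.1, h'.2])
    rcases this with h | h <;> simp [permUnitary, h]
  · simp

/-- The unnormalised maximally entangled vector `∑ i, |ii⟩`. -/
def entVec (m : ℕ) : Fin m × Fin m → ℂ := fun p => if p.1 = p.2 then 1 else 0

theorem maxEnt_eq (m : ℕ) :
    maxEnt m = (1 / (m : ℂ)) • vecMulVec (entVec m) (star (entVec m)) := by
  ext p q
  simp only [maxEnt, entVec, vecMulVec_apply, Matrix.smul_apply, smul_eq_mul, Pi.star_apply]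
  by_cases h1 : p.1 = p.2 <;> by_cases h2 : q.1 = q.2 <;> simp [h1, h2]

theorem kronecker_mulVec_entVec (V : Matrix (Fin m) (Fin m) ℂ) (hV : V * Vᴴ = 1) :
    (V ⊗ₖ V.map star) *ᵥ entVec m = entVec m := by
  ext p
  have := congrFun (congrFun hV p.1) p.2
  simp only [mul_apply, conjTranspose_apply, one_apply] at this
  simp [mulVec, dotProduct, Fintype.sum_prod_type, entVec, kroneckerMap_apply, ← this]

theorem conjPair_maxEnt (V : Matrix (Fin m) (Fin m) ℂ) (hV : V * Vᴴ = 1) :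
    conjPair V (maxEnt m) = maxEnt m := by
  rw [maxEnt_eq, conjPair_smul]
  congr 1
  rw [conjPair, mul_vecMulVec, vecMulVec_mul, vecMul_conjTranspose, star_star,
    kronecker_mulVec_entVec V hV]

theorem conjPair_one (V : Matrix (Fin m) (Fin m) ℂ) (hV : V * Vᴴ = 1) :
    conjPair V 1 = 1 := by
  have h : V.map star * (V.map star)ᴴ = 1 := by
    have := congrArg (fun M => M.map star) hV
    simp only [map_star_mul, map_star_conjTranspose] at this
    rw [this]
    ext i j
    by_cases h : i = j <;> simp [one_apply, h]
  rw [conjPair, Matrix.mul_one, conjTranspose_kronecker, ← mul_kronecker_mul, hV, h,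
    one_kronecker_one]

theorem conjPair_complEnt (V : Matrix (Fin m) (Fin m) ℂ) (hV : V * Vᴴ = 1) :
    conjPair V (complEnt m) = complEnt m := by
  have h : (1 : Matrix (Fin m × Fin m) (Fin m × Fin m) ℂ) - maxEnt m =
      1 + (-1 : ℂ) • maxEnt m := by simp [sub_eq_add_neg]
  rw [complEnt, conjPair_smul, h, conjPair_add, conjPair_one V hV, conjPair_smul,
    conjPair_maxEnt V hV]

theorem maxEnt_mul_self (hm : m ≠ 0) : maxEnt m * maxEnt m = maxEnt m := by
  have : entVec m ⬝ᵥ entVec m = m := by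
    simp [dotProduct, Fintype.sum_prod_type, entVec]
  have h2 : star (entVec m) = entVec m := by
    ext p; simp only [entVec, Pi.star_apply]; split_ifs <;> simp
  rw [maxEnt_eq, smul_mul_smul_comm, vecMulVec_mul_vecMulVec, h2, this, vecMulVec_smul,
    smul_smul]
  congr 1
  have : (m : ℂ) ≠ 0 := by exact_mod_cast hm
  field_simp

theorem trace_maxEnt (hm : m ≠ 0) : (maxEnt m).trace = 1 := by
  have : (m : ℂ) ≠ 0 := by exact_mod_cast hm
  simp [trace, maxEnt, Fintype.sum_prod_type, this]

theorem maxEnt_posSemidef (m : ℕ) : (maxEnt m).PosSemidef := by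
  rw [maxEnt_eq]
  refine (posSemidef_vecMulVec_self_star _).smul ?_
  positivity

theorem maxEnt_conjTranspose (m : ℕ) : (maxEnt m)ᴴ = maxEnt m :=
  (maxEnt_posSemidef m).1

theorem trace_maxEnt_conjPair (V : Matrix (Fin m) (Fin m) ℂ) (hV : V * Vᴴ = 1)
    (Y : Matrix (Fin m × Fin m) (Fin m × Fin m) ℂ) :
    (maxEnt m * conjPair V Y).trace = (maxEnt m * Y).trace := by
  have hV' : Vᴴ * Vᴴᴴ = 1 := by rw [conjTranspose_conjTranspose]; exact mul_eq_one_comm.1 hV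
  have h := conjPair_maxEnt Vᴴ hV'
  have e : (Vᴴ ⊗ₖ Vᴴ.map star) = (V ⊗ₖ V.map star)ᴴ := by
    rw [conjTranspose_kronecker, map_star_conjTranspose]
  rw [conjPair, e, conjTranspose_conjTranspose] at h
  conv_rhs => rw [← h]
  rw [conjPair, ← Matrix.mul_assoc (maxEnt m), trace_mul_comm]
  simp only [Matrix.mul_assoc]

theorem trace_conjPair (V : Matrix (Fin m) (Fin m) ℂ) (hV : V * Vᴴ = 1)
    (Y : Matrix (Fin m × Fin m) (Fin m × Fin m) ℂ) :
    (conjPair V Y).trace = Y.trace := by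
  have hV' : Vᴴ * Vᴴᴴ = 1 := by rw [conjTranspose_conjTranspose]; exact mul_eq_one_comm.1 hV
  have h := conjPair_one Vᴴ hV'
  have e : (Vᴴ ⊗ₖ Vᴴ.map star) = (V ⊗ₖ V.map star)ᴴ := by
    rw [conjTranspose_kronecker, map_star_conjTranspose]
  rw [conjPair, e, conjTranspose_conjTranspose, Matrix.mul_one] at h
  rw [conjPair, trace_mul_comm, ← Matrix.mul_assoc, h, Matrix.one_mul]

/-- A map that is a finite convex combination of conjugations by `V ⊗ V*` with `V` unitary. -/
def IsAverage (Φ : Matrix (Fin m × Fin m) (Fin m × Fin m) ℂ →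
    Matrix (Fin m × Fin m) (Fin m × Fin m) ℂ) : Prop :=
  ∃ (κ : Type) (_ : Fintype κ) (w : κ → ℝ) (V : κ → Matrix.unitaryGroup (Fin m) ℂ),
    (∀ k, 0 ≤ w k) ∧ ∑ k, w k = 1 ∧ ∀ Y, Φ Y = ∑ k, (w k : ℂ) • conjPair (V k).1 Y

theorem unitary_mul_conjTranspose (V : Matrix.unitaryGroup (Fin m) ℂ) : V.1 * V.1ᴴ = 1 :=
  mem_unitaryGroup_iff.1 V.2

theorem isAverage_conjPair (V : Matrix.unitaryGroup (Fin m) ℂ) :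
    IsAverage (conjPair V.1) :=
  ⟨Unit, inferInstance, fun _ => 1, fun _ => V, by simp, by simp, by simp⟩

theorem isAverage_uniform {κ : Type} [Fintype κ] [Nonempty κ]
    (V : κ → Matrix.unitaryGroup (Fin m) ℂ) :
    IsAverage fun Y => ((Fintype.card κ : ℂ)⁻¹) • ∑ k, conjPair (V k).1 Y :=
  ⟨κ, inferInstance, fun _ => (Fintype.card κ : ℝ)⁻¹, V, fun _ => by positivity,
    by simp, fun Y => by simp [Finset.smul_sum]⟩

theorem IsAverage.comp {Φ Ψ : Matrix (Fin m × Fin m) (Fin m × Fin m) ℂ →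
    Matrix (Fin m × Fin m) (Fin m × Fin m) ℂ} (hΦ : IsAverage Φ) (hΨ : IsAverage Ψ) :
    IsAverage fun Y => Φ (Ψ Y) := by
  obtain ⟨κ, _, w, V, hw, hs, h⟩ := hΦ
  obtain ⟨κ', _, w', V', hw', hs', h'⟩ := hΨ
  refine ⟨κ × κ', inferInstance, fun k => w k.1 * w' k.2, fun k => V k.1 * V' k.2,
    fun k => mul_nonneg (hw _) (hw' _), ?_, fun Y => ?_⟩
  · rw [Fintype.sum_prod_type]
    simp [← Finset.mul_sum, hs, hs']
  · simp only [h, Fintype.sum_prod_type]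
    refine Finset.sum_congr rfl fun k _ => ?_
    rw [h', conjPair_sum, Finset.smul_sum]
    refine Finset.sum_congr rfl fun l _ => ?_
    rw [conjPair_smul, smul_smul, ← conjPair_mul]
    simp

theorem IsAverage.mix {Φ Ψ : Matrix (Fin m × Fin m) (Fin m × Fin m) ℂ →
    Matrix (Fin m × Fin m) (Fin m × Fin m) ℂ} (hΦ : IsAverage Φ) (hΨ : IsAverage Ψ)
    {a b : ℝ} (ha : 0 ≤ a) (hb : 0 ≤ b) (hab : a + b = 1) :
    IsAverage fun Y => (a : ℂ) • Φ Y + (b : ℂ) • Ψ Y := by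
  obtain ⟨κ, _, w, V, hw, hs, h⟩ := hΦ
  obtain ⟨κ', _, w', V', hw', hs', h'⟩ := hΨ
  refine ⟨κ ⊕ κ', inferInstance, Sum.elim (fun k => a * w k) (fun k => b * w' k),
    Sum.elim V V', ?_, ?_, fun Y => ?_⟩
  · rintro (k | k)
    · exact mul_nonneg ha (hw k)
    · exact mul_nonneg hb (hw' k)
  · simp [← Finset.mul_sum, hs, hs', hab]
  · simp [h, h', Finset.smul_sum, smul_smul]

/-- Averages preserve the two invariants `tr Y` and `tr (P Y)` of the twirl. -/
theorem IsAverage.trace_eq {Φ : Matrix (Fin m × Fin m) (Fin m × Fin m) ℂ →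
    Matrix (Fin m × Fin m) (Fin m × Fin m) ℂ} (hΦ : IsAverage Φ)
    (Y : Matrix (Fin m × Fin m) (Fin m × Fin m) ℂ) :
    (Φ Y).trace = Y.trace ∧ (maxEnt m * Φ Y).trace = (maxEnt m * Y).trace := by
  obtain ⟨κ, _, w, V, hw, hs, h⟩ := hΦ
  have hs' : ∑ k, (w k : ℂ) = 1 := by exact_mod_cast hs
  rw [h]
  constructor
  · simp [trace_sum, trace_conjPair _ (unitary_mul_conjTranspose _), ← Finset.sum_mul, hs']
  · simp [Matrix.mul_sum, trace_sum, trace_maxEnt_conjPair _ (unitary_mul_conjTranspose _),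
      ← Finset.sum_mul, hs']

/-- The part of an operator on one pair that commutes with all `D ⊗ D*`, `D` diagonal unitary. -/
def phasePart (Y : Matrix (Fin m × Fin m) (Fin m × Fin m) ℂ) :
    Matrix (Fin m × Fin m) (Fin m × Fin m) ℂ :=
  fun p q => if (p.1 = p.2 ∧ q.1 = q.2) ∨ p = q then Y p q else 0

/-- Averaging over diagonal matrices of cube roots of unity produces `phasePart`: in every
other matrix entry some index occurs with a phase that is not cancelled. -/
theorem isAverage_phasePart : IsAverage (phasePart (m := m)) := by
  obtain ⟨ζ, hζ⟩ : ∃ ζ : ℂ, IsPrimitiveRoot ζ 3 := ⟨_, Complex.isPrimitiveRoot_exp 3 (by norm_num)⟩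
  have h3 : ζ ^ 3 = 1 := hζ.pow_eq_one
  have hsum : 1 + ζ + ζ ^ 2 = 0 := by
    have := hζ.geom_sum_eq_zero (by norm_num)
    simpa [Finset.sum_range_succ] using this
  have hstar : ζ * star ζ = 1 := by
    have h : ‖ζ‖ = 1 := hζ.norm'_eq_one (by norm_num)
    rw [Complex.star_def, Complex.mul_conj, Complex.normSq_eq_norm_sq, h]
    simp
  have hst : star ζ = ζ ^ 2 := by
    have h0 : ζ ≠ 0 := hζ.ne_zero (by norm_num)
    apply mul_left_cancel₀ h0
    rw [hstar, ← h3]; ring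
  have hpow : ∀ u : ℕ, ζ ^ u * star (ζ ^ u) = 1 := fun u => by
    rw [star_pow, ← mul_pow, hstar, one_pow]
  let V : (Fin m → Fin 3) → Matrix.unitaryGroup (Fin m) ℂ := fun ε =>
    ⟨diagonal fun i => ζ ^ (ε i : ℕ), by
      rw [mem_unitaryGroup_iff, star_eq_conjTranspose, diagonal_conjTranspose,
        diagonal_mul_diagonal]
      simp only [Pi.star_apply, hpow, diagonal_one]⟩
  -- each entry of the average factorises into averages over the single phases
  convert isAverage_uniform V using 1
  ext Y ⟨i, j⟩ ⟨i', j'⟩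
  simp only [V, Matrix.smul_apply, Matrix.sum_apply, conjPair_diagonal, Fintype.card_pi,
    Fintype.card_fin, Finset.prod_const, Finset.card_univ, smul_eq_mul, phasePart]
  have hm : ((3 : ℕ) ^ m : ℂ) ≠ 0 := by positivity
  by_cases hc : (i = j ∧ i' = j') ∨ (i, j) = (i', j')
  · rw [if_pos hc, Finset.sum_congr rfl (g := fun _ => Y (i, j) (i', j'))]
    · simp only [Finset.sum_const, Finset.card_univ, Fintype.card_pi, Fintype.card_fin,
        Finset.prod_const, nsmul_eq_mul]
      push_cast
      field_simp
    · intro ε _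
      rcases hc with ⟨rfl, rfl⟩ | h
      · linear_combination (Y (i, i) (i', i')) * (hpow (ε i) * (ζ ^ (ε i' : ℕ) *
          star (ζ ^ (ε i' : ℕ))) + hpow (ε i'))
      · obtain ⟨rfl, rfl⟩ := Prod.mk.inj h
        linear_combination (Y (i, j) (i, j)) * (hpow (ε i) * (ζ ^ (ε j : ℕ) *
          star (ζ ^ (ε j : ℕ))) + hpow (ε j))
  · rw [if_neg hc]
    let g : Fin m → Fin 3 → ℂ := fun l u =>
      (if l = i then ζ ^ (u : ℕ) else 1) * (if l = j then star (ζ ^ (u : ℕ)) else 1) *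
      ((if l = i' then star (ζ ^ (u : ℕ)) else 1) * (if l = j' then ζ ^ (u : ℕ) else 1))
    have hg : ∀ ε : Fin m → Fin 3, ζ ^ (ε i : ℕ) * star (ζ ^ (ε j : ℕ)) * Y (i, j) (i', j') *
        (star (ζ ^ (ε i' : ℕ)) * ζ ^ (ε j' : ℕ)) = Y (i, j) (i', j') * ∏ l, g l (ε l) := by
      intro ε
      simp only [g, Finset.prod_mul_distrib, Finset.prod_ite_eq', Finset.mem_univ, if_true]
      ring
    have hz : ∃ l, ∑ u, g l u = 0 := by
      simp only [Prod.mk.injEq] at hc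
      simp only [g, Fin.sum_univ_three, star_pow, hst]
      by_cases hij : i = j
      · subst hij
        have h1 : i' ≠ j' := fun h => hc (Or.inl ⟨rfl, h⟩)
        refine ⟨i', ?_⟩
        by_cases h2 : i' = i
        · subst h2
          simp [h1]
          linear_combination hsum + (ζ ^ 2 + ζ * (ζ ^ 6 + ζ ^ 3 + 1)) * h3
        · simp [h1, h2]
          linear_combination hsum + ζ * h3
      · by_cases h2 : i = i'
        · subst h2
          have h1 : j ≠ j' := fun h => hc (Or.inr ⟨rfl, h⟩)
          refine ⟨j, ?_⟩
          simp [Ne.symm hij, h1]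
          linear_combination hsum + ζ * h3
        · refine ⟨i, ?_⟩
          by_cases h3' : i = j'
          · simp [hij, h2, ← h3']
            linear_combination hsum + ζ * h3
          · simp [hij, h2, h3']
            linear_combination hsum
    obtain ⟨l, hl⟩ := hz
    simp only [hg, ← Finset.mul_sum]
    rw [← Fintype.piFinset_univ, ← Finset.prod_univ_sum,
      Finset.prod_eq_zero (Finset.mem_univ l) hl]
    simp

/-- Average over simultaneous permutations of the two bases. -/
noncomputable def permPart (Y : Matrix (Fin m × Fin m) (Fin m × Fin m) ℂ) :
    Matrix (Fin m × Fin m) (Fin m × Fin m) ℂ :=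
  ((Fintype.card (Equiv.Perm (Fin m)) : ℂ)⁻¹) • ∑ π, conjPair (permUnitary π).1 Y

theorem isAverage_permPart : IsAverage (permPart (m := m)) := isAverage_uniform permUnitary

/-- The operator `∑ i, |ii⟩⟨ii|`. -/
def diagEnt (m : ℕ) : Matrix (Fin m × Fin m) (Fin m × Fin m) ℂ :=
  fun p q => if p.1 = p.2 ∧ p = q then 1 else 0

theorem permPart_apply (Y : Matrix (Fin m × Fin m) (Fin m × Fin m) ℂ) (p q : Fin m × Fin m) :
    permPart Y p q = ((Fintype.card (Equiv.Perm (Fin m)) : ℂ)⁻¹) *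
      ∑ π : Equiv.Perm (Fin m), Y (π p.1, π p.2) (π q.1, π q.2) := by
  simp only [permPart, Matrix.smul_apply, Matrix.sum_apply, conjPair_perm, smul_eq_mul]

theorem permPart_perm (Y : Matrix (Fin m × Fin m) (Fin m × Fin m) ℂ) (τ : Equiv.Perm (Fin m))
    (p q : Fin m × Fin m) :
    permPart Y (τ p.1, τ p.2) (τ q.1, τ q.2) = permPart Y p q := by
  rw [permPart_apply, permPart_apply]
  congr 1
  exact Fintype.sum_equiv (Equiv.mulRight τ) _ _ (fun π => by simp)

/-- Averaging over the monomial unitaries leaves a three-parameter family, since permutations act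
transitively on pairs of distinct basis vectors. -/
theorem exists_permPart_phasePart (hm : 2 ≤ m)
    (Y : Matrix (Fin m × Fin m) (Fin m × Fin m) ℂ) :
    ∃ a b c : ℂ, permPart (phasePart Y) = a • maxEnt m + b • 1 + c • diagEnt m := by
  have hm0 : (m : ℂ) ≠ 0 := by
    have : m ≠ 0 := by omega
    exact_mod_cast this
  obtain ⟨u, v, huv⟩ : ∃ u v : Fin m, u ≠ v :=
    ⟨⟨0, by omega⟩, ⟨1, by omega⟩, by simp⟩
  have htrans : ∀ {i j : Fin m}, i ≠ j → ∃ τ : Equiv.Perm (Fin m), τ u = i ∧ τ v = j := by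
    intro i j hij
    have := (MulAction.is_two_pretransitive_iff (G := Equiv.Perm (Fin m)) (α := Fin m)).1
      (Equiv.Perm.isMultiplyPretransitive _ 2) huv hij
    simpa using this
  set Z := permPart (phasePart Y) with hZ
  have hinv : ∀ (τ : Equiv.Perm (Fin m)) (p q : Fin m × Fin m),
      Z (τ p.1, τ p.2) (τ q.1, τ q.2) = Z p q := fun τ p q => permPart_perm _ τ p q
  refine ⟨m * Z (u, u) (v, v), Z (u, v) (u, v),
    Z (u, u) (u, u) - Z (u, u) (v, v) - Z (u, v) (u, v), ?_⟩
  ext ⟨i, j⟩ ⟨i', j'⟩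
  simp only [Matrix.add_apply, Matrix.smul_apply, smul_eq_mul, maxEnt, one_apply, diagEnt,
    Prod.mk.injEq]
  by_cases hc : (i = j ∧ i' = j') ∨ (i, j) = (i', j')
  · rcases hc with ⟨rfl, rfl⟩ | h
    · by_cases hii : i = i'
      · subst hii
        obtain ⟨τ, h1, -⟩ := htrans (i := i) (j := if i = u then v else u) (by
          split_ifs with h
          · rw [h]; exact huv
          · exact h)
        have := hinv τ (u, u) (u, u)
        simp only [h1] at this
        simp [this]
        field_simp
        ring
      · obtain ⟨τ, h1, h2⟩ := htrans hii
        have := hinv τ (u, u) (v, v)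
        simp only [h1, h2] at this
        simp [this, hii]
        field_simp
    · obtain ⟨rfl, rfl⟩ := Prod.mk.inj h
      by_cases hij : i = j
      · subst hij
        obtain ⟨τ, h1, -⟩ := htrans (i := i) (j := if i = u then v else u) (by
          split_ifs with h
          · rw [h]; exact huv
          · exact h)
        have := hinv τ (u, u) (u, u)
        simp only [h1] at this
        simp [this]
        field_simp
        ring
      · obtain ⟨τ, h1, h2⟩ := htrans hij
        have := hinv τ (u, v) (u, v)
        simp only [h1, h2] at this
        simp [this, hij]
  · have h0 : Z (i, j) (i', j') = 0 := by
      rw [hZ, permPart_apply, Finset.sum_eq_zero, mul_zero]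
      intro π _
      have : ¬ ((π i = π j ∧ π i' = π j') ∨ (π i, π j) = (π i', π j')) := by
        simpa using hc
      simp only [phasePart]
      rw [if_neg this]
    rw [h0]
    simp only [Prod.mk.injEq] at hc
    have h1 : ¬ (i = j ∧ i' = j') := fun h => hc (Or.inl h)
    have h2 : ¬ (i = i' ∧ j = j') := fun h => hc (Or.inr h)
    simp [h1, h2]

/-- The discrete Fourier transform; only `|F i j|² = 1 / m` is used besides unitarity. -/
theorem exists_flat_unitary (hm : m ≠ 0) :
    ∃ F : Matrix.unitaryGroup (Fin m) ℂ, ∀ i j, F.1 i j * star (F.1 i j) = 1 / (m : ℂ) := by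
  obtain ⟨ζ, hζ⟩ : ∃ ζ : ℂ, IsPrimitiveRoot ζ m := ⟨_, Complex.isPrimitiveRoot_exp m hm⟩
  have hm0 : (m : ℂ) ≠ 0 := by exact_mod_cast hm
  have hζ0 : ζ ≠ 0 := hζ.ne_zero hm
  have hstar : ζ * star ζ = 1 := by
    have h : ‖ζ‖ = 1 := hζ.norm'_eq_one hm
    rw [Complex.star_def, Complex.mul_conj, Complex.normSq_eq_norm_sq, h]
    simp
  have hpow : ∀ u : ℕ, ζ ^ u * star (ζ ^ u) = 1 := fun u => by
    rw [star_pow, ← mul_pow, hstar, one_pow]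
  have hs : ((Real.sqrt m : ℝ) : ℂ)⁻¹ * ((Real.sqrt m : ℝ) : ℂ)⁻¹ = 1 / (m : ℂ) := by
    rw [← mul_inv, ← Complex.ofReal_mul, Real.mul_self_sqrt (by positivity)]
    simp
  have hst : ∀ i j : ℕ, star (((Real.sqrt m : ℝ) : ℂ)⁻¹ * ζ ^ (i * j)) =
      ((Real.sqrt m : ℝ) : ℂ)⁻¹ * star (ζ ^ (i * j)) := by
    intro i j
    rw [star_mul', star_inv₀]
    simp
  refine ⟨⟨of fun i j => ((Real.sqrt m : ℝ) : ℂ)⁻¹ * ζ ^ ((i : ℕ) * (j : ℕ)), ?_⟩, fun i j => ?_⟩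
  · rw [mem_unitaryGroup_iff]
    ext i j
    simp only [mul_apply, star_apply, of_apply, hst]
    have hterm : ∀ k : Fin m, ((Real.sqrt m : ℝ) : ℂ)⁻¹ * ζ ^ ((i : ℕ) * (k : ℕ)) *
        (((Real.sqrt m : ℝ) : ℂ)⁻¹ * star (ζ ^ ((j : ℕ) * (k : ℕ)))) =
        1 / (m : ℂ) * (ζ ^ (i : ℕ) * star (ζ ^ (j : ℕ))) ^ (k : ℕ) := by
      intro k
      rw [← hs, mul_pow, ← star_pow, ← pow_mul, ← pow_mul]
      ring
    rw [Finset.sum_congr rfl fun k _ => hterm k, ← Finset.mul_sum]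
    by_cases hij : i = j
    · subst hij
      simp only [hpow, one_pow, one_apply_eq]
      simp [hm0]
    · rw [one_apply_ne hij]
      have hx : ζ ^ (i : ℕ) * star (ζ ^ (j : ℕ)) ≠ 1 := by
        intro h
        apply hij
        apply Fin.ext
        apply hζ.pow_inj i.2 j.2
        have := congrArg (fun z => z * ζ ^ (j : ℕ)) h
        simp only [one_mul] at this
        rw [← this, mul_assoc, mul_comm (star _), hpow, mul_one]
      have hxm : (ζ ^ (i : ℕ) * star (ζ ^ (j : ℕ))) ^ m = 1 := by
        rw [mul_pow, ← star_pow, ← pow_mul, ← pow_mul, mul_comm (i : ℕ), mul_comm (j : ℕ),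
          pow_mul, pow_mul, hζ.pow_eq_one]
        simp
      rw [Fin.sum_univ_eq_sum_range (fun k => (ζ ^ (i : ℕ) * star (ζ ^ (j : ℕ))) ^ k),
        geom_sum_eq hx, hxm]
      simp
  · simp only [of_apply, hst]
    rw [mul_mul_mul_comm, hs, hpow, mul_one]

/-- Modulo the span of `P` and `1`, conjugation by a flat unitary followed by `phasePart` multiplies
`∑ i, |ii⟩⟨ii|` by `-1 / m`. Mixing the unitary with the identity in the ratio `m : 1` therefore removes this
term. -/
theorem phasePart_conjPair_diagEnt (F : Matrix.unitaryGroup (Fin m) ℂ)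
    (hF : ∀ i j, F.1 i j * star (F.1 i j) = 1 / (m : ℂ)) (hm : m ≠ 0) :
    phasePart (conjPair F.1 (diagEnt m)) =
      maxEnt m + (1 / (m : ℂ)) • (1 - diagEnt m) := by
  have hm0 : (m : ℂ) ≠ 0 := by exact_mod_cast hm
  have hentry : ∀ i j i' j', conjPair F.1 (diagEnt m) (i, j) (i', j') =
      ∑ a, F.1 i a * star (F.1 j a) * (star (F.1 i' a) * F.1 j' a) := by
    intro i j i' j'
    rw [conjPair_apply]
    simp only [Fintype.sum_prod_type, diagEnt, Prod.mk.injEq]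
    refine Finset.sum_congr rfl fun a _ => ?_
    rw [Finset.sum_eq_single a, Finset.sum_eq_single a, Finset.sum_eq_single a]
    · simp
    · intro b _ hb; simp [Ne.symm hb]
    · simp
    · intro b _ hb; simp [Ne.symm hb]
    · simp
    · intro b _ hb; simp [Ne.symm hb]
    · simp
  ext ⟨i, j⟩ ⟨i', j'⟩
  simp only [phasePart, hentry, Matrix.add_apply, Matrix.smul_apply, Matrix.sub_apply, smul_eq_mul,
    maxEnt, one_apply, diagEnt, Prod.mk.injEq]
  by_cases h1 : i = j ∧ i' = j'
  · obtain ⟨rfl, rfl⟩ := h1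
    have : ∀ a, F.1 i a * star (F.1 i a) * (star (F.1 i' a) * F.1 i' a) =
        1 / (m : ℂ) * (1 / (m : ℂ)) := fun a => by
      rw [hF, mul_comm (star _), hF]
    simp only [this]
    simp [hm0]
  · by_cases h2 : i = i' ∧ j = j'
    · obtain ⟨rfl, rfl⟩ := h2
      have : ∀ a, F.1 i a * star (F.1 j a) * (star (F.1 i a) * F.1 j a) =
          1 / (m : ℂ) * (1 / (m : ℂ)) := fun a => by
        rw [mul_mul_mul_comm, hF, mul_comm (star _), hF]
      have hij : i ≠ j := fun h => h1 ⟨h, h⟩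
      simp only [this]
      simp [hm0, hij]
    · simp [h1, h2]

theorem phasePart_add (Y Z : Matrix (Fin m × Fin m) (Fin m × Fin m) ℂ) :
    phasePart (Y + Z) = phasePart Y + phasePart Z := by
  ext p q; simp only [phasePart, Matrix.add_apply]; split_ifs <;> simp

theorem phasePart_smul (c : ℂ) (Y : Matrix (Fin m × Fin m) (Fin m × Fin m) ℂ) :
    phasePart (c • Y) = c • phasePart Y := by
  ext p q; simp only [phasePart, Matrix.smul_apply]; split_ifs <;> simp

theorem phasePart_maxEnt : phasePart (maxEnt m) = maxEnt m := by
  ext p q; simp only [phasePart, maxEnt]; split_ifs <;> first | rfl | (exfalso; tauto)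

theorem phasePart_one : phasePart (1 : Matrix (Fin m × Fin m) (Fin m × Fin m) ℂ) = 1 := by
  ext p q; simp only [phasePart, one_apply]; split_ifs <;> first | rfl | (exfalso; tauto)

theorem phasePart_diagEnt : phasePart (diagEnt m) = diagEnt m := by
  ext p q; simp only [phasePart, diagEnt]; split_ifs <;> first | rfl | (exfalso; tauto)

/-- The twirl of one pair: the projection onto the span of `P` and `1 - P` is a finite convex
combination of conjugations by local unitaries `V ⊗ V*`. -/
theorem isAverage_twirl (hm : 2 ≤ m) :
    IsAverage fun Y : Matrix (Fin m × Fin m) (Fin m × Fin m) ℂ =>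
      (maxEnt m * Y).trace • maxEnt m + ((1 - maxEnt m) * Y).trace • complEnt m := by
  have hm1 : m ≠ 0 := by omega
  have hm0 : (m : ℂ) ≠ 0 := by exact_mod_cast hm1
  have hm1' : (m : ℂ) + 1 ≠ 0 := by exact_mod_cast Nat.succ_ne_zero m
  have hm2 : (m : ℂ) ^ 2 - 1 ≠ 0 := by
    have h : (m : ℂ) - 1 ≠ 0 := by
      rw [sub_ne_zero]
      have : m ≠ 1 := by omega
      exact_mod_cast this
    have := mul_ne_zero h hm1'
    intro h0
    apply this
    linear_combination h0
  obtain ⟨F, hF⟩ := exists_flat_unitary hm1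
  have havg := ((isAverage_phasePart (m := m)).comp
    (((isAverage_conjPair 1).mix (isAverage_conjPair F) (a := 1 / (m + 1)) (b := m / (m + 1))
      (by positivity) (by positivity) (by field_simp; ring)).comp
      ((isAverage_permPart (m := m)).comp isAverage_phasePart)))
  convert havg using 1
  ext1 Y
  have htr := havg.trace_eq Y
  obtain ⟨a, b, c, h⟩ := exists_permPart_phasePart hm Y
  have hone : ∀ Z : Matrix (Fin m × Fin m) (Fin m × Fin m) ℂ,
      conjPair (1 : Matrix.unitaryGroup (Fin m) ℂ).1 Z = Z := by
    intro Z
    have : ((1 : Matrix.unitaryGroup (Fin m) ℂ).1).map star = 1 := by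
      ext i j
      by_cases h : i = j <;> simp [one_apply, h]
    rw [conjPair, this]
    simp
  have hF1 := unitary_mul_conjTranspose F
  obtain ⟨a', b', h'⟩ : ∃ a' b' : ℂ,
      phasePart (((1 / ((m : ℝ) + 1) : ℝ) : ℂ) • conjPair (1 : Matrix.unitaryGroup (Fin m) ℂ).1
        (permPart (phasePart Y)) + (((m : ℝ) / (m + 1) : ℝ) : ℂ) •
        conjPair F.1 (permPart (phasePart Y))) = a' • maxEnt m + b' • 1 := by
    refine ⟨a + c * (m / (m + 1)), b + c / (m + 1), ?_⟩
    simp only [h, hone, conjPair_add, conjPair_smul, conjPair_one _ hF1, conjPair_maxEnt _ hF1,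
      phasePart_add, phasePart_smul, phasePart_maxEnt, phasePart_one, phasePart_diagEnt,
      phasePart_conjPair_diagEnt F hF hm1]
    push_cast
    ext p q
    simp only [Matrix.add_apply, Matrix.smul_apply, Matrix.sub_apply, smul_eq_mul]
    field_simp
    ring
  simp only [h'] at htr ⊢
  have ht1 : (1 : Matrix (Fin m × Fin m) (Fin m × Fin m) ℂ).trace = (m : ℂ) ^ 2 := by
    simp [trace_one, sq]
  -- the two coefficients are determined by the traces that averaging preserves
  have e1 : a' + b' * (m : ℂ) ^ 2 = Y.trace := by
    rw [← htr.1, trace_add, trace_smul, trace_smul, trace_maxEnt hm1, ht1]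
    simp
  have e2 : a' + b' = (maxEnt m * Y).trace := by
    rw [← htr.2, Matrix.mul_add, Matrix.mul_smul, Matrix.mul_smul, Matrix.mul_one,
      maxEnt_mul_self hm1, trace_add, trace_smul, trace_smul, trace_maxEnt hm1]
    simp
  rw [Matrix.sub_mul, Matrix.one_mul, trace_sub, ← e1, ← e2, complEnt, smul_smul]
  ext p q
  simp only [Matrix.add_apply, Matrix.smul_apply, Matrix.sub_apply, smul_eq_mul]
  field_simp
  ring

end SinglePair

/-! ### Separable operators -/

section Separable

variable {α β : Type} [Fintype α] [Fintype β]

/-- The normalisation of the summands of a separable operator is immaterial: summands with a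
vanishing factor are dropped, the others are divided by their traces. -/
theorem separableOp_iff {ρ : Matrix (α × β) (α × β) ℂ} :
    SeparableOp ρ ↔ ∃ (κ : Type) (_ : Fintype κ) (A : κ → Matrix α α ℂ) (B : κ → Matrix β β ℂ),
      (∀ k, (A k).PosSemidef ∧ (B k).PosSemidef) ∧ ρ = ∑ k, A k ⊗ₖ B k := by
  classical
  constructor
  · rintro ⟨m, p, A, B, h, rfl⟩
    refine ⟨Fin m, inferInstance, fun k => (p k : ℂ) • A k, B, fun k => ⟨?_, (h k).2.2.2.1⟩, ?_⟩
    · exact (h k).2.1.smul (by exact_mod_cast (h k).1.le)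
    · simp [smul_kronecker]
  · rintro ⟨κ, _, A, B, h, rfl⟩
    let s := {k : κ // A k ≠ 0 ∧ B k ≠ 0}
    let e : Fin (Fintype.card s) ≃ s := (Fintype.equivFin s).symm
    have htr : ∀ {γ : Type} [Fintype γ] {C : Matrix γ γ ℂ}, C.PosSemidef → C ≠ 0 →
        ∃ r : ℝ, 0 < r ∧ C.trace = r := by
      intro γ _ C hC h0
      have h1 : 0 < C.trace :=
        lt_of_le_of_ne hC.trace_nonneg fun h => h0 (hC.trace_eq_zero_iff.1 h.symm)
      obtain ⟨h2, h3⟩ := Complex.lt_def.1 h1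
      exact ⟨C.trace.re, by simpa using h2, Complex.ext rfl (by simpa using h3.symm)⟩
    choose! a ha using fun k (hk : A k ≠ 0) => htr (h k).1 hk
    choose! b hb using fun k (hk : B k ≠ 0) => htr (h k).2 hk
    refine ⟨Fintype.card s, fun i => a (e i).1 * b (e i).1,
      fun i => ((a (e i).1)⁻¹ : ℂ) • A (e i).1, fun i => ((b (e i).1)⁻¹ : ℂ) • B (e i).1,
      fun i => ?_, ?_⟩
    · obtain ⟨hkA, hkB⟩ := (e i).2
      set k := (e i).1
      have h1 := ha k hkA
      have h2 := hb k hkB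
      have h1' : (a k : ℂ) ≠ 0 := by exact_mod_cast h1.1.ne'
      have h2' : (b k : ℂ) ≠ 0 := by exact_mod_cast h2.1.ne'
      refine ⟨mul_pos h1.1 h2.1, (h k).1.smul ?_, ?_, (h k).2.smul ?_, ?_⟩
      · have := inv_nonneg.2 h1.1.le
        exact_mod_cast this
      · rw [trace_smul, h1.2, smul_eq_mul, inv_mul_cancel₀ h1']
      · have := inv_nonneg.2 h2.1.le
        exact_mod_cast this
      · rw [trace_smul, h2.2, smul_eq_mul, inv_mul_cancel₀ h2']
    · have hsum : ∑ k, A k ⊗ₖ B k = ∑ k : s, A k.1 ⊗ₖ B k.1 := by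
        rw [← Finset.sum_filter_of_ne (p := fun k => A k ≠ 0 ∧ B k ≠ 0)]
        · exact Finset.sum_subtype _ (by simp) _
        · intro k _ hk
          constructor <;> intro h0 <;> exact hk (by simp [h0])
      rw [hsum]
      refine (Fintype.sum_equiv e _ _ fun i => ?_).symm
      obtain ⟨hkA, hkB⟩ := (e i).2
      set k := (e i).1
      have h1' : (a k : ℂ) ≠ 0 := by exact_mod_cast (ha k hkA).1.ne'
      have h2' : (b k : ℂ) ≠ 0 := by exact_mod_cast (hb k hkB).1.ne'
      rw [smul_kronecker, kronecker_smul, smul_smul, smul_smul]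
      push_cast
      rw [show (a k * b k * (a k : ℂ)⁻¹ * (b k : ℂ)⁻¹ : ℂ) = 1 by field_simp, one_smul]

theorem separableOp_kronecker {A : Matrix α α ℂ} {B : Matrix β β ℂ} (hA : A.PosSemidef)
    (hB : B.PosSemidef) : SeparableOp (A ⊗ₖ B) :=
  separableOp_iff.2 ⟨Unit, inferInstance, fun _ => A, fun _ => B, fun _ => ⟨hA, hB⟩, by simp⟩

theorem SeparableOp.sum {κ : Type} [Fintype κ] {ρ : κ → Matrix (α × β) (α × β) ℂ}
    (h : ∀ k, SeparableOp (ρ k)) : SeparableOp (∑ k, ρ k) := by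
  choose ι inst A B hAB h using fun k => separableOp_iff.1 (h k)
  refine separableOp_iff.2 ⟨Σ k, ι k, inferInstance, fun x => A x.1 x.2, fun x => B x.1 x.2,
    fun x => hAB x.1 x.2, ?_⟩
  rw [Fintype.sum_sigma]
  exact Finset.sum_congr rfl fun k _ => h k

theorem SeparableOp.smul {ρ : Matrix (α × β) (α × β) ℂ} (h : SeparableOp ρ) {t : ℝ}
    (ht : 0 ≤ t) : SeparableOp ((t : ℂ) • ρ) := by
  obtain ⟨κ, _, A, B, hAB, rfl⟩ := separableOp_iff.1 h
  refine separableOp_iff.2 ⟨κ, inferInstance, fun k => (t : ℂ) • A k, B,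
    fun k => ⟨(hAB k).1.smul (by exact_mod_cast ht), (hAB k).2⟩, ?_⟩
  simp [smul_kronecker, Finset.smul_sum]

theorem SeparableOp.add {ρ σ : Matrix (α × β) (α × β) ℂ} (h : SeparableOp ρ)
    (h' : SeparableOp σ) : SeparableOp (ρ + σ) := by
  have := SeparableOp.sum (κ := Bool) (ρ := fun b => if b then ρ else σ)
    (fun b => by cases b <;> simpa)
  simpa using this

theorem SeparableOp.conj {ρ : Matrix (α × β) (α × β) ℂ} (h : SeparableOp ρ)
    (C : Matrix α α ℂ) (D : Matrix β β ℂ) :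
    SeparableOp ((C ⊗ₖ D) * ρ * (C ⊗ₖ D)ᴴ) := by
  obtain ⟨κ, _, A, B, hAB, rfl⟩ := separableOp_iff.1 h
  refine separableOp_iff.2 ⟨κ, inferInstance, fun k => C * A k * Cᴴ, fun k => D * B k * Dᴴ,
    fun k => ⟨(hAB k).1.mul_mul_conjTranspose_same C, (hAB k).2.mul_mul_conjTranspose_same D⟩, ?_⟩
  rw [Matrix.mul_sum, Matrix.sum_mul, conjTranspose_kronecker]
  simp only [mul_kronecker_mul]

theorem SeparableOp.posSemidef {ρ : Matrix (α × β) (α × β) ℂ} (h : SeparableOp ρ) :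
    ρ.PosSemidef := by
  obtain ⟨κ, _, A, B, hAB, rfl⟩ := separableOp_iff.1 h
  exact posSemidef_sum _ fun k _ => (hAB k).1.kronecker (hAB k).2

end Separable

/-! ### Symmetrised products -/

section Layers

variable {d n : ℕ}

open Polynomial in
/-- The coefficients of a product of linear polynomials. -/
theorem coeff_prod_linear (p q : Fin n → ℂ) (j : ℕ) :
    (∏ i, (C (q i) + C (p i) * X)).coeff j =
      ∑ S ∈ Finset.powersetCard j (Finset.univ : Finset (Fin n)),
        ∏ i, if i ∈ S then p i else q i := by
  have h : ∀ S : Finset (Fin n), (∏ i ∈ S, C (p i) * X) * ∏ i ∈ Finset.univ \ S, C (q i) =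
      C (∏ i, if i ∈ S then p i else q i) * X ^ S.card := by
    intro S
    rw [Finset.prod_mul_distrib, Finset.prod_const, ← Finset.prod_mul_prod_compl S, C_mul,
      ← Finset.compl_eq_univ_sdiff]
    rw [Finset.prod_congr rfl (g := p) fun i hi => if_pos hi,
      Finset.prod_congr rfl (s₁ := Sᶜ) (g := q) fun i hi => if_neg (Finset.mem_compl.1 hi)]
    rw [map_prod, map_prod]
    ring
  simp_rw [add_comm (C (q _))]
  rw [Finset.prod_add, finsetSum_coeff, Finset.powersetCard_eq_filter, Finset.sum_filter]
  refine Finset.sum_congr rfl fun S _ => ?_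
  rw [h, coeff_C_mul, coeff_X_pow]
  simp [eq_comm]

/-- The symmetrised operator whose coefficients, weighted with binomial coefficients, are those
of a polynomial. -/
noncomputable def lay (d n : ℕ) (f : Polynomial ℂ) :
    Matrix ((Fin n → Fin d) × (Fin n → Fin d)) ((Fin n → Fin d) × (Fin n → Fin d)) ℂ :=
  ∑ j ∈ Finset.range (n + 1), (f.coeff j / n.choose j) • layer d n j

theorem lay_add (f g : Polynomial ℂ) : lay d n (f + g) = lay d n f + lay d n g := by
  simp [lay, add_div, add_smul, Finset.sum_add_distrib]

theorem lay_C_mul (c : ℂ) (f : Polynomial ℂ) :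
    lay d n (Polynomial.C c * f) = c • lay d n f := by
  simp [lay, mul_div_assoc, Finset.smul_sum, smul_smul]

/-- The product operator with `P` on the pairs in `S` and the normalised complement elsewhere. -/
noncomputable def layerTerm (d : ℕ) {n : ℕ} (S : Finset (Fin n)) :
    Matrix ((Fin n → Fin d) × (Fin n → Fin d)) ((Fin n → Fin d) × (Fin n → Fin d)) ℂ :=
  pairTensor (fun i => if i ∈ S then maxEnt d else complEnt d)

open Polynomial in
/-- Averaging a product of twirled operators over the permutations of the pairs gives the
symmetrised operator with the generating polynomial `∏ i, (q i + p i z)`. -/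
theorem average_perm_pairTensor (p q : Fin n → ℂ) :
    ((n.factorial : ℂ)⁻¹) • ∑ π : Equiv.Perm (Fin n),
      pairTensor (fun i => p (π i) • maxEnt d + q (π i) • complEnt d) =
      lay d n (∏ i, (C (q i) + C (p i) * X)) := by
  set f := ∏ i, (C (q i) + C (p i) * X) with hf
  let c : Finset (Fin n) → Equiv.Perm (Fin n) → ℂ :=
    fun S π => ∏ i, if i ∈ S then p (π i) else q (π i)
  have h1 : ∀ π : Equiv.Perm (Fin n),
      pairTensor (fun i => p (π i) • maxEnt d + q (π i) • complEnt d) =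
        ∑ S : Finset (Fin n), c S π • layerTerm d S := by
    intro π
    rw [pairTensor_add]
    refine Finset.sum_congr rfl fun S _ => ?_
    rw [layerTerm, ← pairTensor_smul]
    congr 1
    ext1 i
    split_ifs <;> rfl
  -- a permutation carrying `S` to `T` identifies the two averages
  have h2 : ∀ S T : Finset (Fin n), S.card = T.card → ∑ π, c S π = ∑ π, c T π := by
    intro S T hST
    let τ : Equiv.Perm (Fin n) := (Finset.equivOfCardEq hST).extendSubtype
    have hτ : ∀ i, τ i ∈ T ↔ i ∈ S := by
      intro i
      by_cases hi : i ∈ S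
      · simp only [hi, iff_true]
        exact (Finset.equivOfCardEq hST).extendSubtype_mem i hi
      · simp only [hi, iff_false]
        exact (Finset.equivOfCardEq hST).extendSubtype_not_mem i hi
    refine Fintype.sum_equiv (Equiv.mulRight τ⁻¹) _ _ fun π => ?_
    simp only [c]
    refine Fintype.prod_equiv τ _ _ fun i => ?_
    simp [hτ]
  have h3 : ∀ (π : Equiv.Perm (Fin n)) (j : ℕ),
      ∑ S ∈ Finset.powersetCard j Finset.univ, c S π = f.coeff j := by
    intro π j
    rw [← coeff_prod_linear (fun i => p (π i)) (fun i => q (π i)), hf]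
    congr 1
    exact Fintype.prod_equiv π _ _ fun i => rfl
  have hn : (n.factorial : ℂ) ≠ 0 := by exact_mod_cast n.factorial_ne_zero
  have h4 : ∀ j, ∀ S ∈ Finset.powersetCard j (Finset.univ : Finset (Fin n)),
      ((n.factorial : ℂ)⁻¹) * ∑ π, c S π = f.coeff j / n.choose j := by
    intro j S hS
    have hj : S.card = j := (Finset.mem_powersetCard.1 hS).2
    have hch : (n.choose j : ℂ) ≠ 0 := by
      have : j ≤ n := by
        rw [← hj]; simpa using S.card_le_univ
      exact_mod_cast (Nat.choose_pos this).ne'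
    have : (n.choose j : ℂ) * ∑ π, c S π = n.factorial * f.coeff j := by
      calc (n.choose j : ℂ) * ∑ π, c S π
          = ∑ T ∈ Finset.powersetCard j (Finset.univ : Finset (Fin n)), ∑ π, c T π := by
            rw [Finset.sum_congr rfl fun T hT =>
              h2 T S ((Finset.mem_powersetCard.1 hT).2.trans hj.symm)]
            simp
        _ = n.factorial * f.coeff j := by
            rw [Finset.sum_comm, Finset.sum_congr rfl fun π _ => h3 π j]
            simp [Fintype.card_perm]
    field_simp
    linear_combination this
  simp_rw [h1]
  rw [Finset.sum_comm, Finset.smul_sum, lay, ← Finset.powerset_univ, Finset.sum_powerset]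
  simp only [Finset.card_univ, Fintype.card_fin]
  refine Finset.sum_congr rfl fun j _ => ?_
  rw [layer, Finset.smul_sum]
  refine Finset.sum_congr rfl fun S hS => ?_
  rw [← Finset.sum_smul, smul_smul, h4 j S hS]
  rfl

end Layers

/-! ### The twirl of all pairs -/

section Twirl

variable {d n : ℕ}

/-- The symmetry `g ⊗ g*` given by `U`, `V i` and the permutation `π`. -/
def symOp (U : Matrix.unitaryGroup (Fin 2) ℂ) (V : Fin n → Matrix.unitaryGroup (Fin d) ℂ)
    (π : Equiv.Perm (Fin n)) : Op d n :=
  localUnitary (d := d) (n := n) U V π ⊗ₖ (localUnitary U V π).map star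

/-- Relabelling of the basis by a permutation of the pairs. -/
def relabel (d : ℕ) {n : ℕ} (π : Equiv.Perm (Fin n)) :
    Party d n × Party d n ≃ Party d n × Party d n where
  toFun q := ((q.1.1, q.1.2 ∘ π), (q.2.1, q.2.2 ∘ π))
  invFun q := ((q.1.1, q.1.2 ∘ π.symm), (q.2.1, q.2.2 ∘ π.symm))
  left_inv q := by ext <;> simp
  right_inv q := by ext <;> simp

theorem symOp_eq (U : Matrix.unitaryGroup (Fin 2) ℂ) (V : Fin n → Matrix.unitaryGroup (Fin d) ℂ)
    (π : Equiv.Perm (Fin n)) :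
    symOp U V π = (withQubits (U.1 ⊗ₖ U.1.map star)
      (pairTensor fun i => (V i).1 ⊗ₖ (V i).1.map star)).submatrix id (relabel d π) := by
  ext p q
  simp only [symOp, localUnitary, relabel, withQubits, pairTensor, kroneckerMap_apply,
    submatrix_apply, Matrix.map_apply, Finset.prod_mul_distrib, Equiv.coe_fn_mk, id, star_mul',
    Function.comp_apply, star_prod]
  ring

/-- Symmetries act on products pair by pair. -/
theorem symOp_conj (U : Matrix.unitaryGroup (Fin 2) ℂ)
    (V : Fin n → Matrix.unitaryGroup (Fin d) ℂ) (π : Equiv.Perm (Fin n))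
    (X : Matrix (Fin 2 × Fin 2) (Fin 2 × Fin 2) ℂ)
    (Y : Fin n → Matrix (Fin d × Fin d) (Fin d × Fin d) ℂ) :
    symOp U V π * withQubits X (pairTensor Y) * (symOp U V π)ᴴ =
      withQubits (conjPair U.1 X) (pairTensor fun i => conjPair (V i).1 (Y (π i))) := by
  have h : withQubits X (pairTensor Y) =
      (withQubits X (pairTensor fun i => Y (π i))).submatrix (relabel d π) (relabel d π) := by
    ext p q
    simp only [withQubits, pairTensor, relabel, submatrix_apply, Equiv.coe_fn_mk,
      Function.comp_apply]
    congr 1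
    exact (Fintype.prod_equiv π _ _ fun i => rfl).symm
  rw [h, symOp_eq, conjTranspose_submatrix, submatrix_mul_equiv, submatrix_mul_equiv,
    submatrix_id_id, withQubits_mul, withQubits_conjTranspose, withQubits_mul,
    pairTensor_mul, pairTensor_conjTranspose, pairTensor_mul]
  rfl

theorem mem_symmetries {G : Op d n} : G ∈ symmetries d n ↔ ∃ U V π, G = symOp U V π := Iff.rfl

theorem symOp_conj_layer (U : Matrix.unitaryGroup (Fin 2) ℂ)
    (V : Fin n → Matrix.unitaryGroup (Fin d) ℂ) (π : Equiv.Perm (Fin n))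
    {X : Matrix (Fin 2 × Fin 2) (Fin 2 × Fin 2) ℂ} (hX : conjPair U.1 X = X) (j : ℕ) :
    symOp U V π * withQubits X (layer d n j) * (symOp U V π)ᴴ = withQubits X (layer d n j) := by
  rw [layer, withQubits_sum_right, Matrix.mul_sum, Matrix.sum_mul]
  simp only [symOp_conj, hX]
  refine Finset.sum_nbij' (fun S => S.map π.symm.toEmbedding) (fun S => S.map π.toEmbedding)
    ?_ ?_ ?_ ?_ ?_
  · intro S hS; simpa using hS
  · intro S hS; simpa using hS
  · intro S _; ext; simp
  · intro S _; ext; simp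
  · intro S _
    congr 2
    ext1 i
    have hi : i ∈ S.map π.symm.toEmbedding ↔ π i ∈ S := by simp
    by_cases h : π i ∈ S
    · rw [if_pos h, if_pos (hi.2 h), conjPair_maxEnt _ (unitary_mul_conjTranspose _)]
    · rw [if_neg h, if_neg (fun h' => h (hi.1 h')),
        conjPair_complEnt _ (unitary_mul_conjTranspose _)]

theorem symOp_conj_lay (U : Matrix.unitaryGroup (Fin 2) ℂ)
    (V : Fin n → Matrix.unitaryGroup (Fin d) ℂ) (π : Equiv.Perm (Fin n))
    {X : Matrix (Fin 2 × Fin 2) (Fin 2 × Fin 2) ℂ} (hX : conjPair U.1 X = X)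
    (f : Polynomial ℂ) :
    symOp U V π * withQubits X (lay d n f) * (symOp U V π)ᴴ = withQubits X (lay d n f) := by
  simp only [lay, withQubits_sum_right, withQubits_smul_right, Matrix.mul_sum, Matrix.sum_mul,
    Matrix.mul_smul, Matrix.smul_mul, symOp_conj_layer U V π hX]

/-- The invariant operator with generating polynomials `f`, `g`. -/
noncomputable def invOp (d n : ℕ) (f g : Polynomial ℂ) : Op d n :=
  withQubits (complEnt 2) (lay d n f) + withQubits (maxEnt 2) (lay d n g)

theorem invOp_invariant (f g : Polynomial ℂ) {G : Op d n} (hG : G ∈ symmetries d n) :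
    G * invOp d n f g * Gᴴ = invOp d n f g := by
  obtain ⟨U, V, π, rfl⟩ := mem_symmetries.1 hG
  rw [invOp, Matrix.mul_add, Matrix.add_mul,
    symOp_conj_lay U V π (conjPair_complEnt _ (unitary_mul_conjTranspose _)),
    symOp_conj_lay U V π (conjPair_maxEnt _ (unitary_mul_conjTranspose _))]

theorem invOp_add (f g f' g' : Polynomial ℂ) :
    invOp d n (f + f') (g + g') = invOp d n f g + invOp d n f' g' := by
  simp only [invOp, lay_add, withQubits_add_right]
  abel

theorem invOp_smul (c : ℂ) (f g : Polynomial ℂ) :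
    invOp d n (Polynomial.C c * f) (Polynomial.C c * g) = c • invOp d n f g := by
  simp only [invOp, lay_C_mul, withQubits_smul_right, smul_add]

/-- The partial transpose of `1 - F / 2`. -/
noncomputable def halfX (d : ℕ) : Matrix (Fin d × Fin d) (Fin d × Fin d) ℂ :=
  (1 - maxEnt d) + (1 - (d : ℂ) / 2) • maxEnt d

theorem trace_halfX_mul (Y : Matrix (Fin d × Fin d) (Fin d × Fin d) ℂ) :
    (halfX d * Y).trace = Y.trace - (d : ℂ) / 2 * (maxEnt d * Y).trace := by
  simp only [halfX, Matrix.add_mul, Matrix.sub_mul, Matrix.one_mul, Matrix.smul_mul, trace_add,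
    trace_sub, trace_smul, smul_eq_mul]
  ring

/-- The witness is invariant under the symmetry group. -/
theorem trace_witness_symOp (U : Matrix.unitaryGroup (Fin 2) ℂ)
    (V : Fin n → Matrix.unitaryGroup (Fin d) ℂ) (π : Equiv.Perm (Fin n)) (M : Op d n) :
    (witness d n * (symOp U V π * M * (symOp U V π)ᴴ)).trace = (witness d n * M).trace := by
  induction M using op_induction with
  | add M N hM hN =>
    simp only [Matrix.mul_add, Matrix.add_mul, trace_add] at *
    rw [hM, hN]
  | prod X Y =>
    rw [symOp_conj, witness, withQubits_mul, withQubits_mul, trace_withQubits, trace_withQubits,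
      pairTensor_mul, pairTensor_mul, trace_pairTensor, trace_pairTensor,
      trace_maxEnt_conjPair _ (unitary_mul_conjTranspose _)]
    congr 1
    refine Fintype.prod_equiv π _ _ fun i => ?_
    have h := fun Z => trace_halfX_mul (d := d) Z
    rw [halfX] at h
    rw [h, h, trace_maxEnt_conjPair _ (unitary_mul_conjTranspose _),
      trace_conjPair _ (unitary_mul_conjTranspose _)]

/-- `Φ` is a finite average over the symmetry group with the stated values on products, which are
invariant operators. As the products span all operators, `Φ` is the twirl. -/
structure IsTwirlMap (Φ : Op d n → Op d n) : Prop where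
  average : ∃ (κ : Type) (_ : Fintype κ) (w : κ → ℝ) (G : κ → Op d n),
    (∀ k, 0 ≤ w k) ∧ ∑ k, w k = 1 ∧ (∀ k, G k ∈ symmetries d n) ∧
      ∀ M, Φ M = ∑ k, (w k : ℂ) • (G k * M * (G k)ᴴ)
  product : ∀ X Y, Φ (withQubits X (pairTensor Y)) =
    invOp d n (Polynomial.C (((1 - maxEnt 2) * X).trace) *
      ∏ i, (Polynomial.C (((1 - maxEnt d) * Y i).trace) +
        Polynomial.C ((maxEnt d * Y i).trace) * Polynomial.X))
      (Polynomial.C ((maxEnt 2 * X).trace) *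
      ∏ i, (Polynomial.C (((1 - maxEnt d) * Y i).trace) +
        Polynomial.C ((maxEnt d * Y i).trace) * Polynomial.X))

/-- The twirls of the single pairs and the average over their permutations combine to a twirl of the
whole system. -/
theorem exists_isTwirlMap (hd : 2 ≤ d) (n : ℕ) : ∃ Φ : Op d n → Op d n, IsTwirlMap Φ := by
  obtain ⟨κ₂, _, w₂, V₂, hw₂, hs₂, h₂⟩ := isAverage_twirl (m := 2) le_rfl
  obtain ⟨κ, _, w, V, hw, hs, h⟩ := isAverage_twirl hd
  let K := κ₂ × (Fin n → κ) × Equiv.Perm (Fin n)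
  let W : K → ℝ := fun k => w₂ k.1 * ((∏ i, w (k.2.1 i)) * (n.factorial : ℝ)⁻¹)
  let G : K → Op d n := fun k => symOp (V₂ k.1) (fun i => V (k.2.1 i)) k.2.2
  refine ⟨fun M => ∑ k, (W k : ℂ) • (G k * M * (G k)ᴴ),
    ⟨K, inferInstance, W, G, fun k => ?_, ?_, fun k => ⟨_, _, _, rfl⟩, fun M => rfl⟩,
    fun X Y => ?_⟩
  · exact mul_nonneg (hw₂ _) (mul_nonneg (Finset.prod_nonneg fun i _ => hw _) (by positivity))
  · have hn : (n.factorial : ℝ) ≠ 0 := by exact_mod_cast n.factorial_ne_zero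
    have hprod : ∑ k : Fin n → κ, ∏ i, w (k i) = 1 := by
      have := Finset.prod_univ_sum (fun _ : Fin n => (Finset.univ : Finset κ)) (fun _ k => w k)
      rw [Fintype.piFinset_univ] at this
      simp [← this, hs]
    simp only [K, W, Fintype.sum_prod_type, Finset.sum_const, Finset.card_univ, Fintype.card_perm,
      Fintype.card_fin, nsmul_eq_mul]
    have e : ∀ a b : ℝ, (n.factorial : ℝ) * (a * (b * (n.factorial : ℝ)⁻¹)) = a * b :=
      fun a b => by field_simp
    simp only [e, ← Finset.mul_sum, hprod, mul_one, hs₂]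
  · have hfac : ∀ π : Equiv.Perm (Fin n),
        ∑ k : Fin n → κ, (∏ i, (w (k i) : ℂ)) •
          pairTensor (fun i => conjPair (V (k i)).1 (Y (π i))) =
        pairTensor (fun i => (maxEnt d * Y (π i)).trace • maxEnt d +
          ((1 - maxEnt d) * Y (π i)).trace • complEnt d) := by
      intro π
      simp only [h, pairTensor_sum, pairTensor_smul]
    have hsym := average_perm_pairTensor (d := d) (fun i => (maxEnt d * Y i).trace)
      (fun i => ((1 - maxEnt d) * Y i).trace)
    calc ∑ k, (W k : ℂ) • (G k * withQubits X (pairTensor Y) * (G k)ᴴ)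
        = withQubits (∑ k₂, (w₂ k₂ : ℂ) • conjPair (V₂ k₂).1 X)
          ((n.factorial : ℂ)⁻¹ • ∑ π : Equiv.Perm (Fin n), ∑ k : Fin n → κ,
            (∏ i, (w (k i) : ℂ)) •
              pairTensor (fun i => conjPair (V (k i)).1 (Y (π i)))) := by
          simp only [K, W, G, symOp_conj, Fintype.sum_prod_type, withQubits_sum_left,
            withQubits_smul_left, withQubits_smul_right, withQubits_sum_right, Finset.smul_sum,
            smul_smul]
          refine (Finset.sum_congr rfl fun k₂ _ => Finset.sum_comm).trans
            (Finset.sum_comm.trans (Finset.sum_congr rfl fun π _ => Finset.sum_comm.trans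
              (Finset.sum_congr rfl fun k _ => Finset.sum_congr rfl fun k₂ _ => ?_)))
          congr 1
          push_cast
          ring
      _ = _ := by
          simp only [hfac]
          rw [hsym, ← h₂, withQubits_add_left, withQubits_smul_left, withQubits_smul_left, invOp,
            lay_C_mul, lay_C_mul, withQubits_smul_right, withQubits_smul_right, add_comm]

variable {Φ : Op d n → Op d n}

theorem IsTwirlMap.map_add (h : IsTwirlMap Φ) (M N : Op d n) : Φ (M + N) = Φ M + Φ N := by
  obtain ⟨κ, _, w, G, -, -, -, h⟩ := h.average
  simp [h, Matrix.mul_add, Matrix.add_mul, Finset.sum_add_distrib]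

theorem IsTwirlMap.map_sum (h : IsTwirlMap Φ) {ι : Type} (s : Finset ι) (M : ι → Op d n) :
    Φ (∑ i ∈ s, M i) = ∑ i ∈ s, Φ (M i) := by
  obtain ⟨κ, _, w, G, -, -, -, h⟩ := h.average
  simp only [h, Matrix.mul_sum, Matrix.sum_mul, Finset.smul_sum]
  exact Finset.sum_comm

theorem IsTwirlMap.mem_convexHull (h : IsTwirlMap Φ) (M : Op d n) :
    Φ M ∈ convexHull ℝ {τ : Op d n | ∃ G ∈ symmetries d n, τ = G * M * Gᴴ} := by
  obtain ⟨κ, _, w, G, h1, h2, h3, h⟩ := h.average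
  rw [h]
  have := (convex_convexHull ℝ {τ : Op d n | ∃ G ∈ symmetries d n, τ = G * M * Gᴴ}).sum_mem
    (t := Finset.univ) (w := w) (z := fun k => G k * M * (G k)ᴴ) (fun k _ => h1 k) h2
    (fun k _ => subset_convexHull _ _ ⟨_, h3 k, rfl⟩)
  convert this using 2
  exact Complex.coe_smul _ _

theorem IsTwirlMap.separableOp (h : IsTwirlMap Φ) {M : Op d n} (hM : SeparableOp M) :
    SeparableOp (Φ M) := by
  obtain ⟨κ, _, w, G, h1, h2, h3, h⟩ := h.average
  rw [h]
  refine SeparableOp.sum fun k => SeparableOp.smul ?_ (h1 k)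
  obtain ⟨U, V, π, hk⟩ := mem_symmetries.1 (h3 k)
  rw [hk]
  exact hM.conj _ _

theorem IsTwirlMap.exists_invOp (h : IsTwirlMap Φ) (M : Op d n) :
    ∃ f g, Φ M = invOp d n f g := by
  induction M using op_induction with
  | add M N hM hN =>
    obtain ⟨f, g, hM⟩ := hM
    obtain ⟨f', g', hN⟩ := hN
    exact ⟨f + f', g + g', by rw [h.map_add, hM, hN, invOp_add]⟩
  | prod X Y => exact ⟨_, _, h.product X Y⟩

theorem IsTwirlMap.trace_witness (h : IsTwirlMap Φ) (M : Op d n) :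
    (witness d n * Φ M).trace = (witness d n * M).trace := by
  obtain ⟨κ, _, w, G, h1, h2, h3, h⟩ := h.average
  have h2' : ∑ k, (w k : ℂ) = 1 := by exact_mod_cast h2
  rw [h, Matrix.mul_sum, trace_sum, Finset.sum_congr rfl
    (g := fun k => (w k : ℂ) * (witness d n * M).trace), ← Finset.sum_mul, h2', one_mul]
  intro k _
  obtain ⟨U, V, π, hk⟩ := mem_symmetries.1 (h3 k)
  rw [Matrix.mul_smul, trace_smul, hk, trace_witness_symOp, smul_eq_mul]

theorem IsTwirlMap.isTwirl (h : IsTwirlMap Φ) (M : Op d n) : IsTwirl M (Φ M) := by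
  refine ⟨fun G hG => ?_, h.mem_convexHull M⟩
  obtain ⟨f, g, hfg⟩ := h.exists_invOp M
  rw [hfg, invOp_invariant f g hG]

end Twirl

/-! ### Block positivity and the witness -/

section BlockPositive

variable {d n : ℕ}

/-- The vector of the bipartite space whose coefficients are the entries of the matrix `M`; its
Schmidt rank is the rank of `M`. -/
def vecOf {α : Type} (M : Matrix α α ℂ) : α × α → ℂ := fun p => M p.1 p.2

/-- The expectation value of `K` in the vector with coefficient matrix `M`. -/
noncomputable def qform {α : Type} [Fintype α] (K : Matrix (α × α) (α × α) ℂ) (M : Matrix α α ℂ) :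
    ℂ :=
  star (vecOf M) ⬝ᵥ K *ᵥ vecOf M

/-- The `n`-th tensor power of the partial transpose of `1 - F / 2` has nonnegative expectation
values in all vectors of Schmidt rank at most two, the latter being written as `Aᵀ * B`. -/
def BlockPositive (d n : ℕ) : Prop :=
  ∀ A B : Matrix (Fin 2) (Fin n → Fin d) ℂ,
    0 ≤ (qform (pairTensor fun _ : Fin n => halfX d) (Aᵀ * B)).re

theorem prodProj_eq (a b : Party d n → ℂ) :
    prodProj a b = vecMulVec (fun p : Party d n × Party d n => a p.1 * b p.2)
      (star fun p : Party d n × Party d n => a p.1 * b p.2) := by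
  ext p q
  simp only [prodProj, kroneckerMap_apply, vecMulVec_apply, Pi.star_apply, star_mul']
  ring

theorem witness_eq : witness d n = withQubits (maxEnt 2) (pairTensor fun _ => halfX d) := rfl

/-- Contracting the qubits with `P₂` turns a product vector `a ⊗ b` into the vector
`∑ s, a_s ⊗ b_s` of Schmidt rank at most two. -/
theorem trace_witness_prodProj (a b : Party d n → ℂ) :
    (witness d n * prodProj a b).trace = (1 / 2 : ℂ) *
      qform (pairTensor fun _ : Fin n => halfX d)
        ((of fun s f => a (s, f) : Matrix (Fin 2) (Fin n → Fin d) ℂ)ᵀ *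
          (of fun s f => b (s, f) : Matrix (Fin 2) (Fin n → Fin d) ℂ)) := by
  set K := pairTensor fun _ : Fin n => halfX d with hK
  set M := (of fun s f => a (s, f) : Matrix (Fin 2) (Fin n → Fin d) ℂ)ᵀ *
          (of fun s f => b (s, f) : Matrix (Fin 2) (Fin n → Fin d) ℂ) with hM
  have hMe : ∀ f g, M f g = ∑ s, a (s, f) * b (s, g) := fun f g => by
    simp [hM, mul_apply]
  have h1 : ∀ s t f g, (witness d n *ᵥ fun p : Party d n × Party d n => a p.1 * b p.2)
      ((s, f), (t, g)) =
      if s = t then (1 / 2 : ℂ) * (K *ᵥ vecOf M) (f, g) else 0 := by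
    intro s t f g
    simp only [mulVec, dotProduct, witness_eq, withQubits, maxEnt, ← hK, vecOf, hMe,
      Fintype.sum_prod_type, Fin.sum_univ_two]
    by_cases hst : s = t
    · simp [hst, Finset.mul_sum, Finset.sum_add_distrib, mul_add]
      congr 1 <;>
        refine Finset.sum_congr rfl fun x _ => Finset.sum_congr rfl fun y _ => ?_ <;> ring
    · simp [hst]
  have h2 : ∀ x : Party d n × Party d n → ℂ, ∑ p, x p =
      ∑ s, ∑ t, ∑ f, ∑ g, x ((s, f), (t, g)) := by
    intro x
    simp only [Fintype.sum_prod_type]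
    refine Finset.sum_congr rfl fun s _ => ?_
    rw [Finset.sum_comm]
  rw [prodProj_eq, mul_vecMulVec, trace_vecMulVec, dotProduct_comm, dotProduct, h2]
  simp only [h1, Fin.sum_univ_two]
  simp only [qform, dotProduct, Fintype.sum_prod_type, vecOf, hMe, Pi.star_apply,
    Fin.sum_univ_two]
  simp [Finset.mul_sum, ← Finset.sum_add_distrib]
  refine Finset.sum_congr rfl fun x _ => Finset.sum_congr rfl fun y _ => ?_
  ring

open scoped MatrixOrder in
theorem _root_.Matrix.PosSemidef.exists_sum_vecMulVec {α : Type} [Fintype α] [DecidableEq α]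
    {A : Matrix α α ℂ} (hA : A.PosSemidef) :
    ∃ u : α → α → ℂ, A = ∑ k, vecMulVec (u k) (star (u k)) := by
  obtain ⟨a, rfl⟩ := CStarAlgebra.nonneg_iff_eq_star_mul_self.mp hA.nonneg
  refine ⟨fun k => star (a k), ?_⟩
  ext i j
  simp [mul_apply, Matrix.sum_apply, vecMulVec_apply]

theorem prodProj_separableOp (a b : Party d n → ℂ) : SeparableOp (prodProj a b) :=
  separableOp_kronecker (posSemidef_vecMulVec_self_star _) (posSemidef_vecMulVec_self_star _)

/-- Block positivity says that the witness is nonnegative on separable operators. -/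
theorem BlockPositive.trace_witness_nonneg (h : BlockPositive d n) {σ : Op d n}
    (hσ : SeparableOp σ) : 0 ≤ ((witness d n * σ).trace).re := by
  obtain ⟨κ, _, A, B, hAB, rfl⟩ := separableOp_iff.1 hσ
  rw [Matrix.mul_sum, trace_sum, Complex.re_sum]
  refine Finset.sum_nonneg fun k _ => ?_
  obtain ⟨u, hu⟩ := (hAB k).1.exists_sum_vecMulVec
  obtain ⟨v, hv⟩ := (hAB k).2.exists_sum_vecMulVec
  have : A k ⊗ₖ B k = ∑ i, ∑ j, prodProj (u i) (v j) := by
    rw [hu, hv]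
    ext p q
    simp [kroneckerMap_apply, Matrix.sum_apply, prodProj, Finset.sum_mul_sum]
  rw [this, Matrix.mul_sum, trace_sum, Complex.re_sum]
  refine Finset.sum_nonneg fun i _ => ?_
  rw [Matrix.mul_sum, trace_sum, Complex.re_sum]
  refine Finset.sum_nonneg fun j _ => ?_
  rw [trace_witness_prodProj]
  have := h (of fun s f => u i (s, f)) (of fun s f => v j (s, f))
  rw [show (1 / 2 : ℂ) = ((1 / 2 : ℝ) : ℂ) by norm_num, Complex.re_ofReal_mul]
  positivity

theorem exists_separableOp_of_not_blockPositive (h : ¬ BlockPositive d n) :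
    ∃ σ : Op d n, SeparableOp σ ∧ ((witness d n * σ).trace).re < 0 := by
  simp only [BlockPositive, not_forall, not_le] at h
  obtain ⟨A, B, h⟩ := h
  refine ⟨prodProj (fun p => A p.1 p.2) (fun p => B p.1 p.2), prodProj_separableOp _ _, ?_⟩
  rw [trace_witness_prodProj, show (1 / 2 : ℂ) = ((1 / 2 : ℝ) : ℂ) by norm_num,
    Complex.re_ofReal_mul]
  have : (of fun s f => A s f : Matrix (Fin 2) (Fin n → Fin d) ℂ) = A := rfl
  simp only [this, show (of fun s f => B s f : Matrix (Fin 2) (Fin n → Fin d) ℂ) = B from rfl]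
  linarith

end BlockPositive

/-! ### Coordinates of invariant states -/

section Coordinates

variable {d n : ℕ}

/-- The homogeneous form of `invState`, with a free coefficient of `Q̃₂ ⊗ L₀`. -/
noncomputable def coneState (d n : ℕ) : ℝ × Coord n →ₗ[ℝ] Op d n where
  toFun x := x.1 • withQubits (complEnt 2) (layer d n 0) +
    ∑ j : Fin n, x.2.1 j • withQubits (complEnt 2) (layer d n (j + 1)) +
    ∑ i : Fin (n + 1), x.2.2 i • withQubits (maxEnt 2) (layer d n i)
  map_add' x y := by
    simp only [Prod.fst_add, Prod.snd_add, Pi.add_apply, add_smul, Finset.sum_add_distrib]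
    abel
  map_smul' r x := by
    simp only [Prod.smul_fst, Prod.smul_snd, Pi.smul_apply, smul_eq_mul, mul_smul, smul_add,
      Finset.smul_sum, RingHom.id_apply]

theorem coneState_apply (s : ℝ) (c : Coord n) :
    coneState d n (s, c) = s • withQubits (complEnt 2) (layer d n 0) +
    ∑ j : Fin n, c.1 j • withQubits (complEnt 2) (layer d n (j + 1)) +
    ∑ i : Fin (n + 1), c.2 i • withQubits (maxEnt 2) (layer d n i) := rfl

theorem invState_eq (c : Coord n) : invState d c = coneState d n (1, c) := by
  rw [coneState_apply, one_smul]
  simp only [← Complex.coe_smul, invState, withQubits_add_right, withQubits_sum_right,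
    withQubits_smul_right]

theorem coneState_of_pos {s : ℝ} (hs : 0 < s) (c : Coord n) :
    coneState d n (s, c) = (s : ℂ) • invState d (s⁻¹ • c) := by
  rw [invState_eq, Complex.coe_smul, ← map_smul]
  congr 1
  ext <;> simp [hs.ne']

theorem invState_sum {κ : Type} [Fintype κ] (w : κ → ℝ) (hw : ∑ k, w k = 1) (c : κ → Coord n) :
    invState d (∑ k, w k • c k) = ∑ k, (w k : ℂ) • invState d (c k) := by
  simp only [invState_eq, Complex.coe_smul, ← map_smul, ← map_sum]
  congr 1
  ext <;> simp [Prod.fst_sum, Prod.snd_sum, hw]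

theorem invOp_eq_sum (f g : Polynomial ℂ) : invOp d n f g =
    (f.coeff 0) • withQubits (complEnt 2) (layer d n 0) +
    ∑ j : Fin n, (f.coeff (j + 1) / n.choose (j + 1)) •
      withQubits (complEnt 2) (layer d n (j + 1)) +
    ∑ i : Fin (n + 1), (g.coeff i / n.choose i) • withQubits (maxEnt 2) (layer d n i) := by
  simp only [invOp, lay, withQubits_sum_right, withQubits_smul_right]
  congr 1
  · rw [Finset.sum_range, Fin.sum_univ_succ]
    simp
  · rw [Finset.sum_range]

theorem choose_cast_ne_zero {n j : ℕ} (h : j ≤ n) : (n.choose j : ℂ) ≠ 0 := by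
  exact_mod_cast (Nat.choose_pos h).ne'

/-- Coordinates are read off from the coefficients of the generating polynomials. -/
theorem invOp_eq_coneState {f g : Polynomial ℂ} {s : ℝ} {c : Coord n} (h0 : f.coeff 0 = s)
    (hf : ∀ j : Fin n, f.coeff (j + 1) = n.choose (j + 1) * c.1 j)
    (hg : ∀ i : Fin (n + 1), g.coeff i = n.choose i * c.2 i) :
    invOp d n f g = coneState d n (s, c) := by
  rw [invOp_eq_sum, coneState_apply, h0]
  congr 1
  · congr 1
    refine Finset.sum_congr rfl fun j _ => ?_
    rw [hf, mul_div_cancel_left₀ _ (choose_cast_ne_zero (by omega)), Complex.coe_smul]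
  · refine Finset.sum_congr rfl fun j _ => ?_
    rw [hg, mul_div_cancel_left₀ _ (choose_cast_ne_zero (by omega)), Complex.coe_smul]

theorem complEnt_conjTranspose (m : ℕ) : (complEnt m)ᴴ = complEnt m := by
  simp [complEnt, maxEnt_conjTranspose]

theorem layer_conjTranspose (j : ℕ) : (layer d n j)ᴴ = layer d n j := by
  simp only [layer, conjTranspose_sum, pairTensor_conjTranspose]
  refine Finset.sum_congr rfl fun S _ => ?_
  congr 1
  ext1 i
  split_ifs
  · exact maxEnt_conjTranspose d
  · exact complEnt_conjTranspose d

/-- A Hermitian invariant operator has real coordinates. -/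
theorem exists_coneState_of_isHermitian {f g : Polynomial ℂ} (h : (invOp d n f g).IsHermitian) :
    ∃ s c, invOp d n f g = coneState d n (s, c) := by
  refine ⟨(f.coeff 0).re, (fun j => (f.coeff (j + 1) / n.choose (j + 1)).re,
    fun i => (g.coeff i / n.choose i).re), ?_⟩
  have h2 : invOp d n f g = (1 / 2 : ℂ) • (invOp d n f g + (invOp d n f g)ᴴ) := by
    rw [h.eq]
    ext p q
    simp only [Matrix.smul_apply, Matrix.add_apply, smul_eq_mul]
    ring
  have hre : ∀ z : ℂ, ((z.re : ℝ) : ℂ) = (1 / 2) * (z + star z) := fun z => by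
    rw [Complex.star_def, Complex.add_conj]
    push_cast
    ring
  rw [h2, coneState_apply]
  simp only [← Complex.coe_smul, hre]
  rw [invOp_eq_sum]
  simp only [conjTranspose_add, conjTranspose_sum, conjTranspose_smul, withQubits_conjTranspose,
    layer_conjTranspose, complEnt_conjTranspose, maxEnt_conjTranspose, mul_smul, add_smul,
    smul_add, Finset.smul_sum, Finset.sum_add_distrib]
  abel

/-- The trace of the witness times the state with coordinates `c`. The `y`-coordinates do not
contribute, since `P₂` is orthogonal to `Q̃₂`. -/
noncomputable def witnessValue (d : ℕ) {n : ℕ} (c : Coord n) : ℝ :=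
  ∑ i : Fin (n + 1), c.2 i * (n.choose i * (1 - (d : ℝ) / 2) ^ (i : ℕ))

theorem sq_sub_one_ne_zero {m : ℕ} (hm : 2 ≤ m) : (m : ℂ) ^ 2 - 1 ≠ 0 := by
  have h1 : 2 ^ 2 ≤ m ^ 2 := Nat.pow_le_pow_left hm 2
  rw [sub_ne_zero]
  have : m ^ 2 ≠ 1 := by omega
  exact_mod_cast this

theorem trace_complEnt {m : ℕ} (hm : 2 ≤ m) : (complEnt m).trace = 1 := by
  have := sq_sub_one_ne_zero hm
  rw [complEnt, trace_smul, trace_sub, trace_maxEnt (by omega), trace_one]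
  simp only [Fintype.card_prod, Fintype.card_fin, smul_eq_mul]
  push_cast
  field_simp

theorem maxEnt_mul_complEnt {m : ℕ} (hm : m ≠ 0) : maxEnt m * complEnt m = 0 := by
  rw [complEnt, Matrix.mul_smul, Matrix.mul_sub, maxEnt_mul_self hm]
  simp

theorem trace_halfX_layer (hd : 2 ≤ d) (j : ℕ) :
    ((pairTensor fun _ : Fin n => halfX d) * layer d n j).trace =
      n.choose j * (1 - (d : ℂ) / 2) ^ j := by
  have hd0 : d ≠ 0 := by omega
  rw [layer, Matrix.mul_sum, trace_sum, Finset.sum_congr rfl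
    (g := fun _ => (1 - (d : ℂ) / 2) ^ j)]
  · simp
  · intro S hS
    rw [pairTensor_mul, trace_pairTensor, Finset.prod_congr rfl
      (g := fun i => if i ∈ S then (1 - (d : ℂ) / 2) else 1)]
    · rw [Finset.prod_ite_mem, Finset.univ_inter, Finset.prod_const,
        (Finset.mem_powersetCard.1 hS).2]
    · intro i _
      rw [trace_halfX_mul]
      split_ifs
      · rw [maxEnt_mul_self hd0, trace_maxEnt hd0]; ring
      · rw [maxEnt_mul_complEnt hd0, trace_complEnt hd]; simp

theorem trace_witness_coneState (hd : 2 ≤ d) (s : ℝ) (c : Coord n) :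
    (witness d n * coneState d n (s, c)).trace = (witnessValue d c : ℂ) := by
  have h1 : ∀ j, (witness d n * withQubits (complEnt 2) (layer d n j)).trace = 0 := by
    intro j
    rw [witness_eq, withQubits_mul, trace_withQubits, maxEnt_mul_complEnt (by norm_num)]
    simp
  have h2 : ∀ j, (witness d n * withQubits (maxEnt 2) (layer d n j)).trace =
      n.choose j * (1 - (d : ℂ) / 2) ^ j := by
    intro j
    rw [witness_eq, withQubits_mul, trace_withQubits, maxEnt_mul_self (by norm_num),
      trace_maxEnt (by norm_num), trace_halfX_layer hd, one_mul]
  rw [coneState_apply]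
  simp only [← Complex.coe_smul, Matrix.mul_add, Matrix.mul_sum, Matrix.mul_smul, trace_add,
    trace_sum, trace_smul, h1, h2, smul_zero, Finset.sum_const_zero, zero_add, witnessValue]
  push_cast
  rfl

theorem witnessValue_add (c c' : Coord n) :
    witnessValue d (c + c') = witnessValue d c + witnessValue d c' := by
  simp [witnessValue, add_mul, Finset.sum_add_distrib]

theorem witnessValue_smul (r : ℝ) (c : Coord n) :
    witnessValue d (r • c) = r * witnessValue d c := by
  simp [witnessValue, mul_assoc, Finset.mul_sum]

theorem trace_witness_invState (hd : 2 ≤ d) (c : Coord n) :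
    (witness d n * invState d c).trace = (witnessValue d c : ℂ) := by
  rw [invState_eq, trace_witness_coneState hd]

theorem addX1_eq (c : Coord n) (δ : ℝ) : addX1 c δ = c + δ • ((0, Pi.single 1 1) : Coord n) := by
  ext i
  · simp [addX1]
  · simp [addX1, Pi.single_apply]

theorem witnessValue_single (hn : 1 ≤ n) :
    witnessValue d ((0, Pi.single 1 1) : Coord n) = n * (1 - (d : ℝ) / 2) := by
  have h1 : ((1 : Fin (n + 1)) : ℕ) = 1 := by
    rw [Fin.val_one']
    exact Nat.mod_eq_of_lt (by omega)
  rw [witnessValue, Finset.sum_eq_single 1]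
  · simp only [Pi.single_eq_same, h1, Nat.choose_one_right, pow_one, one_mul]
  · intro b _ hb
    simp [hb]
  · simp

/-- Increasing `x₁` makes the witness negative. -/
theorem witnessValue_addX1 (hn : 1 ≤ n) (c : Coord n) (δ : ℝ) :
    witnessValue d (addX1 c δ) = witnessValue d c + δ * (n * (1 - (d : ℝ) / 2)) := by
  rw [addX1_eq, witnessValue_add, witnessValue_smul, witnessValue_single hn]

theorem BlockPositive.not_separableOp (h : BlockPositive d n) (hd : 2 ≤ d) {c : Coord n}
    (hc : witnessValue d c < 0) : ¬ SeparableOp (invState d c) := by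
  intro hs
  have := h.trace_witness_nonneg hs
  rw [trace_witness_invState hd, Complex.ofReal_re] at this
  linarith

/-- The matrix entry at `|01⟩ |01⟩ ⋯ |01⟩` only sees the coefficient of `Q̃₂ ⊗ L₀`. -/
theorem coneState_nonneg (hd : 2 ≤ d) {s : ℝ} {c : Coord n}
    (h : (coneState d n (s, c)).PosSemidef) : 0 ≤ s := by
  let z : Fin d := ⟨0, by omega⟩
  let o : Fin d := ⟨1, by omega⟩
  have hzo : z ≠ o := by simp [z, o]
  let p : Party d n × Party d n := ((0, fun _ => z), (1, fun _ => o))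
  have h1 : ∀ Y, (withQubits (maxEnt 2) Y : Op d n) p p = 0 := by
    intro Y; simp [withQubits, maxEnt, p]
  have h2 : ∀ j : ℕ, 0 < j → (withQubits (complEnt 2) (layer d n j) : Op d n) p p = 0 := by
    intro j hj
    have : layer d n j (fun _ => z, fun _ => o) (fun _ => z, fun _ => o) = 0 := by
      rw [layer, Matrix.sum_apply]
      refine Finset.sum_eq_zero fun S hS => ?_
      obtain ⟨i, hi⟩ : S.Nonempty := by
        rw [← Finset.card_pos, (Finset.mem_powersetCard.1 hS).2]; exact hj
      refine Finset.prod_eq_zero (Finset.mem_univ i) ?_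
      simp [hi, maxEnt, hzo]
    simp [withQubits, p, this]
  have hcompl : ∀ m : ℕ, ∀ a b : Fin m, a ≠ b →
      complEnt m (a, b) (a, b) = (((m : ℝ) ^ 2 - 1)⁻¹ : ℝ) := by
    intro m a b hab
    simp [complEnt, maxEnt, hab]
  have h3 : (withQubits (complEnt 2) (layer d n 0) : Op d n) p p =
      (((((2 : ℕ) : ℝ) ^ 2 - 1)⁻¹ * (((d : ℝ) ^ 2 - 1)⁻¹) ^ n : ℝ) : ℂ) := by
    simp only [withQubits, p, layer, Finset.powersetCard_zero, Finset.sum_singleton, pairTensor,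
      Finset.notMem_empty, if_false, hcompl 2 0 1 (by decide), hcompl d z o hzo,
      Finset.prod_const, Finset.card_univ, Fintype.card_fin]
    push_cast
    ring
  have h4 := h.diag_nonneg (i := p)
  rw [coneState_apply, Matrix.add_apply, Matrix.add_apply, Matrix.sum_apply, Matrix.sum_apply,
    Finset.sum_eq_zero (s := (Finset.univ : Finset (Fin n))), Finset.sum_eq_zero] at h4
  · rw [Matrix.smul_apply, h3, add_zero, add_zero, Complex.real_smul, ← Complex.ofReal_mul] at h4
    have h5 : (0 : ℝ) < (d : ℝ) ^ 2 - 1 := by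
      have : (2 : ℝ) ≤ d := by exact_mod_cast hd
      nlinarith
    have h6 := Complex.zero_le_real.1 h4
    have h7 : 0 < (((2 : ℕ) : ℝ) ^ 2 - 1)⁻¹ * (((d : ℝ) ^ 2 - 1)⁻¹) ^ n := by
      apply mul_pos
      · norm_num
      · positivity
    exact nonneg_of_mul_nonneg_left h6 h7
  · intro i _
    rw [Matrix.smul_apply, h1, smul_zero]
  · intro i _
    rw [Matrix.smul_apply, h2 _ (Nat.succ_pos _), smul_zero]

/-- If block positivity fails, twirling a product vector with negative expectation
value yields a separable invariant state beyond the hyperplane. -/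
theorem exists_separable_invState (hd : 2 ≤ d) (h : ¬ BlockPositive d n) {c₀ : Coord n}
    (h₀ : SeparableOp (invState d c₀)) (hc₀ : witnessValue d c₀ = 0) :
    ∃ c : Coord n, SeparableOp (invState d c) ∧ witnessValue d c < 0 := by
  obtain ⟨σ, hσ, hneg⟩ := exists_separableOp_of_not_blockPositive h
  obtain ⟨Φ, hΦ⟩ := exists_isTwirlMap hd n
  obtain ⟨f, g, hfg⟩ := hΦ.exists_invOp σ
  have hsep := hΦ.separableOp hσ
  have htr := hΦ.trace_witness σ
  obtain ⟨s, c, hsc⟩ := exists_coneState_of_isHermitian (hfg ▸ hsep.posSemidef.1)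
  rw [hfg, hsc] at hsep htr
  rw [← htr, trace_witness_coneState hd, Complex.ofReal_re] at hneg
  have hs := coneState_nonneg hd hsep.posSemidef
  have hs1 : 0 < s + 1 := by linarith
  -- adding `c₀` makes the leading coefficient positive
  have hadd : coneState d n (s, c) + invState d c₀ =
      ((s + 1 : ℝ) : ℂ) • invState d ((s + 1)⁻¹ • (c + c₀)) := by
    rw [← coneState_of_pos hs1, invState_eq, ← _root_.map_add]
    rfl
  refine ⟨(s + 1)⁻¹ • (c + c₀), ?_, ?_⟩
  · have h1 := hsep.add h₀
    rw [hadd] at h1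
    have h2 := h1.smul (inv_nonneg.2 hs1.le)
    have hne : ((s + 1 : ℝ) : ℂ) ≠ 0 := by exact_mod_cast hs1.ne'
    rw [smul_smul, Complex.ofReal_inv, inv_mul_cancel₀ hne, one_smul] at h2
    exact h2
  · rw [witnessValue_smul, witnessValue_add, hc₀, add_zero]
    exact mul_neg_of_pos_of_neg (inv_pos.2 hs1) hneg

end Coordinates

/-! ### The twirls of the explicit product vectors -/

section Points

variable {d n : ℕ}

theorem ket_eq {s : ℕ} {g : ℕ → ℕ} {s' : Fin 2} {g' : Fin n → Fin d} (hs : (s' : ℕ) = s)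
    (hg : ∀ i : Fin n, (g' i : ℕ) = g i) : ket d n s g = Pi.single (s', g') 1 := by
  ext p
  have : ((p.1 : ℕ) = s ∧ ∀ i : Fin n, (p.2 i : ℕ) = g i) ↔ p = (s', g') := by
    rw [Prod.ext_iff, funext_iff, Fin.ext_iff, hs]
    simp only [Fin.ext_iff, hg]
  simp only [ket, this, Pi.single_apply]

theorem trace_maxEnt_mul_single {m : ℕ} (a b : Fin m × Fin m) :
    (maxEnt m * Matrix.single a b 1).trace = if a.1 = a.2 ∧ b.1 = b.2 then 1 / (m : ℂ) else 0 := by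
  rw [trace_mul_comm, trace_single_mul, one_smul, maxEnt]
  simp only [and_comm]

theorem trace_sub_maxEnt_mul_single {m : ℕ} (a b : Fin m × Fin m) :
    ((1 - maxEnt m) * Matrix.single a b 1).trace =
      (if a = b then 1 else 0) - if a.1 = a.2 ∧ b.1 = b.2 then 1 / (m : ℂ) else 0 := by
  rw [Matrix.sub_mul, trace_sub, trace_maxEnt_mul_single, Matrix.one_mul]
  congr 1
  by_cases h : a = b
  · subst h; simp
  · simp [h]

theorem invOp_sum {ι : Type} (s : Finset ι) (f g : ι → Polynomial ℂ) :
    ∑ i ∈ s, invOp d n (f i) (g i) = invOp d n (∑ i ∈ s, f i) (∑ i ∈ s, g i) := by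
  classical
  induction s using Finset.induction_on with
  | empty =>
    have := invOp_smul (d := d) (n := n) 0 0 0
    simpa using this.symm
  | insert a s ha ih => rw [Finset.sum_insert ha, Finset.sum_insert ha, Finset.sum_insert ha, ih,
      invOp_add]

theorem prod_ite_lt {R : Type} [CommSemiring R] {n k : ℕ} (hk : k ≤ n) (A : R) :
    ∏ i : Fin n, (if (i : ℕ) < k then A else 1) = A ^ k := by
  rw [← Finset.prod_filter, Finset.prod_const, Fin.card_filter_val_lt, min_eq_right hk]

open Polynomial in
theorem coeff_one_add_C_mul_X_pow {K : Type} [Field K] (b : K) (m j : ℕ) :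
    ((1 + C b * X) ^ m).coeff j = m.choose j * b ^ j := by
  have : (1 + C b * X) ^ m = ((1 + X) ^ m : K[X]).comp (C b * X) := by simp
  rw [this, comp_C_mul_X_coeff, coeff_one_add_X_pow]

open Polynomial in
theorem coeff_affine_mul {K : Type} [Field K] (u v : K) (h : K[X]) (i : ℕ) :
    ((C u + C v * X) * h).coeff i = u * h.coeff i + v * (if i = 0 then 0 else h.coeff (i - 1)) := by
  rw [add_mul, coeff_add, coeff_C_mul, mul_assoc, coeff_C_mul]
  rcases i with _ | i
  · simp
  · simp [coeff_X_mul]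

open Polynomial in
/-- The generating polynomial of the twirl of `|00⟩⟨00|` on one pair. -/
theorem one_factor_eq (hd : 2 ≤ d) : (C (1 - 1 / (d : ℂ)) + C (1 / (d : ℂ)) * X : ℂ[X]) =
    C (1 - 1 / (d : ℂ)) * (1 + C (1 / ((d : ℂ) - 1)) * X) := by
  have h0 : (d : ℂ) ≠ 0 := by
    have : d ≠ 0 := by omega
    exact_mod_cast this
  have h1 : (d : ℂ) - 1 ≠ 0 := by
    rw [sub_ne_zero]
    have : d ≠ 1 := by omega
    exact_mod_cast this
  rw [mul_add, mul_one, ← mul_assoc, ← C_mul]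
  congr 3
  field_simp

theorem cast_sub_one_ne_zero (hd : 2 ≤ d) : (d : ℝ) - 1 ≠ 0 := by
  rw [sub_ne_zero]
  have : d ≠ 1 := by omega
  exact_mod_cast this

open Polynomial in
theorem coeff_pow_eq_pointY {m : ℕ} (j : Fin n) :
    ((1 + C (1 / ((d : ℂ) - 1)) * X : ℂ[X]) ^ m).coeff (j + 1) =
      n.choose (j + 1) * (pointY d n m j : ℂ) := by
  have hch := choose_cast_ne_zero (n := n) (j := j + 1) (by omega)
  rw [coeff_one_add_C_mul_X_pow, pointY, div_pow, one_pow]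
  push_cast
  field_simp

open Polynomial in
theorem coeff_eq_pointX (hd : 2 ≤ d) {m : ℕ} (i : Fin (n + 1)) :
    ((C (((d : ℂ) - 2) / (3 * d)) + C (2 / (3 * (d : ℂ))) * X) *
      (1 + C (1 / ((d : ℂ) - 1)) * X : ℂ[X]) ^ m).coeff i =
      n.choose i * (pointX d n m i : ℂ) := by
  have hch := choose_cast_ne_zero (n := n) (j := i) (by omega)
  have h0 : (d : ℂ) ≠ 0 := by
    have : d ≠ 0 := by omega
    exact_mod_cast this
  have h1 : (d : ℂ) - 1 ≠ 0 := by exact_mod_cast cast_sub_one_ne_zero hd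
  rw [coeff_affine_mul, coeff_one_add_C_mul_X_pow, coeff_one_add_C_mul_X_pow, pointX]
  simp only [div_pow, one_pow]
  by_cases hi : (i : ℕ) = 0
  · simp only [hi, if_true]
    push_cast
    field_simp
    simp
  · simp only [hi, if_false]
    push_cast
    field_simp

theorem one_sub_inv_pos (hd : 2 ≤ d) : (0 : ℝ) < 1 - 1 / d := by
  have : (2 : ℝ) ≤ d := by exact_mod_cast hd
  rw [sub_pos, div_lt_one (by linarith)]
  linarith

open Polynomial in
theorem twirl_productState_inl (hd : 2 ≤ d) {Φ : Op d n → Op d n} (hΦ : IsTwirlMap Φ)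
    (k : Fin (n + 1)) :
    Φ (productState d n (.inl k)) =
      (((1 - 1 / (d : ℝ)) ^ (k : ℕ) : ℝ) : ℂ) • invState d (point d n (.inl k)) := by
  let z : Fin d := ⟨0, by omega⟩
  let o : Fin d := ⟨1, by omega⟩
  have hzo : z ≠ o := by simp [z, o]
  have hprod : productState d n (.inl k) = Matrix.single
      (((0, fun _ => z), (1, fun i => if (i : ℕ) < k then z else o)) : Party d n × Party d n)
      (((0, fun _ => z), (1, fun i => if (i : ℕ) < k then z else o)) : Party d n × Party d n)
      1 := by
    have h1 : ket d n 0 (fun _ => 0) = Pi.single (0, fun _ : Fin n => z) 1 :=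
      ket_eq rfl fun i => rfl
    have h2 : ket d n 1 (fun i => if i < k then 0 else 1) =
        Pi.single (1, fun i : Fin n => if (i : ℕ) < k then z else o) 1 :=
      ket_eq rfl fun i => by split_ifs <;> rfl
    simp only [productState, h1, h2, prodProj, Pi.star_single, star_one,
      ← Matrix.single_eq_single_vecMulVec_single, single_kronecker_single, mul_one]
  have hfac : ∀ i : Fin n, (C (((1 - maxEnt d) * Matrix.single
      (z, if (i : ℕ) < k then z else o) (z, if (i : ℕ) < k then z else o) 1).trace) +
      C ((maxEnt d * Matrix.single
      (z, if (i : ℕ) < k then z else o) (z, if (i : ℕ) < k then z else o) 1).trace) * X : ℂ[X]) =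
      if (i : ℕ) < k then C (1 - 1 / (d : ℂ)) * (1 + C (1 / ((d : ℂ) - 1)) * X) else 1 := by
    intro i
    rw [← one_factor_eq hd]
    simp only [trace_maxEnt_mul_single, trace_sub_maxEnt_mul_single]
    split_ifs <;> simp_all
  rw [hprod, single_eq_withQubits, hΦ.product]
  simp only [hfac, prod_ite_lt (show (k : ℕ) ≤ n by omega)]
  rw [invState_eq, Complex.coe_smul, ← map_smul]
  simp only [trace_maxEnt_mul_single, trace_sub_maxEnt_mul_single]
  refine invOp_eq_coneState ?_ (fun j => ?_) fun i => ?_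
  · rw [mul_pow, ← C_pow]
    simp only [coeff_C_mul, coeff_one_add_C_mul_X_pow]
    simp
  · rw [mul_pow, ← C_pow, coeff_C_mul, coeff_C_mul, coeff_pow_eq_pointY (n := n)]
    simp [point]
    ring
  · simp [point]

open Polynomial in
theorem twirl_productState_inr (hd : 2 ≤ d) {Φ : Op d n → Op d n} (hΦ : IsTwirlMap Φ)
    (k : Fin n) :
    Φ (productState d n (.inr k)) =
      ((3 * (1 - 1 / (d : ℝ)) ^ (n - 1 - (k : ℕ)) : ℝ) : ℂ) •
        invState d (point d n (.inr k)) := by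
  obtain ⟨N, rfl⟩ : ∃ N, n = N + 1 := ⟨n - 1, by have := k.2; omega⟩
  let z : Fin d := ⟨0, by omega⟩
  let o : Fin d := ⟨1, by omega⟩
  have hzo : z ≠ o := by simp [z, o]
  have hd0 : (d : ℂ) ≠ 0 := by
    have : d ≠ 0 := by omega
    exact_mod_cast this
  -- the product vector is the sum of the `|s t⟩` with `s`, `t` also written into the first pair
  let e : Fin 2 → Fin d := fun s => ⟨s, by omega⟩
  have he : ∀ s t, e s = e t ↔ s = t := fun s t => by simp [e, Fin.ext_iff]
  let r : Fin N → Fin d := fun i => if (i : ℕ) < N - k then z else o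
  let a : Fin 2 → Party d (N + 1) := fun s => (s, Fin.cons (e s) fun _ => z)
  let b : Fin 2 → Party d (N + 1) := fun s => (s, Fin.cons (e s) r)
  have hprod : productState d (N + 1) (.inr k) =
      ∑ x : (Fin 2 × Fin 2) × (Fin 2 × Fin 2),
        Matrix.single (a x.1.1, b x.1.2) (a x.2.1, b x.2.2) 1 := by
    have h1 : ∀ s : Fin 2, ket d (N + 1) s (fun i => if i = 0 then s else 0) =
        Pi.single (a s) 1 := fun s => ket_eq rfl fun i => by
      refine Fin.cases ?_ (fun i => ?_) i
      · simp [e]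
      · simp [z]
    have h2 : ∀ s : Fin 2, ket d (N + 1) s
        (fun i => if i = 0 then s else if i < N + 1 - k then 0 else 1) =
        Pi.single (b s) 1 := fun s => ket_eq rfl fun i => by
      refine Fin.cases ?_ (fun i => ?_) i
      · simp [e]
      · simp only [Fin.cons_succ, Fin.val_succ, r]
        have : (i : ℕ) + 1 < N + 1 - k ↔ (i : ℕ) < N - k := by omega
        simp only [this]
        split_ifs <;> simp_all [z, o]
    simp only [productState, prodProj]
    rw [Finset.sum_range (fun s => ket d (N + 1) s fun i => if i = 0 then s else 0),
      Finset.sum_range (fun s => ket d (N + 1) s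
        fun i => if i = 0 then s else if i < N + 1 - k then 0 else 1)]
    simp only [h1, h2, Fin.sum_univ_two, Fintype.sum_prod_type, star_add, Pi.star_single, star_one,
      add_vecMulVec, vecMulVec_add, add_kronecker, kronecker_add,
      ← Matrix.single_eq_single_vecMulVec_single, single_kronecker_single, mul_one]
    abel
  set B : ℂ[X] := (C (1 - 1 / (d : ℂ)) * (1 + C (1 / ((d : ℂ) - 1)) * X)) ^ (N - (k : ℕ)) with hB
  have hfac : ∀ i : Fin N, (C (((1 - maxEnt d) * Matrix.single (z, r i) (z, r i) 1).trace) +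
      C ((maxEnt d * Matrix.single (z, r i) (z, r i) 1).trace) * X : ℂ[X]) =
      if (i : ℕ) < N - k then C (1 - 1 / (d : ℂ)) * (1 + C (1 / ((d : ℂ) - 1)) * X) else 1 := by
    intro i
    rw [← one_factor_eq hd]
    simp only [trace_maxEnt_mul_single, trace_sub_maxEnt_mul_single, r]
    split_ifs <;> simp_all
  rw [hprod, hΦ.map_sum]
  simp only [single_eq_withQubits, hΦ.product, a, b, Fin.prod_univ_succ, Fin.cons_zero,
    Fin.cons_succ, hfac, prod_ite_lt (show N - (k : ℕ) ≤ N by omega), ← hB]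
  rw [invOp_sum]
  have hsum : ∀ α β γ : (Fin 2 × Fin 2) × (Fin 2 × Fin 2) → ℂ,
      ∑ x, C (α x) * ((C (β x) + C (γ x) * X) * B) =
        (C (∑ x, α x * β x) + C (∑ x, α x * γ x) * X) * B := by
    intro α β γ
    simp only [map_sum, C_mul, Finset.sum_mul, add_mul, ← Finset.sum_add_distrib]
    exact Finset.sum_congr rfl fun x _ => by ring
  have hB' : B = C ((1 - 1 / (d : ℂ)) ^ (N - (k : ℕ))) *
    (1 + C (1 / ((d : ℂ) - 1)) * X) ^ (N - (k : ℕ)) := by rw [hB, mul_pow, C_pow]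
  have hfin : ∀ u v u' v' : ℂ, u = 3 → v = 0 → u' = 1 - 2 / d → v' = 2 / d →
      invOp d (N + 1) ((C u + C v * X) * B) ((C u' + C v' * X) * B) =
      ((3 * (1 - 1 / (d : ℝ)) ^ (N + 1 - 1 - (k : ℕ)) : ℝ) : ℂ) •
        invState d (point d (N + 1) (.inr k)) := by
    rintro u v u' v' rfl rfl rfl rfl
    rw [invState_eq, Complex.coe_smul, ← map_smul]
    refine invOp_eq_coneState ?_ (fun j => ?_) fun i => ?_
    · rw [hB', C_0, zero_mul, add_zero, coeff_C_mul, coeff_C_mul, coeff_one_add_C_mul_X_pow]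
      simp
    · rw [hB', C_0, zero_mul, add_zero, coeff_C_mul, coeff_C_mul,
        coeff_pow_eq_pointY (n := N + 1)]
      simp [point]
      ring
    · have h3 : (C (1 - 2 / (d : ℂ)) + C (2 / (d : ℂ)) * X) * B =
          C (3 * (1 - 1 / (d : ℂ)) ^ (N - (k : ℕ))) *
          ((C (((d : ℂ) - 2) / (3 * d)) + C (2 / (3 * (d : ℂ))) * X) *
            (1 + C (1 / ((d : ℂ) - 1)) * X : ℂ[X]) ^ (N - (k : ℕ))) := by
        rw [hB', C_mul, show 1 - 2 / (d : ℂ) = 3 * (((d : ℂ) - 2) / (3 * d)) by field_simp,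
          show 2 / (d : ℂ) = 3 * (2 / (3 * (d : ℂ))) by field_simp, C_mul, C_mul]
        ring
      rw [h3, coeff_C_mul, coeff_eq_pointX hd]
      simp [point]
      ring
  rw [hsum, hsum]
  refine hfin _ _ _ _ ?_ ?_ ?_ ?_ <;>
  · simp only [trace_maxEnt_mul_single, trace_sub_maxEnt_mul_single, Fintype.sum_prod_type,
      Fin.sum_univ_two, Prod.mk.injEq, he]
    simp
    field_simp
    ring

end Points

/-! ### The hyperplane spanned by the explicit points -/

section Hyperplane

variable {d n : ℕ}

theorem productState_separableOp (k : Fin (n + 1) ⊕ Fin n) :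
    SeparableOp (productState d n k) := by
  rcases k with k | k <;> exact prodProj_separableOp _ _

theorem exists_twirl_productState (hd : 2 ≤ d) {Φ : Op d n → Op d n} (hΦ : IsTwirlMap Φ)
    (k : Fin (n + 1) ⊕ Fin n) :
    ∃ t : ℝ, 0 < t ∧ Φ (productState d n k) = (t : ℂ) • invState d (point d n k) := by
  have := one_sub_inv_pos hd
  rcases k with k | k
  · exact ⟨_, pow_pos this _, twirl_productState_inl hd hΦ k⟩
  · exact ⟨_, mul_pos three_pos (pow_pos this _), twirl_productState_inr hd hΦ k⟩

theorem isTwirl_productState (hd : 2 ≤ d) (k : Fin (n + 1) ⊕ Fin n) :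
    ∃ t : ℝ, 0 < t ∧ IsTwirl (productState d n k) ((t : ℂ) • invState d (point d n k)) := by
  obtain ⟨Φ, hΦ⟩ := exists_isTwirlMap hd n
  obtain ⟨t, ht, h⟩ := exists_twirl_productState hd hΦ k
  exact ⟨t, ht, h ▸ hΦ.isTwirl _⟩

theorem point_separableOp (hd : 2 ≤ d) (k : Fin (n + 1) ⊕ Fin n) :
    SeparableOp (invState d (point d n k)) := by
  obtain ⟨Φ, hΦ⟩ := exists_isTwirlMap hd n
  obtain ⟨t, ht, h⟩ := exists_twirl_productState hd hΦ k
  have h1 := (h ▸ hΦ.separableOp (productState_separableOp (d := d) k)).smul (inv_nonneg.2 ht.le)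
  have hne : (t : ℂ) ≠ 0 := by exact_mod_cast ht.ne'
  rwa [smul_smul, Complex.ofReal_inv, inv_mul_cancel₀ hne, one_smul] at h1

open Polynomial in
/-- The generating polynomial of the `x`-coordinates vanishes at `1 - d / 2`. -/
theorem witnessValue_point (hd : 2 ≤ d) (k : Fin (n + 1) ⊕ Fin n) :
    witnessValue d (point d n k) = 0 := by
  rcases k with k | k
  · simp [witnessValue, point]
  · set m := n - 1 - (k : ℕ) with hm
    set f : ℂ[X] := (C (((d : ℂ) - 2) / (3 * d)) + C (2 / (3 * (d : ℂ))) * X) *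
      (1 + C (1 / ((d : ℂ) - 1)) * X : ℂ[X]) ^ m with hf
    have hdeg : f.natDegree < n + 1 := by
      have h1 : (C (((d : ℂ) - 2) / (3 * d)) + C (2 / (3 * (d : ℂ))) * X).natDegree ≤ 1 := by
        rw [add_comm]; exact natDegree_linear_le
      have h2 : (1 + C (1 / ((d : ℂ) - 1)) * X : ℂ[X]).natDegree ≤ 1 := by
        rw [add_comm, ← C_1]; exact natDegree_linear_le
      have h3 := natDegree_mul_le_of_le h1 (natDegree_pow_le_of_le m h2)
      have := k.2
      rw [← hf] at h3
      omega
    have h0 : (d : ℂ) ≠ 0 := by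
      have : d ≠ 0 := by omega
      exact_mod_cast this
    have heval : f.eval (1 - (d : ℂ) / 2) = 0 := by
      rw [hf, eval_mul]
      simp only [eval_add, eval_C, eval_mul, eval_X]
      rw [show ((d : ℂ) - 2) / (3 * d) + 2 / (3 * d) * (1 - d / 2) = 0 by field_simp; ring,
        zero_mul]
    rw [eval_eq_sum_range' hdeg, Finset.sum_range] at heval
    simp only [hf, coeff_eq_pointX hd] at heval
    rw [witnessValue]
    have : ((∑ i : Fin (n + 1), (point d n (.inr k)).2 i *
        (n.choose i * (1 - (d : ℝ) / 2) ^ (i : ℕ)) : ℝ) : ℂ) = 0 := by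
      rw [← heval]
      push_cast
      refine Finset.sum_congr rfl fun i _ => ?_
      simp only [point, ← hm]
      ring
    exact_mod_cast this

/-- The binomial coefficients form a unitriangular matrix. -/
theorem eq_zero_of_sum_mul_choose {N : ℕ} {c : Fin N → ℝ}
    (h : ∀ i < N, ∑ m, c m * ((m : ℕ).choose i : ℝ) = 0) : c = 0 := by
  induction N with
  | zero => exact Subsingleton.elim _ _
  | succ N ih =>
    have hlast : c (Fin.last N) = 0 := by
      have := h N (Nat.lt_succ_self N)
      rw [Fin.sum_univ_castSucc, Finset.sum_eq_zero] at this
      · simpa using this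
      · intro m _
        simp [Nat.choose_eq_zero_of_lt m.2]
    have hinit : (fun m : Fin N => c m.castSucc) = 0 := by
      refine ih fun i hi => ?_
      have := h i (by omega)
      rw [Fin.sum_univ_castSucc, hlast] at this
      simpa using this
    ext m
    refine Fin.lastCases hlast (fun m => ?_) m
    exact congrFun hinit m

theorem sub_two_pos_of_three_le (hd : 3 ≤ d) : (0 : ℝ) < (d : ℝ) - 2 := by
  have : (3 : ℝ) ≤ d := by exact_mod_cast hd
  linarith

theorem pointX_mul (hd : 3 ≤ d) (m : ℕ) (i : Fin (n + 1)) :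
    pointX d n m i * (3 * d * n.choose i * ((d : ℝ) - 1) ^ (i : ℕ)) =
      (d - 2) * m.choose i +
        (if (i : ℕ) = 0 then 0 else 2 * ((d : ℝ) - 1) * (m.choose (i - 1) : ℝ)) := by
  have h0 : (d : ℝ) - 1 ≠ 0 := cast_sub_one_ne_zero (by omega)
  have hd0 : (d : ℝ) ≠ 0 := by
    have : d ≠ 0 := by omega
    exact_mod_cast this
  have hch : (n.choose i : ℝ) ≠ 0 := by
    exact_mod_cast (Nat.choose_pos (show (i : ℕ) ≤ n by omega)).ne'
  rw [pointX]
  by_cases hi : (i : ℕ) = 0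
  · simp only [hi, if_true]
    field_simp
  · simp only [hi, if_false]
    obtain ⟨j, hj⟩ : ∃ j, (i : ℕ) = j + 1 := ⟨i - 1, by omega⟩
    simp only [hj, Nat.add_sub_cancel] at hch ⊢
    field_simp
    ring

/-- The generating polynomials of the `x`-coordinates are `d - 2 + 2 z` times distinct powers of
`1 + z / (d - 1)`, hence linearly independent, which eliminates the points of the second kind. Those
of the `y`-coordinates of the other points are distinct powers as well. -/
theorem affineIndependent_point (hd : 3 ≤ d) : AffineIndependent ℝ (point d n) := by
  rw [affineIndependent_iff_of_fintype]
  intro w hw hsum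
  rw [Finset.weightedVSub_eq_linear_combination _ hw] at hsum
  have h0 : (d : ℝ) - 1 ≠ 0 := cast_sub_one_ne_zero (by omega)
  have hd2 := sub_two_pos_of_three_le hd
  have hx : ∀ i : Fin (n + 1), ∑ k : Fin n, w (.inr k) * pointX d n (n - 1 - k) i = 0 := by
    intro i
    have := congrFun (congrArg Prod.snd hsum) i
    simpa [Prod.snd_sum, Fintype.sum_sum_type, point] using this
  have hy : ∀ j : Fin n, ∑ k : Fin (n + 1), w (.inl k) * pointY d n k j +
      ∑ k : Fin n, w (.inr k) * pointY d n (n - 1 - k) j = 0 := by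
    intro j
    have := congrFun (congrArg Prod.fst hsum) j
    simpa [Prod.fst_sum, Fintype.sum_sum_type, point] using this
  have hp : ∀ i ≤ n, ∑ k : Fin n, w (.inr k) * ((n - 1 - (k : ℕ)).choose i : ℝ) = 0 := by
    intro i
    induction i with
    | zero =>
      intro _
      have h1 := congrArg (fun r => r * (3 * d * n.choose 0 * ((d : ℝ) - 1) ^ 0)) (hx 0)
      simp only [Finset.sum_mul, zero_mul, mul_assoc (w _)] at h1
      have h2 : ∀ k : Fin n, pointX d n (n - 1 - k) 0 * (3 * d * n.choose 0 * ((d : ℝ) - 1) ^ 0) =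
          (d - 2) * (n - 1 - (k : ℕ)).choose 0 := fun k => by
        simpa using pointX_mul hd (n - 1 - k) (0 : Fin (n + 1))
      simp only [h2, mul_left_comm (w _), ← Finset.mul_sum] at h1
      exact (mul_eq_zero.1 h1).resolve_left hd2.ne'
    | succ i ih =>
      intro hi
      have h1 := congrArg (fun r => r * (3 * d * n.choose (i + 1) * ((d : ℝ) - 1) ^ (i + 1)))
        (hx ⟨i + 1, by omega⟩)
      simp only [Finset.sum_mul, zero_mul, mul_assoc (w _)] at h1
      have h2 : ∀ k : Fin n, w (.inr k) * (pointX d n (n - 1 - k) ⟨i + 1, by omega⟩ *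
          (3 * d * n.choose (i + 1) * ((d : ℝ) - 1) ^ (i + 1))) =
          (d - 2) * (w (.inr k) * (n - 1 - (k : ℕ)).choose (i + 1)) +
            2 * (d - 1) * (w (.inr k) * (n - 1 - (k : ℕ)).choose i) := fun k => by
        have := pointX_mul hd (n - 1 - k) (⟨i + 1, by omega⟩ : Fin (n + 1))
        simp only [Nat.succ_ne_zero, if_false, Nat.add_sub_cancel] at this
        rw [this]
        ring
      simp only [h2, Finset.sum_add_distrib, ← Finset.mul_sum] at h1
      rw [ih (by omega), mul_zero, add_zero] at h1
      exact (mul_eq_zero.1 h1).resolve_left hd2.ne'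
  have hb : ∀ k : Fin n, w (.inr k) = 0 := by
    have : (fun m : Fin n => w (.inr m.rev)) = 0 := by
      refine eq_zero_of_sum_mul_choose fun i hi => ?_
      rw [← hp i hi.le]
      refine Fintype.sum_equiv Fin.revPerm _ _ fun m => ?_
      simp only [Fin.revPerm_apply, Fin.val_rev]
      congr 3
      omega
    intro k
    simpa using congrFun this k.rev
  have ha : (fun m : Fin (n + 1) => w (.inl m)) = 0 := by
    refine eq_zero_of_sum_mul_choose fun i hi => ?_
    rcases i with _ | i
    · simpa [Fintype.sum_sum_type, hb] using hw
    · have h1 := hy ⟨i, by omega⟩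
      simp only [hb, zero_mul, Finset.sum_const_zero, add_zero] at h1
      have hch : (n.choose (i + 1) : ℝ) ≠ 0 := by
        exact_mod_cast (Nat.choose_pos (show i + 1 ≤ n by omega)).ne'
      have h2 := congrArg (fun r => r * (n.choose (i + 1) * ((d : ℝ) - 1) ^ (i + 1))) h1
      simp only [Finset.sum_mul, zero_mul] at h2
      rw [← h2]
      refine Finset.sum_congr rfl fun k _ => ?_
      simp only [pointY]
      field_simp
  rintro (k | k)
  · exact congrFun ha k
  · exact hb k

/-- `witnessValue` as a linear functional. -/
noncomputable def witnessFunctional (d n : ℕ) : Coord n →ₗ[ℝ] ℝ where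
  toFun := witnessValue d
  map_add' := witnessValue_add
  map_smul' := witnessValue_smul

/-- The `2n + 1` points are affinely independent in a hyperplane of dimension `2n`. -/
theorem affineSpan_point (hd : 3 ≤ d) (hn : 1 ≤ n) :
    (affineSpan ℝ (Set.range (point d n)) : Set (Coord n)) = {c | witnessValue d c = 0} := by
  set L := witnessFunctional d n with hL
  have hd2 := sub_two_pos_of_three_le hd
  have hn' : (0 : ℝ) < n := by exact_mod_cast hn
  have hL0 : L ≠ 0 := by
    intro h
    have h1 := congrArg (fun f => f ((0, Pi.single 1 1) : Coord n)) h
    have h2 : witnessValue d ((0, Pi.single 1 1) : Coord n) = 0 := h1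
    rw [witnessValue_single hn] at h2
    rcases mul_eq_zero.1 h2 with h3 | h3
    · exact hn'.ne' h3
    · linarith
  have hker : Module.finrank ℝ (LinearMap.ker L) = 2 * n := by
    have h1 := LinearMap.finrank_range_add_finrank_ker L
    rw [LinearMap.range_eq_top_of_surjective _ (LinearMap.surjective hL0), finrank_top] at h1
    simp only [Module.finrank_self, Module.finrank_prod, Module.finrank_fin_fun] at h1
    omega
  have hle : affineSpan ℝ (Set.range (point d n)) ≤ (LinearMap.ker L).toAffineSubspace := by
    rw [affineSpan_le]
    rintro _ ⟨k, rfl⟩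
    exact witnessValue_point (by omega) k
  have heq := (affineIndependent_point hd).affineSpan_eq_of_le_of_card_eq_finrank_add_one hle (by
    rw [Submodule.toAffineSubspace_direction, hker]
    simp
    omega)
  rw [heq]
  rfl

/-- Points of the half-space where the witness is negative are reached from an inner point `p` of
the simplex by any line leaving the hyperplane: `p + δ e` is, for small `δ`, a convex combination
of the vertices of the simplex and a given point on the negative side. -/
theorem exists_separable_addX1 (hd : 3 ≤ d) (hn : 1 ≤ n) {w : Fin (n + 1) ⊕ Fin n → ℝ}
    (hw : ∀ k, 0 < w k) (hw1 : ∑ k, w k = 1) {c : Coord n} (hc : SeparableOp (invState d c))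
    (hneg : witnessValue d c < 0) :
    ∃ δ : ℝ, 0 < δ ∧ SeparableOp (invState d (addX1 (∑ k, w k • point d n k) δ)) := by
  set p : Coord n := ∑ k, w k • point d n k with hp
  set e : Coord n := (0, Pi.single 1 1) with he
  have hd2 := sub_two_pos_of_three_le hd
  have hn' : (0 : ℝ) < n := by exact_mod_cast hn
  have hp0 : witnessValue d p = 0 := by
    have : witnessFunctional d n p = 0 := by
      rw [hp, _root_.map_sum]
      refine Finset.sum_eq_zero fun k _ => ?_
      rw [_root_.map_smul]
      exact smul_eq_zero.2 (Or.inr (witnessValue_point (by omega) k))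
    exact this
  have he0 : witnessValue d e < 0 := by
    rw [he, witnessValue_single hn]
    exact mul_neg_of_pos_of_neg hn' (by linarith)
  -- `u` is the direction, parallel to the hyperplane, from `p` away from `c` along `e`
  set s := witnessValue d e / witnessValue d c with hs
  have hs0 : 0 < s := div_pos_of_neg_of_neg he0 hneg
  set u : Coord n := e + s • (p - c) with hu
  have hu0 : witnessValue d (p + u) = 0 := by
    have h1 : p - c = p + (-1 : ℝ) • c := by rw [neg_one_smul, sub_eq_add_neg]
    rw [hu, h1, witnessValue_add, witnessValue_add, witnessValue_smul, witnessValue_add,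
      witnessValue_smul, hp0, hs]
    have hne := hneg.ne
    field_simp
    ring
  obtain ⟨μ, hμ1, hμ⟩ : ∃ μ : Fin (n + 1) ⊕ Fin n → ℝ, ∑ k, μ k = 1 ∧
      p + u = ∑ k, μ k • point d n k := by
    have hmem : p + u ∈ affineSpan ℝ (Set.range (point d n)) := by
      have : p + u ∈ (affineSpan ℝ (Set.range (point d n)) : Set (Coord n)) := by
        rw [affineSpan_point hd hn]; exact hu0
      exact this
    obtain ⟨μ, h1, h2⟩ := eq_affineCombination_of_mem_affineSpan_of_fintype hmem
    refine ⟨μ, h1, ?_⟩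
    rw [h2, Finset.affineCombination_eq_linear_combination _ _ _ h1]
  -- a step size for which all barycentric coordinates stay positive
  obtain ⟨τ, hτ0, hτ1, hτ⟩ : ∃ τ : ℝ, 0 < τ ∧ τ < 1 ∧ ∀ k, 0 ≤ (1 - τ) * w k + τ * μ k := by
    have hev : ∀ᶠ τ in 𝓝[>] (0 : ℝ), ∀ k, 0 < (1 - τ) * w k + τ * μ k := by
      rw [Filter.eventually_all]
      intro k
      have hcont : Filter.Tendsto (fun τ : ℝ => (1 - τ) * w k + τ * μ k) (𝓝[>] 0)
          (𝓝 ((1 - 0) * w k + 0 * μ k)) := by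
        apply Filter.Tendsto.mono_left _ nhdsWithin_le_nhds
        exact Continuous.tendsto (by fun_prop) 0
      exact hcont.eventually_const_lt (by simpa using hw k)
    have h1 : ∀ᶠ τ in 𝓝[>] (0 : ℝ), τ < 1 :=
      nhdsWithin_le_nhds (eventually_lt_nhds one_pos)
    obtain ⟨τ, ha, hb, hc⟩ := (hev.and (h1.and self_mem_nhdsWithin)).exists
    exact ⟨τ, hc, hb, fun k => (ha k).le⟩
  -- solve `δ / (1 - δ s) = τ`
  set δ := τ / (1 + τ * s) with hδ
  have h1s : 0 < 1 + τ * s := by positivity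
  have hδ0 : 0 < δ := div_pos hτ0 h1s
  have ht : 1 - δ * s = 1 / (1 + τ * s) := by rw [hδ]; field_simp; ring
  refine ⟨δ, hδ0, ?_⟩
  have hkey : addX1 p δ = ∑ k : Option (Fin (n + 1) ⊕ Fin n),
      (k.elim (δ * s) fun k => (1 - δ * s) * ((1 - τ) * w k + τ * μ k)) •
        (k.elim c fun k => point d n k) := by
    have h2 : ∑ k, ((1 - δ * s) * ((1 - τ) * w k + τ * μ k)) • point d n k =
        (1 - δ * s) • ((1 - τ) • p + τ • (p + u)) := by
      rw [hμ, hp]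
      simp only [Finset.smul_sum, ← Finset.sum_add_distrib, smul_smul, ← add_smul]
    have h3 : (1 - δ * s) * τ = δ := by rw [ht, hδ]; ring
    rw [Fintype.sum_option]
    simp only [Option.elim_none, Option.elim_some]
    rw [h2, addX1_eq, ← he]
    have h4 : (1 - τ) • p + τ • (p + u) = p + τ • u := by module
    rw [h4, smul_add, smul_smul, h3, hu]
    module
  rw [hkey, invState_sum]
  · refine SeparableOp.sum fun k => ?_
    rcases k with _ | k
    · exact hc.smul (by simpa using (mul_pos hδ0 hs0).le)
    · refine (point_separableOp (by omega) k).smul ?_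
      simp only [Option.elim_some]
      rw [ht]
      exact mul_nonneg (by positivity) (hτ k)
  · rw [Fintype.sum_option]
    simp only [Option.elim_none, Option.elim_some, ← Finset.mul_sum, Finset.sum_add_distrib,
      hw1, hμ1]
    ring

/-- The equivalence of block positivity and entanglement near an inner point of the simplex. -/
theorem blockPositive_iff_not_separableOp (hd : 3 ≤ d) (hn : 1 ≤ n)
    {w : Fin (n + 1) ⊕ Fin n → ℝ} (hw : ∀ k, 0 < w k) (hw1 : ∑ k, w k = 1) :
    BlockPositive d n ↔
      ∀ δ : ℝ, 0 < δ → ¬ SeparableOp (invState d (addX1 (∑ k, w k • point d n k) δ)) := by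
  have hd2 := sub_two_pos_of_three_le hd
  have hn' : (0 : ℝ) < n := by exact_mod_cast hn
  constructor
  · intro h δ hδ
    refine h.not_separableOp (by omega) ?_
    have hp0 : witnessFunctional d n (∑ k, w k • point d n k) = 0 := by
      rw [_root_.map_sum]
      refine Finset.sum_eq_zero fun k _ => ?_
      rw [_root_.map_smul]
      exact smul_eq_zero.2 (Or.inr (witnessValue_point (by omega) k))
    have hp0' : witnessValue d (∑ k, w k • point d n k) = 0 := hp0
    rw [witnessValue_addX1 hn, hp0', zero_add]
    exact mul_neg_of_pos_of_neg hδ (mul_neg_of_pos_of_neg hn' (by linarith))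
  · intro h
    by_contra hB
    obtain ⟨c, hc, hneg⟩ := exists_separable_invState (by omega) hB
      (point_separableOp (by omega) (.inl 0)) (witnessValue_point (by omega) _)
    obtain ⟨δ, hδ, hsep⟩ := exists_separable_addX1 hd hn hw hw1 hc hneg
    exact h δ hδ hsep

end Hyperplane

/-! ### Expectation values in vectors of Schmidt rank two -/

section SchmidtRank

variable {α γ : Type} [Fintype α]

theorem conjTranspose_kronecker_mulVec_vecOf (C D : Matrix α γ ℂ) (M : Matrix α α ℂ) :
    (C ⊗ₖ D)ᴴ *ᵥ vecOf M = vecOf (Cᴴ * M * D.map star) := by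
  ext p
  simp only [mulVec, dotProduct, conjTranspose_apply, kroneckerMap_apply, vecOf, mul_apply,
    Matrix.map_apply, Fintype.sum_prod_type, Finset.sum_mul, star_mul']
  rw [Finset.sum_comm]
  refine Finset.sum_congr rfl fun g _ => Finset.sum_congr rfl fun f _ => ?_
  ring

theorem qform_conj [Fintype γ] (C D : Matrix α γ ℂ) (K : Matrix (γ × γ) (γ × γ) ℂ)
    (M : Matrix α α ℂ) :
    qform ((C ⊗ₖ D) * K * (C ⊗ₖ D)ᴴ) M = qform K (Cᴴ * M * D.map star) := by
  have h : star (vecOf (Cᴴ * M * D.map star)) = star (vecOf M) ᵥ* (C ⊗ₖ D) := by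
    rw [← conjTranspose_kronecker_mulVec_vecOf, star_mulVec, conjTranspose_conjTranspose]
  rw [qform, qform, h, ← conjTranspose_kronecker_mulVec_vecOf, ← mulVec_mulVec, ← mulVec_mulVec,
    dotProduct_mulVec]

theorem qform_sum {κ : Type} (s : Finset κ) (K : κ → Matrix (α × α) (α × α) ℂ)
    (M : Matrix α α ℂ) : qform (∑ k ∈ s, K k) M = ∑ k ∈ s, qform (K k) M := by
  simp [qform, sum_mulVec, dotProduct_sum]

theorem qform_smul (c : ℂ) (K : Matrix (α × α) (α × α) ℂ) (M : Matrix α α ℂ) :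
    qform (c • K) M = c * qform K M := by
  simp [qform, smul_mulVec]

/-- Nonnegative expectation values in all vectors of Schmidt rank at most two. -/
def RankTwoNonneg (K : Matrix (α × α) (α × α) ℂ) : Prop :=
  ∀ A B : Matrix (Fin 2) α ℂ, 0 ≤ (qform K (Aᵀ * B)).re

theorem RankTwoNonneg.conj [Fintype γ] {K : Matrix (γ × γ) (γ × γ) ℂ} (h : RankTwoNonneg K)
    (C D : Matrix α γ ℂ) : RankTwoNonneg ((C ⊗ₖ D) * K * (C ⊗ₖ D)ᴴ) := by
  intro A B
  have : Cᴴ * (Aᵀ * B) * D.map star = (A * C.map star)ᵀ * (B * D.map star) := by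
    rw [transpose_mul, Matrix.mul_assoc, Matrix.mul_assoc, Matrix.mul_assoc]
    rfl
  rw [qform_conj, this]
  exact h _ _

theorem RankTwoNonneg.sum_smul {κ : Type} [Fintype κ] {K : κ → Matrix (α × α) (α × α) ℂ}
    (h : ∀ k, RankTwoNonneg (K k)) {w : κ → ℝ} (hw : ∀ k, 0 ≤ w k) :
    RankTwoNonneg (∑ k, (w k : ℂ) • K k) := by
  intro A B
  rw [qform_sum, Complex.re_sum]
  refine Finset.sum_nonneg fun k _ => ?_
  rw [qform_smul, Complex.re_ofReal_mul]
  exact mul_nonneg (hw k) (h k A B)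

/-- Every compression of a Hermitian operator that is nonnegative on vectors of Schmidt rank two
to a pair of qubits is positive. -/
theorem RankTwoNonneg.posSemidef_compression {K : Matrix (α × α) (α × α) ℂ}
    (h : RankTwoNonneg K) (hK : K.IsHermitian) (A B : Matrix (Fin 2) α ℂ) :
    ((A ⊗ₖ B) * K * (A ⊗ₖ B)ᴴ).PosSemidef := by
  have hH : ((A ⊗ₖ B) * K * (A ⊗ₖ B)ᴴ).IsHermitian := isHermitian_mul_mul_conjTranspose _ hK
  refine PosSemidef.of_dotProduct_mulVec_nonneg hH fun x => ?_
  have hq : star x ⬝ᵥ ((A ⊗ₖ B) * K * (A ⊗ₖ B)ᴴ) *ᵥ x =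
      qform ((A ⊗ₖ B) * K * (A ⊗ₖ B)ᴴ) (of fun s t => x (s, t)) := rfl
  have him := hH.im_star_dotProduct_mulVec_self x
  rw [Complex.le_def]
  refine ⟨?_, by simpa using him.symm⟩
  have e : (of fun s t => x (s, t) : Matrix (Fin 2) (Fin 2) ℂ) =
      (of fun t s => x (s, t) : Matrix (Fin 2) (Fin 2) ℂ)ᵀ * 1 := by
    rw [Matrix.mul_one]; rfl
  rw [hq, e]
  exact h.conj A B _ 1

/-- An orthonormal basis of the column space of a matrix of rank two. -/
theorem exists_isometry_of_rank_eq_two [DecidableEq α] {M : Matrix α α ℂ} (hM : M.rank = 2) :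
    ∃ A : Matrix (Fin 2) α ℂ, A * Aᴴ = 1 ∧ Aᴴ * A * M = M := by
  let S := LinearMap.range (toEuclideanLin M)
  have hS : Module.finrank ℂ S = 2 := by
    rw [← hM]
    change Module.finrank ℂ (LinearMap.range (toEuclideanLin M)) = _
    rw [toEuclideanLin_eq_toLin_orthonormal]
    exact (rank_eq_finrank_range_toLin _ _ _).symm
  let b : OrthonormalBasis (Fin 2) ℂ S := (stdOrthonormalBasis ℂ S).reindex (finCongr hS)
  let A : Matrix (Fin 2) α ℂ := of fun s f => star ((b s : EuclideanSpace ℂ α) f)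
  have hinner : ∀ x y : EuclideanSpace ℂ α, inner ℂ x y = ∑ f, star (x f) * y f := fun x y => by
    simp [PiLp.inner_apply, mul_comm]
  refine ⟨A, ?_, ?_⟩
  · ext s t
    have h1 : inner ℂ (b s) (b t) = if s = t then (1 : ℂ) else 0 :=
      orthonormal_iff_ite.1 b.orthonormal s t
    rw [Submodule.coe_inner, hinner] at h1
    simp only [mul_apply, A, of_apply, conjTranspose_apply, star_star, h1, one_apply]
  · ext i j
    let v : S := ⟨toEuclideanLin M (EuclideanSpace.single j 1), LinearMap.mem_range_self _ _⟩
    have hv : ∀ f, (v : EuclideanSpace ℂ α) f = M f j := fun f => by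
      simp [v]
    have h1 := congrArg (fun x : S => (x : EuclideanSpace ℂ α) i) (b.sum_repr' v)
    simp only [Submodule.coe_inner, hinner, hv] at h1
    rw [Matrix.mul_assoc, mul_apply, ← h1]
    simp [mul_apply, A, mul_comm]

/-- The Schmidt decomposition of a vector of Schmidt rank two, up to a change of local bases. -/
theorem exists_factorization [DecidableEq α] {M : Matrix α α ℂ} (hM : M.rank = 2) :
    ∃ (A B : Matrix (Fin 2) α ℂ) (φ : Matrix (Fin 2) (Fin 2) ℂ),
      A * Aᴴ = 1 ∧ B * Bᴴ = 1 ∧ M = Aᴴ * φ * B := by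
  obtain ⟨A, hA, hAM⟩ := exists_isometry_of_rank_eq_two hM
  obtain ⟨B, hB, hBM⟩ := exists_isometry_of_rank_eq_two ((rank_conjTranspose M).trans hM)
  refine ⟨A, B, A * M * Bᴴ, hA, hB, ?_⟩
  have h := congrArg conjTranspose hBM
  simp only [conjTranspose_mul, conjTranspose_conjTranspose] at h
  calc M = Aᴴ * A * (M * (Bᴴ * B)) := by rw [h, hAM]
    _ = Aᴴ * (A * M * Bᴴ) * B := by simp only [Matrix.mul_assoc]

theorem exists_vecMulVec_of_rank_le_one [DecidableEq α] {M : Matrix α α ℂ} (hM : M.rank ≤ 1) :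
    ∃ u v : α → ℂ, M = vecMulVec u v := by
  obtain ⟨u, hu⟩ := finrank_le_one_iff.1 hM
  choose c hc using fun j => hu ⟨M.mulVecLin (Pi.single j 1), LinearMap.mem_range_self _ _⟩
  refine ⟨u, c, ?_⟩
  ext i j
  have := congrArg (fun x : LinearMap.range M.mulVecLin => (x : α → ℂ) i) (hc j)
  simp at this
  rw [vecMulVec_apply, mul_comm, ← this]

theorem kronecker_conj_apply (A B : Matrix γ α ℂ) (K : Matrix (α × α) (α × α) ℂ)
    (p q : γ × γ) : ((A ⊗ₖ B) * K * (A ⊗ₖ B)ᴴ) p q =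
      ∑ f, ∑ g, ∑ f', ∑ g', A p.1 f * B p.2 g * K (f, g) (f', g') *
        (star (A q.1 f') * star (B q.2 g')) := by
  simp only [mul_apply, conjTranspose_apply, kroneckerMap_apply, Finset.sum_mul, star_mul',
    Fintype.sum_prod_type]
  have h : ∀ F : α → α → α → α → ℂ, ∑ f', ∑ g', ∑ f, ∑ g, F f g f' g' =
      ∑ f, ∑ g, ∑ f', ∑ g', F f g f' g' := by
    intro F
    calc ∑ f', ∑ g', ∑ f, ∑ g, F f g f' g'
        = ∑ f', ∑ f, ∑ g', ∑ g, F f g f' g' :=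
          Finset.sum_congr rfl fun _ _ => Finset.sum_comm
      _ = ∑ f, ∑ f', ∑ g', ∑ g, F f g f' g' := Finset.sum_comm
      _ = ∑ f, ∑ f', ∑ g, ∑ g', F f g f' g' :=
          Finset.sum_congr rfl fun _ _ => Finset.sum_congr rfl fun _ _ => Finset.sum_comm
      _ = _ := Finset.sum_congr rfl fun _ _ => Finset.sum_comm
  exact h fun f g f' g' => A p.1 f * B p.2 g * K (f, g) (f', g') *
        (star (A q.1 f') * star (B q.2 g'))

theorem sum_swap_outer (F : α → α → α → ℂ) :
    ∑ g, ∑ f', ∑ g', F g f' g' = ∑ g, ∑ f', ∑ g', F g' f' g := by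
  calc ∑ g, ∑ f', ∑ g', F g f' g' = ∑ f', ∑ g, ∑ g', F g f' g' := Finset.sum_comm
    _ = ∑ f', ∑ g, ∑ g', F g' f' g := Finset.sum_congr rfl fun _ _ => Finset.sum_comm
    _ = _ := Finset.sum_comm

/-- Partial transposition turns a local operation of the second party into its conjugate. -/
theorem partialTranspose_conj (A B : Matrix γ α ℂ) (K : Matrix (α × α) (α × α) ℂ) :
    partialTranspose ((A ⊗ₖ B) * K * (A ⊗ₖ B)ᴴ) =
      (A ⊗ₖ B.map star) * partialTranspose K * (A ⊗ₖ B.map star)ᴴ := by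
  ext p q
  rw [partialTranspose, kronecker_conj_apply, kronecker_conj_apply]
  refine Finset.sum_congr rfl fun f _ => ?_
  rw [sum_swap_outer]
  refine Finset.sum_congr rfl fun g _ => Finset.sum_congr rfl fun f' _ =>
    Finset.sum_congr rfl fun g' _ => ?_
  simp only [partialTranspose, Matrix.map_apply, star_star]
  ring

/-- On product vectors the expectation values of an operator and of its partial transpose agree up
to complex conjugation of one factor. -/
theorem qform_vecMulVec (K : Matrix (α × α) (α × α) ℂ) (u v : α → ℂ) :
    qform K (vecMulVec u v) = qform (partialTranspose K) (vecMulVec u (star v)) := by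
  simp only [qform, dotProduct, mulVec, vecOf, vecMulVec_apply, Pi.star_apply, star_mul',
    Fintype.sum_prod_type, Finset.mul_sum, partialTranspose, star_star]
  refine Finset.sum_congr rfl fun f _ => ?_
  rw [sum_swap_outer]
  refine Finset.sum_congr rfl fun g _ => Finset.sum_congr rfl fun f' _ =>
    Finset.sum_congr rfl fun g' _ => ?_
  ring

end SchmidtRank

/-! ### Werner states -/

section Werner

variable {d n : ℕ}

/-- The partial transpose of `1 + β F`, written as `1 + β d P`. -/
noncomputable def wernerX (d : ℕ) (β : ℝ) : Matrix (Fin d × Fin d) (Fin d × Fin d) ℂ :=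
  1 + ((β : ℂ) * d) • maxEnt d

theorem wernerX_half : wernerX d (-1 / 2) = halfX d := by
  rw [wernerX, halfX]
  push_cast
  module

theorem partialTranspose_one {α β : Type} [DecidableEq α] [DecidableEq β] :
    partialTranspose (1 : Matrix (α × β) (α × β) ℂ) = 1 := by
  ext ⟨a, b⟩ ⟨a', b'⟩
  simp [partialTranspose, one_apply, eq_comm (a := b)]

theorem partialTranspose_flip (hd : d ≠ 0) : partialTranspose (flip d) = (d : ℂ) • maxEnt d := by
  have h0 : (d : ℂ) ≠ 0 := by exact_mod_cast hd
  ext ⟨a, b⟩ ⟨a', b'⟩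
  simp only [partialTranspose, flip, maxEnt, Matrix.smul_apply, smul_eq_mul, mul_ite, mul_zero,
    mul_one_div_cancel h0, eq_comm (a := b')]

theorem partialTranspose_maxEnt (d : ℕ) :
    partialTranspose (maxEnt d) = (1 / (d : ℂ)) • flip d := by
  ext ⟨a, b⟩ ⟨a', b'⟩
  simp only [partialTranspose, flip, maxEnt, Matrix.smul_apply, smul_eq_mul, mul_ite, mul_zero,
    mul_one, eq_comm (a := b)]

theorem partialTranspose_add {α β : Type} (M N : Matrix (α × β) (α × β) ℂ) :
    partialTranspose (M + N) = partialTranspose M + partialTranspose N := rfl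

theorem partialTranspose_sub {α β : Type} (M N : Matrix (α × β) (α × β) ℂ) :
    partialTranspose (M - N) = partialTranspose M - partialTranspose N := rfl

theorem partialTranspose_smul {α β : Type} (c : ℂ) (M : Matrix (α × β) (α × β) ℂ) :
    partialTranspose (c • M) = c • partialTranspose M := rfl

theorem partialTranspose_werner (hd : d ≠ 0) (β : ℝ) : partialTranspose (werner d β) =
    (((d : ℝ) ^ 2 + β * d)⁻¹ : ℝ) • wernerX d β := by
  rw [werner, partialTranspose_smul, partialTranspose_add, partialTranspose_one,
    partialTranspose_smul, partialTranspose_flip hd, wernerX, smul_smul, ← Complex.coe_smul]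
  push_cast
  rfl

theorem flip_conjTranspose (d : ℕ) : (flip d)ᴴ = flip d := by
  ext p q
  simp only [flip, conjTranspose_apply, apply_ite star, star_one, star_zero]
  congr 1
  rw [and_comm, eq_comm (a := p.2), eq_comm (a := p.1)]

theorem flip_mul_self (d : ℕ) : flip d * flip d = 1 := by
  ext p q
  rw [mul_apply, Finset.sum_eq_single (p.2, p.1)]
  · simp only [flip, one_apply, Prod.ext_iff, and_self, if_true, one_mul, and_comm]
  · intro r _ hr
    have : ¬ (p.1 = r.2 ∧ p.2 = r.1) := fun h => hr (Prod.ext h.2.symm h.1.symm)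
    simp [flip, this]
  · simp

theorem one_sub_flip_posSemidef (d : ℕ) : (1 - flip d).PosSemidef := by
  have h : 1 - flip d = (1 / 2 : ℂ) • ((1 - flip d)ᴴ * (1 - flip d)) := by
    rw [conjTranspose_sub, conjTranspose_one, flip_conjTranspose, Matrix.sub_mul, Matrix.mul_sub,
      Matrix.mul_sub, flip_mul_self]
    simp only [Matrix.one_mul, Matrix.mul_one]
    module
  rw [h]
  exact (posSemidef_conjTranspose_mul_self _).smul (by positivity)

theorem one_add_flip_posSemidef (d : ℕ) : (1 + flip d).PosSemidef := by
  have h : 1 + flip d = (1 / 2 : ℂ) • ((1 + flip d)ᴴ * (1 + flip d)) := by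
    rw [conjTranspose_add, conjTranspose_one, flip_conjTranspose, Matrix.add_mul, Matrix.mul_add,
      Matrix.mul_add, flip_mul_self]
    simp only [Matrix.one_mul, Matrix.mul_one]
    module
  rw [h]
  exact (posSemidef_conjTranspose_mul_self _).smul (by positivity)

open scoped MatrixOrder in
theorem pairTensor_posSemidef {X : Fin n → Matrix (Fin d × Fin d) (Fin d × Fin d) ℂ}
    (h : ∀ i, (X i).PosSemidef) : (pairTensor X).PosSemidef := by
  choose Y hY using fun i => CStarAlgebra.nonneg_iff_eq_star_mul_self.mp (h i).nonneg
  have : pairTensor X = (pairTensor Y)ᴴ * pairTensor Y := by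
    rw [pairTensor_conjTranspose, pairTensor_mul]
    congr 1
    ext1 i
    exact hY i
  rw [this]
  exact posSemidef_conjTranspose_mul_self _

theorem wernerX_isHermitian (β : ℝ) : (wernerX d β).IsHermitian := by
  rw [IsHermitian, wernerX, conjTranspose_add, conjTranspose_one, conjTranspose_smul,
    maxEnt_conjTranspose]
  simp

theorem pairTensor_wernerX_isHermitian (β : ℝ) :
    (pairTensor fun _ : Fin n => wernerX d β).IsHermitian := by
  rw [IsHermitian, pairTensor_conjTranspose]
  simp only [(wernerX_isHermitian β).eq]

/-- Vectors of Schmidt rank one have nonnegative expectation values, since the partial transpose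
of the operator is positive. -/
theorem qform_halfX_vecMulVec_nonneg (hd : d ≠ 0) (u v : (Fin n → Fin d) → ℂ) :
    0 ≤ (qform (pairTensor fun _ : Fin n => halfX d) (vecMulVec u v)).re := by
  rw [qform_vecMulVec, partialTranspose_pairTensor]
  have h0 : (d : ℂ) ≠ 0 := by exact_mod_cast hd
  have h : (partialTranspose (halfX d)).PosSemidef := by
    have h1 : partialTranspose (halfX d) = (1 / 2 : ℂ) • 1 + (1 / 2 : ℂ) • (1 - flip d) := by
      rw [halfX, partialTranspose_add, partialTranspose_smul, partialTranspose_sub,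
        partialTranspose_one, partialTranspose_maxEnt, smul_smul]
      have : (1 - (d : ℂ) / 2) * (1 / d) = 1 / d - 1 / 2 := by field_simp
      rw [this]
      module
    rw [h1]
    exact (PosSemidef.one.smul (by positivity)).add
      ((one_sub_flip_posSemidef d).smul (by positivity))
  exact (Complex.le_def.1 ((pairTensor_posSemidef fun _ => h).dotProduct_mulVec_nonneg _)).1

/-- `Y` is a positive combination of operators obtained from `halfX d` by local operations. -/
def IsLocalImage (Y : Matrix (Fin d × Fin d) (Fin d × Fin d) ℂ) : Prop :=
  ∃ (κ : Type) (_ : Fintype κ) (w : κ → ℝ) (C D : κ → Matrix (Fin d) (Fin d) ℂ),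
    (∀ k, 0 ≤ w k) ∧ Y = ∑ k, (w k : ℂ) • ((C k ⊗ₖ D k) * halfX d * (C k ⊗ₖ D k)ᴴ)

theorem IsLocalImage.add {Y Z : Matrix (Fin d × Fin d) (Fin d × Fin d) ℂ} (hY : IsLocalImage Y)
    (hZ : IsLocalImage Z) : IsLocalImage (Y + Z) := by
  obtain ⟨κ, _, w, C, D, hw, rfl⟩ := hY
  obtain ⟨κ', _, w', C', D', hw', rfl⟩ := hZ
  refine ⟨κ ⊕ κ', inferInstance, Sum.elim w w', Sum.elim C C', Sum.elim D D', ?_, by simp⟩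
  rintro (k | k)
  · exact hw k
  · exact hw' k

theorem IsLocalImage.smul {Y : Matrix (Fin d × Fin d) (Fin d × Fin d) ℂ} (hY : IsLocalImage Y)
    {t : ℝ} (ht : 0 ≤ t) : IsLocalImage ((t : ℂ) • Y) := by
  obtain ⟨κ, _, w, C, D, hw, rfl⟩ := hY
  refine ⟨κ, inferInstance, fun k => t * w k, C, D, fun k => mul_nonneg ht (hw k), ?_⟩
  simp only [Finset.smul_sum, smul_smul, Complex.ofReal_mul]

theorem IsLocalImage.conj {Y : Matrix (Fin d × Fin d) (Fin d × Fin d) ℂ} (hY : IsLocalImage Y)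
    (C D : Matrix (Fin d) (Fin d) ℂ) : IsLocalImage ((C ⊗ₖ D) * Y * (C ⊗ₖ D)ᴴ) := by
  obtain ⟨κ, _, w, C', D', hw, rfl⟩ := hY
  refine ⟨κ, inferInstance, w, fun k => C * C' k, fun k => D * D' k, hw, ?_⟩
  simp only [Matrix.mul_sum, Matrix.sum_mul, Matrix.mul_smul, Matrix.smul_mul, mul_kronecker_mul,
    conjTranspose_mul, Matrix.mul_assoc]

theorem IsLocalImage.sum {κ : Type} [Fintype κ]
    {Y : κ → Matrix (Fin d × Fin d) (Fin d × Fin d) ℂ} (hY : ∀ k, IsLocalImage (Y k)) :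
    IsLocalImage (∑ k, Y k) := by
  classical
  induction (Finset.univ : Finset κ) using Finset.induction_on with
  | empty => exact ⟨Empty, inferInstance, fun _ => 0, fun _ => 0, fun _ => 0, by simp, by simp⟩
  | insert a s ha ih => rw [Finset.sum_insert ha]; exact (hY a).add ih

theorem isLocalImage_halfX : IsLocalImage (halfX d) :=
  ⟨Unit, inferInstance, fun _ => 1, fun _ => 1, fun _ => 1, by simp, by simp⟩

/-- For `-1/2 ≤ β ≤ 1` the operator `1 + β F` arises from `1 - F / 2` by mixing with twirls of the
product vectors `|00⟩` and `|01⟩`. -/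
theorem isLocalImage_wernerX (hd : 2 ≤ d) {β : ℝ} (hβ : β ∈ Set.Icc (-1 / 2 : ℝ) 1) :
    IsLocalImage (wernerX d β) := by
  let z : Fin d := ⟨0, by omega⟩
  let o : Fin d := ⟨1, by omega⟩
  have hzo : z ≠ o := by simp [z, o]
  have hd0 : (d : ℂ) ≠ 0 := by
    have : d ≠ 0 := by omega
    exact_mod_cast this
  have hd1 : (d : ℂ) + 1 ≠ 0 := by exact_mod_cast Nat.succ_ne_zero d
  have hd2 := sq_sub_one_ne_zero hd
  obtain ⟨κ, _, w, V, hw, -, h⟩ := isAverage_twirl hd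
  have htwirl : ∀ Y : Matrix (Fin d × Fin d) (Fin d × Fin d) ℂ, IsLocalImage Y →
      IsLocalImage ((maxEnt d * Y).trace • maxEnt d + ((1 - maxEnt d) * Y).trace • complEnt d) := by
    intro Y hY
    have hY' := h Y
    simp only at hY'
    rw [hY']
    exact IsLocalImage.sum fun k => (hY.conj _ _).smul (hw k)
  have hcut : ∀ a b : Fin d, (Matrix.single a a (1 : ℂ) ⊗ₖ Matrix.single b b (1 : ℂ)) * halfX d *
      (Matrix.single a a (1 : ℂ) ⊗ₖ Matrix.single b b (1 : ℂ))ᴴ =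
      halfX d (a, b) (a, b) • Matrix.single (a, b) (a, b) 1 := by
    intro a b
    rw [single_kronecker_single, conjTranspose_single]
    simp
  have h00 : IsLocalImage (Matrix.single (z, z) (z, z) (1 : ℂ)) := by
    have h1 := (isLocalImage_halfX.conj (Matrix.single z z (1 : ℂ)) (Matrix.single z z 1)).smul
      (t := 2) (by norm_num)
    rw [hcut, smul_smul] at h1
    have h2 : ((2 : ℝ) : ℂ) * halfX d (z, z) (z, z) = 1 := by
      simp [halfX, maxEnt]
      field_simp
      ring
    rwa [h2, one_smul] at h1
  have h01 : IsLocalImage (Matrix.single (z, o) (z, o) (1 : ℂ)) := by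
    have h1 := isLocalImage_halfX.conj (Matrix.single z z (1 : ℂ)) (Matrix.single o o 1)
    have h2 : halfX d (z, o) (z, o) = 1 := by
      simp [halfX, maxEnt, hzo]
    rwa [hcut, h2, one_smul] at h1
  have t00 := htwirl _ h00
  have t01 := htwirl _ h01
  rw [trace_maxEnt_mul_single, trace_sub_maxEnt_mul_single] at t00 t01
  simp only [hzo, if_true, if_false, and_self, zero_smul, zero_add, sub_zero,
    one_smul] at t00 t01
  have hdR : (0 : ℝ) ≤ d := Nat.cast_nonneg d
  have hdR1 : (0 : ℝ) ≤ (d : ℝ) - 1 := by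
    have : (2 : ℝ) ≤ d := by exact_mod_cast hd
    linarith
  have hone : IsLocalImage (1 : Matrix (Fin d × Fin d) (Fin d × Fin d) ℂ) := by
    convert (t00.smul hdR).add (t01.smul (mul_nonneg hdR hdR1)) using 1
    rw [complEnt]
    push_cast
    ext p q
    simp only [Matrix.add_apply, Matrix.smul_apply, Matrix.sub_apply, smul_eq_mul]
    field_simp
    ring
  -- `1 + β F` is a mixture of `1` with `1 - F / 2` or with `1 + F`
  rcases le_total β 0 with hβ0 | hβ0
  · convert (isLocalImage_halfX.smul (show 0 ≤ -2 * β by linarith)).add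
      (hone.smul (show 0 ≤ 1 + 2 * β by linarith [hβ.1])) using 1
    rw [← wernerX_half, wernerX, wernerX]
    push_cast
    module
  · convert (t00.smul (show 0 ≤ β * d * (d + 1) by positivity)).add
      (hone.smul (show 0 ≤ 1 - β by linarith [hβ.2])) using 1
    rw [complEnt, wernerX]
    push_cast
    ext p q
    simp only [Matrix.add_apply, Matrix.smul_apply, Matrix.sub_apply, smul_eq_mul]
    field_simp
    ring

theorem rankTwoNonneg_of_isLocalImage {Y : Matrix (Fin d × Fin d) (Fin d × Fin d) ℂ}
    (hY : IsLocalImage Y) (h : BlockPositive d n) :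
    RankTwoNonneg (pairTensor fun _ : Fin n => Y) := by
  obtain ⟨κ, _, w, C, D, hw, rfl⟩ := hY
  have h1 : (pairTensor fun _ : Fin n =>
      ∑ k, (w k : ℂ) • ((C k ⊗ₖ D k) * halfX d * (C k ⊗ₖ D k)ᴴ)) =
      ∑ K : Fin n → κ, ((∏ i, w (K i) : ℝ) : ℂ) •
        ((tens (fun i => C (K i)) ⊗ₖ tens (fun i => D (K i))) *
          (pairTensor fun _ => halfX d) *
            (tens (fun i => C (K i)) ⊗ₖ tens (fun i => D (K i)))ᴴ) := by
    rw [pairTensor_sum]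
    refine Finset.sum_congr rfl fun K _ => ?_
    rw [pairTensor_smul, tens_kronecker, pairTensor_conjTranspose, pairTensor_mul, pairTensor_mul]
    push_cast
    rfl
  rw [h1]
  exact RankTwoNonneg.sum_smul (fun K => RankTwoNonneg.conj h _ _)
    fun K => Finset.prod_nonneg fun i _ => hw _

theorem werner_scale_pos (hd : 2 ≤ d) {β : ℝ} (hβ : -1 / 2 ≤ β) :
    0 < ((d : ℝ) ^ 2 + β * d)⁻¹ := by
  have : (2 : ℝ) ≤ d := by exact_mod_cast hd
  apply inv_pos.2
  nlinarith

theorem pairTensor_partialTranspose_werner (hd : 2 ≤ d) (β : ℝ) :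
    (pairTensor fun _ : Fin n => partialTranspose (werner d β)) =
      ((((d : ℝ) ^ 2 + β * d)⁻¹ ^ n : ℝ) : ℂ) • pairTensor fun _ : Fin n => wernerX d β := by
  rw [partialTranspose_werner (by omega)]
  have := pairTensor_smul (fun _ : Fin n => ((((d : ℝ) ^ 2 + β * d)⁻¹ : ℝ) : ℂ))
    (fun _ => wernerX d β)
  simp only [Complex.coe_smul] at this
  rw [this]
  simp

theorem not_nDistillable_of_rankTwoNonneg (hd : 2 ≤ d) {β : ℝ} (hβ : -1 / 2 ≤ β)
    (h : RankTwoNonneg (pairTensor fun _ : Fin n => wernerX d β)) :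
    ¬ NDistillable n (werner d β) := by
  rintro ⟨A, B, -, -, hneg⟩
  apply hneg
  rw [partialTranspose_conj, partialTranspose_pairTensor, pairTensor_partialTranspose_werner hd,
    Matrix.mul_smul, Matrix.smul_mul]
  refine (h.posSemidef_compression (pairTensor_wernerX_isHermitian β) _ _).smul ?_
  have := pow_pos (werner_scale_pos hd hβ) n
  exact_mod_cast this.le

/-- A vector of Schmidt rank two with negative expectation value yields a distillation
protocol: project onto the supports of its reduced states. -/
theorem nDistillable_of_qform_neg (hd : 2 ≤ d) {β : ℝ} (hβ : -1 / 2 ≤ β)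
    {M : Matrix (Fin n → Fin d) (Fin n → Fin d) ℂ} (hM : M.rank = 2)
    (h : (qform (pairTensor fun _ : Fin n => wernerX d β) M).re < 0) :
    NDistillable n (werner d β) := by
  obtain ⟨A, B, φ, hA, hB, rfl⟩ := exists_factorization hM
  refine ⟨A, B, hA, hB, fun hpos => ?_⟩
  rw [partialTranspose_conj, partialTranspose_pairTensor, pairTensor_partialTranspose_werner hd,
    Matrix.mul_smul, Matrix.smul_mul] at hpos
  have h1 := hpos.dotProduct_mulVec_nonneg (vecOf φ)
  have h2 : qform (((((d : ℝ) ^ 2 + β * d)⁻¹ ^ n : ℝ) : ℂ) •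
      ((A ⊗ₖ B.map star) * (pairTensor fun _ : Fin n => wernerX d β) *
      (A ⊗ₖ B.map star)ᴴ)) φ = ((((d : ℝ) ^ 2 + β * d)⁻¹ ^ n : ℝ) : ℂ) *
      qform (pairTensor fun _ : Fin n => wernerX d β) (Aᴴ * φ * B) := by
    rw [qform_smul, qform_conj]
    congr 3
    ext i j
    simp
  have h3 := (Complex.le_def.1 h1).1
  change (0 : ℂ).re ≤ (qform _ φ).re at h3
  rw [h2, Complex.re_ofReal_mul, Complex.zero_re] at h3
  have := mul_neg_of_pos_of_neg (pow_pos (werner_scale_pos hd hβ) n) h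
  linarith

theorem continuous_qform_wernerX (M : Matrix (Fin n → Fin d) (Fin n → Fin d) ℂ) :
    Continuous fun β : ℝ => (qform (pairTensor fun _ : Fin n => wernerX d β) M).re := by
  simp only [qform, dotProduct, mulVec, pairTensor, wernerX, Matrix.add_apply, Matrix.smul_apply,
    smul_eq_mul]
  fun_prop

theorem qform_partialTranspose_werner_neg_iff (hd : 2 ≤ d) {β : ℝ} (hβ : -1 / 2 ≤ β)
    (M : Matrix (Fin n → Fin d) (Fin n → Fin d) ℂ) :
    (qform (pairTensor fun _ : Fin n => partialTranspose (werner d β)) M).re < 0 ↔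
      (qform (pairTensor fun _ : Fin n => wernerX d β) M).re < 0 := by
  rw [pairTensor_partialTranspose_werner hd, qform_smul, Complex.re_ofReal_mul]
  have := pow_pos (werner_scale_pos hd hβ) n
  constructor
  · intro h
    by_contra! h'
    have := mul_nonneg this.le h'
    linarith
  · exact mul_neg_of_pos_of_neg this

theorem BlockPositive.wernerUndistillable (hd : 2 ≤ d) (h : BlockPositive d n) :
    WernerUndistillable d n := fun _ hβ =>
  not_nDistillable_of_rankTwoNonneg hd hβ.1
    (rankTwoNonneg_of_isLocalImage (isLocalImage_wernerX hd hβ) h)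

theorem blockPositive_of_forall_rank_two (hd : 2 ≤ d)
    (h : ∀ M : Matrix (Fin n → Fin d) (Fin n → Fin d) ℂ, M.rank = 2 →
      0 ≤ (qform (pairTensor fun _ : Fin n => halfX d) M).re) : BlockPositive d n := by
  intro A B
  by_cases h2 : (Aᵀ * B).rank = 2
  · exact h _ h2
  · have hle : (Aᵀ * B).rank ≤ 2 :=
      (rank_mul_le_left _ _).trans (by simpa using rank_le_card_width Aᵀ)
    obtain ⟨u, v, huv⟩ := exists_vecMulVec_of_rank_le_one (M := Aᵀ * B) (by omega)
    rw [huv]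
    exact qform_halfX_vecMulVec_nonneg (by omega) u v

theorem forall_rank_two_of_not_nDistillable (hd : 2 ≤ d)
    (h : ¬ NDistillable n (werner d (-1 / 2))) :
    ∀ M : Matrix (Fin n → Fin d) (Fin n → Fin d) ℂ, M.rank = 2 →
      0 ≤ (qform (pairTensor fun _ : Fin n => halfX d) M).re := by
  intro M hM
  by_contra! hneg
  rw [← wernerX_half] at hneg
  exact h (nDistillable_of_qform_neg hd le_rfl hM hneg)

theorem wernerUndistillable_iff_blockPositive (hd : 2 ≤ d) :
    WernerUndistillable d n ↔ BlockPositive d n :=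
  ⟨fun h => blockPositive_of_forall_rank_two hd
    (forall_rank_two_of_not_nDistillable hd (h _ ⟨le_rfl, by norm_num⟩)),
    fun h => h.wernerUndistillable hd⟩

/-- Negative expectation values are an open condition in `β`, so a vector that is negative at
`β = -1/2` distills Werner states with slightly larger `β` too. -/
theorem wernerUndistillable_tfae (hd : 2 ≤ d) (n : ℕ) :
    [ WernerUndistillable d n,
      ¬ NDistillable n (werner d (-1 / 2)),
      ∀ᶠ β in 𝓝[>] (-1 / 2 : ℝ), ¬ NDistillable n (werner d β),
      ¬ ∃ M : Matrix (Fin n → Fin d) (Fin n → Fin d) ℂ, M.rank = 2 ∧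
        (star (fun p : (Fin n → Fin d) × (Fin n → Fin d) => M p.1 p.2) ⬝ᵥ
          (pairTensor (fun _ : Fin n => partialTranspose (werner d (-1 / 2)))) *ᵥ
            (fun p : (Fin n → Fin d) × (Fin n → Fin d) => M p.1 p.2)).re < 0 ].TFAE := by
  have hq : ∀ M : Matrix (Fin n → Fin d) (Fin n → Fin d) ℂ,
      (star (fun p : (Fin n → Fin d) × (Fin n → Fin d) => M p.1 p.2) ⬝ᵥ
          (pairTensor (fun _ : Fin n => partialTranspose (werner d (-1 / 2)))) *ᵥ
            (fun p : (Fin n → Fin d) × (Fin n → Fin d) => M p.1 p.2)).re < 0 ↔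
      (qform (pairTensor fun _ : Fin n => wernerX d (-1 / 2)) M).re < 0 := fun M =>
    qform_partialTranspose_werner_neg_iff hd le_rfl M
  tfae_have 1 → 2 := fun h => h _ ⟨le_rfl, by norm_num⟩
  tfae_have 1 → 3 := by
    intro h
    have : Set.Ioo (-1 / 2 : ℝ) 1 ∈ 𝓝[>] (-1 / 2 : ℝ) := Ioo_mem_nhdsGT (by norm_num)
    filter_upwards [this] with β hβ using h β ⟨hβ.1.le, hβ.2.le⟩
  tfae_have 2 → 4 := by
    rintro h ⟨M, hM, hneg⟩
    exact h (nDistillable_of_qform_neg hd le_rfl hM ((hq M).1 hneg))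
  tfae_have 3 → 4 := by
    rintro h ⟨M, hM, hneg⟩
    have h1 : ∀ᶠ β in 𝓝[>] (-1 / 2 : ℝ),
        (qform (pairTensor fun _ : Fin n => wernerX d β) M).re < 0 :=
      nhdsWithin_le_nhds ((continuous_qform_wernerX M).continuousAt.eventually_lt_const
        ((hq M).1 hneg))
    obtain ⟨β, ha, hb, hc⟩ := (h.and (h1.and self_mem_nhdsWithin)).exists
    exact ha (nDistillable_of_qform_neg hd (le_of_lt hc) hM hb)
  tfae_have 4 → 1 := by
    intro h
    refine (blockPositive_of_forall_rank_two hd fun M hM => ?_).wernerUndistillable hd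
    by_contra! hneg
    rw [← wernerX_half] at hneg
    exact h ⟨M, hM, (hq M).2 hneg⟩
  tfae_finish

end Werner

/-! ### Explicit base points -/

section BasePoints

open Polynomial

variable {d n : ℕ}

/-- The factorial moments of the binomial distribution. -/
theorem sum_choose_mul_choose_mul_pow (N j : ℕ) (r : ℝ) :
    ∑ k ∈ Finset.range (N + 1), (N.choose k * r ^ k * (1 - r) ^ (N - k)) * k.choose j =
      N.choose j * r ^ j := by
  have h : (C r * (1 + X) + C (1 - r) : ℝ[X]) ^ N = (1 + C r * X) ^ N := by
    congr 1
    rw [C_sub, C_1]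
    ring
  rw [add_pow] at h
  have h1 := congrArg (fun p => coeff p j) h
  simp only [finsetSum_coeff, coeff_one_add_C_mul_X_pow] at h1
  rw [← h1]
  refine Finset.sum_congr rfl fun k _ => ?_
  have : (C r * (1 + X) : ℝ[X]) ^ k * C (1 - r) ^ (N - k) * (N.choose k : ℝ[X]) =
      C (N.choose k * r ^ k * (1 - r) ^ (N - k)) * (1 + X) ^ k := by
    rw [mul_pow]
    simp only [C_mul, C_pow, map_natCast]
    ring
  rw [this, coeff_C_mul, coeff_one_add_X_pow]

/-- Weights that put total mass `W k` on the two points sharing the `y`-coordinates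
`pointY d n k`, of which `L k` on the one with nonzero `x`-coordinates. -/
noncomputable def splitWeight (n : ℕ) (W L : ℕ → ℝ) : Fin (n + 1) ⊕ Fin n → ℝ :=
  Sum.elim (fun k => W k - if (k : ℕ) < n then L k else 0) fun k => L (n - 1 - k)

theorem sum_reflect (f : ℕ → ℝ) : ∑ k : Fin n, f (n - 1 - k) = ∑ m ∈ Finset.range n, f m := by
  rw [Fin.sum_univ_eq_sum_range fun k => f (n - 1 - k), Finset.sum_range_reflect]

theorem sum_splitWeight_mul (W L g : ℕ → ℝ) :
    ∑ k : Fin (n + 1), (W k - if (k : ℕ) < n then L k else 0) * g k +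
      ∑ k : Fin n, L (n - 1 - k) * g (n - 1 - k) = ∑ k ∈ Finset.range (n + 1), W k * g k := by
  rw [sum_reflect fun m => L m * g m,
    Fin.sum_univ_eq_sum_range fun k => (W k - if k < n then L k else 0) * g k]
  have h : ∑ k ∈ Finset.range n, (if k < n then L k else 0) * g k =
      ∑ k ∈ Finset.range n, L k * g k :=
    Finset.sum_congr rfl fun k hk => by rw [if_pos (Finset.mem_range.1 hk)]
  simp only [sub_mul, Finset.sum_sub_distrib]
  rw [Finset.sum_range_succ fun k => (if k < n then L k else 0) * g k, if_neg (lt_irrefl n), h]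
  ring

theorem sum_splitWeight (W L : ℕ → ℝ) :
    ∑ k, splitWeight n W L k = ∑ k ∈ Finset.range (n + 1), W k := by
  simpa [splitWeight] using sum_splitWeight_mul (n := n) W L fun _ => 1

theorem sum_splitWeight_smul_point (W L : ℕ → ℝ) :
    ∑ k, splitWeight n W L k • point d n k =
      (fun j => ∑ k ∈ Finset.range (n + 1), W k * pointY d n k j,
        fun i => ∑ m ∈ Finset.range n, L m * pointX d n m i) := by
  ext i
  · simp only [Fintype.sum_sum_type, Prod.fst_add, Prod.fst_sum, Pi.add_apply, Finset.sum_apply,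
      Prod.smul_fst, Pi.smul_apply, smul_eq_mul, point, splitWeight, Sum.elim_inl, Sum.elim_inr]
    exact sum_splitWeight_mul W L fun k => pointY d n k i
  · simp only [Fintype.sum_sum_type, Prod.snd_add, Prod.snd_sum, Pi.add_apply, Finset.sum_apply,
      Prod.smul_snd, Pi.smul_apply, smul_eq_mul, point, splitWeight, Sum.elim_inl, Sum.elim_inr,
      Pi.zero_apply, mul_zero, Finset.sum_const_zero, zero_add]
    exact sum_reflect fun m => L m * pointX d n m i

theorem ofNormalised_addX1 (hn : 1 ≤ n) (c : Coord n) (δ : ℝ) :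
    ofNormalised d (addX1 c δ) = addX1 (ofNormalised d c) (δ / ((d : ℝ) / 2 - 1)) := by
  obtain ⟨n, rfl⟩ : ∃ k, n = k + 1 := ⟨n - 1, by omega⟩
  refine Prod.ext rfl (funext fun i => ?_)
  simp only [ofNormalised, addX1, Pi.add_apply, add_div]
  congr 1
  by_cases hi : i = 1
  · subst hi
    simp
  · simp [hi]

theorem half_sub_one_pos (hd : 3 ≤ d) : (0 : ℝ) < (d : ℝ) / 2 - 1 := by
  have := sub_two_pos_of_three_le hd
  linarith

/-- The base point is a mixture, with binomial weights, of the twirled product vectors. -/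
theorem ofNormalised_basePoint (hd : 3 ≤ d) (hn : 1 ≤ n) (ε : ℝ) :
    ofNormalised d (basePoint n ε) = ∑ k, splitWeight n
      (fun k => n.choose k * (ε * (2 * (d - 1) / (d - 2))) ^ k *
        (1 - ε * (2 * (d - 1) / (d - 2))) ^ (n - k))
      (fun m => ε * (3 * d / (d - 2)) * ((n - 1).choose m *
        (ε * (2 * (d - 1) / (d - 2))) ^ m *
        (1 - ε * (2 * (d - 1) / (d - 2))) ^ (n - 1 - m))) k • point d n k := by
  obtain ⟨N, rfl⟩ : ∃ k, n = k + 1 := ⟨n - 1, by omega⟩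
  have h1 := cast_sub_one_ne_zero (show 2 ≤ d by omega)
  have h2 := (sub_two_pos_of_three_le hd).ne'
  have h0 : (d : ℝ) ≠ 0 := by
    have : d ≠ 0 := by omega
    exact_mod_cast this
  have hh : (d : ℝ) / 2 - 1 = (d - 2) / 2 := by ring
  rw [sum_splitWeight_smul_point]
  set r : ℝ := ε * (2 * (d - 1) / (d - 2)) with hr
  have hq : r / (d - 1) = ε / ((d : ℝ) / 2 - 1) := by
    rw [hr, hh]
    field_simp
  refine Prod.ext (funext fun j => ?_) (funext fun i => ?_)
  · have hc : ((N + 1).choose (j + 1) : ℝ) ≠ 0 := by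
      exact_mod_cast (Nat.choose_pos (by omega)).ne'
    simp only [pointY, ofNormalised, basePoint, mul_div_assoc', ← Finset.sum_div,
      sum_choose_mul_choose_mul_pow]
    rw [mul_div_cancel_left₀ _ hc, ← div_pow, ← div_pow, hq]
  · have hc : ((N + 1).choose i : ℝ) ≠ 0 := by
      exact_mod_cast (Nat.choose_pos (by omega)).ne'
    simp only [pointX, ofNormalised, basePoint, mul_div_assoc', ← Finset.sum_div,
      Nat.add_sub_cancel]
    obtain ⟨i, hi⟩ := i
    simp only
    rcases i with _ | i
    · have := sum_choose_mul_choose_mul_pow N 0 r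
      simp only [Nat.choose_zero_right, Nat.cast_one, mul_one, pow_zero] at this
      simp only [Nat.choose_zero_right, Nat.cast_one, mul_one, pow_zero, if_true, add_zero,
        div_one, Nat.cast_zero, zero_div, zero_add, sub_zero, one_mul, pow_one]
      rw [← Finset.sum_mul, ← Finset.mul_sum, this]
      field_simp
    · have e1 := sum_choose_mul_choose_mul_pow N (i + 1) r
      have e2 := sum_choose_mul_choose_mul_pow N i r
      have hk : ∀ m : ℕ, ε * (3 * d) / (d - 2) * (N.choose m * r ^ m * (1 - r) ^ (N - m)) *
          ((d - 2) * m.choose (i + 1) / (d - 1) ^ (i + 1) + 2 * m.choose i / (d - 1) ^ i) =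
          (ε * 3 * d / (d - 1) ^ (i + 1)) *
            ((N.choose m * r ^ m * (1 - r) ^ (N - m)) * m.choose (i + 1)) +
          (ε * 6 * d / (d - 2) / (d - 1) ^ i) *
            ((N.choose m * r ^ m * (1 - r) ^ (N - m)) * m.choose i) := by
        intro m
        field_simp
        ring
      simp only [Nat.add_eq_zero_iff, one_ne_zero, and_false, if_false, Nat.add_sub_cancel]
      have hS : ∑ m ∈ Finset.range (N + 1),
          ε * (3 * d) / (d - 2) * (N.choose m * r ^ m * (1 - r) ^ (N - m)) *
          ((d - 2) * m.choose (i + 1) / (d - 1) ^ (i + 1) + 2 * m.choose i / (d - 1) ^ i) =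
          3 * d * (ε * N.choose (i + 1) * (ε / ((d : ℝ) / 2 - 1)) ^ (i + 1) +
            N.choose i * (ε / ((d : ℝ) / 2 - 1)) ^ (i + 1)) := by
        rw [Finset.sum_congr rfl fun m _ => hk m, Finset.sum_add_distrib, ← Finset.mul_sum,
          ← Finset.mul_sum, e1, e2]
        have hq6 : ε * 6 * d / (d - 2) = 3 * d * (ε / ((d : ℝ) / 2 - 1)) := by
          rw [hh]
          field_simp
          ring
        rw [hq6, show r = ε / ((d : ℝ) / 2 - 1) * (d - 1) by rw [← hq, div_mul_cancel₀ _ h1]]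
        generalize ε / ((d : ℝ) / 2 - 1) = q
        rw [mul_pow, mul_pow]
        field_simp
        ring
      have hc1 : ((i : ℝ) + 1) / (N + 1) * (N + 1).choose (i + 1) = N.choose i := by
        have := congrArg (Nat.cast (R := ℝ)) (Nat.add_one_mul_choose_eq N i)
        push_cast at this
        field_simp
        linarith
      have hc2 : ((N + 1).choose (i + 1) : ℝ) = N.choose i + N.choose (i + 1) := by
        exact_mod_cast Nat.choose_succ_succ N i
      rw [hS, div_eq_div_iff (pow_ne_zero _ (by rw [hh]; positivity)) (by positivity), div_pow]
      push_cast
      have hc3 : (1 - ((i : ℝ) + 1) / (N + 1)) * (N + 1).choose (i + 1) = N.choose (i + 1) := by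
        rw [sub_mul, hc1, hc2]
        ring
      rw [← hc3, ← hc1]
      have hp : ((d : ℝ) / 2 - 1) ^ (i + 1) ≠ 0 := pow_ne_zero _ (by rw [hh]; positivity)
      field_simp
      ring

/-- Whether some `δ > 0` makes the state separable does not depend on the scale of `δ`. -/
theorem forall_not_separableOp_ofNormalised_iff (hd : 3 ≤ d) (hn : 1 ≤ n) (c : Coord n) :
    (∀ δ : ℝ, 0 < δ → ¬ SeparableOp (invState d (ofNormalised d (addX1 c δ)))) ↔
      ∀ δ : ℝ, 0 < δ → ¬ SeparableOp (invState d (addX1 (ofNormalised d c) δ)) := by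
  have h := half_sub_one_pos hd
  constructor
  · intro H δ hδ
    have := H (δ * ((d : ℝ) / 2 - 1)) (mul_pos hδ h)
    rwa [ofNormalised_addX1 hn, mul_div_cancel_right₀ _ h.ne'] at this
  · intro H δ hδ
    rw [ofNormalised_addX1 hn]
    exact H _ (div_pos hδ h)

theorem wernerUndistillable_iff_forall_sum_smul_point (hd : 3 ≤ d) (hn : 1 ≤ n)
    {w : Fin (n + 1) ⊕ Fin n → ℝ} (hw : ∀ k, 0 < w k) (hw1 : ∑ k, w k = 1) :
    WernerUndistillable d n ↔ ∀ δ : ℝ, 0 < δ →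
      ¬ SeparableOp (invState d (addX1 (∑ k, w k • point d n k) δ)) :=
  (wernerUndistillable_iff_blockPositive (by omega)).trans
    (blockPositive_iff_not_separableOp hd hn hw hw1)

/-- The bound on `ε` makes all weights of `ofNormalised_basePoint` positive. -/
theorem wernerUndistillable_iff_basePoint (hd : 3 ≤ d) (hn : 1 ≤ n) {ε : ℝ} (hε : 0 < ε)
    (hε' : ε < (d - 2) / (5 * d - 2)) :
    WernerUndistillable d n ↔ ∀ δ : ℝ, 0 < δ →
      ¬ SeparableOp (invState d (ofNormalised d (addX1 (basePoint n ε) δ))) := by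
  have h2 := sub_two_pos_of_three_le hd
  have h1 : (0 : ℝ) < d - 1 := by linarith
  have h0 : (0 : ℝ) < d := by linarith
  rw [forall_not_separableOp_ofNormalised_iff hd hn, ofNormalised_basePoint hd hn]
  set r : ℝ := ε * (2 * (d - 1) / (d - 2)) with hr
  have hr0 : 0 < r := by positivity
  have hr1 : ε * (3 * d / (d - 2)) < 1 - r := by
    rw [lt_div_iff₀ (by linarith)] at hε'
    rw [hr, ← sub_pos]
    have : 1 - ε * (2 * ((d : ℝ) - 1) / (d - 2)) - ε * (3 * d / (d - 2)) =
        (d - 2 - ε * (5 * d - 2)) / (d - 2) := by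
      field_simp
      ring
    rw [this]
    exact div_pos (by linarith) h2
  have hs0 : 0 < ε * (3 * d / ((d : ℝ) - 2)) := by positivity
  have hr2 : 0 < 1 - r := hs0.trans hr1
  refine wernerUndistillable_iff_forall_sum_smul_point hd hn ?_ ?_
  · rintro (⟨k, hk⟩ | k)
    · simp only [splitWeight, Sum.elim_inl]
      have hW : 0 < (n.choose k : ℝ) * r ^ k * (1 - r) ^ (n - k) := by
        have : 0 < (n.choose k : ℝ) := by exact_mod_cast Nat.choose_pos (by omega)
        positivity
      split_ifs with hkn
      · rw [sub_pos]
        have hc : ((n - 1).choose k : ℝ) ≤ n.choose k := by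
          exact_mod_cast Nat.choose_le_choose k (Nat.sub_le n 1)
        have hc0 : 0 < ((n - 1).choose k : ℝ) := by
          exact_mod_cast Nat.choose_pos (by omega)
        obtain ⟨e, he⟩ : ∃ e, n - k = e + 1 := ⟨n - k - 1, by omega⟩
        rw [he, show n - 1 - k = e by omega]
        calc _ < (1 - r) * ((n - 1).choose k * r ^ k * (1 - r) ^ e) := by gcongr
          _ = (n - 1).choose k * r ^ k * (1 - r) ^ (e + 1) := by ring
          _ ≤ _ := by gcongr
      · simpa using hW
    · simp only [splitWeight, Sum.elim_inr]
      have : 0 < ((n - 1).choose (n - 1 - k) : ℝ) := by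
        exact_mod_cast Nat.choose_pos (by omega)
      positivity
  · rw [sum_splitWeight]
    simpa using sum_choose_mul_choose_mul_pow n 0 r

/-- In normalised coordinates the witness is an alternating sum of binomial coefficients. -/
theorem witnessValue_ofNormalised_constPoint (hd : 3 ≤ d) (hn : 1 ≤ n) (ε : ℝ) :
    witnessValue d (ofNormalised d (constPoint n ε)) = 0 := by
  have h := (half_sub_one_pos hd).ne'
  have h1 : ∀ i : ℕ, ε / ((d : ℝ) / 2 - 1) ^ i * (n.choose i * (1 - (d : ℝ) / 2) ^ i) =
      ε * ((-1) ^ i * n.choose i) := by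
    intro i
    rw [show 1 - (d : ℝ) / 2 = -1 * (d / 2 - 1) by ring, mul_pow]
    generalize (d : ℝ) / 2 - 1 = u at h
    field_simp
  simp only [witnessValue, ofNormalised, constPoint, h1]
  rw [Fin.sum_univ_eq_sum_range fun i => ε * ((-1) ^ i * (n.choose i : ℝ)), ← Finset.mul_sum]
  have := congrArg (Int.cast (R := ℝ)) (Int.alternating_sum_range_choose (n := n))
  rw [if_neg (by omega)] at this
  push_cast at this
  rw [this, mul_zero]

theorem not_separableOp_constPoint (hd : 3 ≤ d) (hn : 1 ≤ n) (h : WernerUndistillable d n)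
    (ε : ℝ) {δ : ℝ} (hδ : 0 < δ) :
    ¬ SeparableOp (invState d (ofNormalised d (addX1 (constPoint n ε) δ))) := by
  refine ((wernerUndistillable_iff_blockPositive (by omega)).1 h).not_separableOp (by omega) ?_
  have hh := half_sub_one_pos hd
  rw [ofNormalised_addX1 hn, witnessValue_addX1 hn, witnessValue_ofNormalised_constPoint hd hn,
    zero_add]
  have hn0 : (0 : ℝ) < n := by exact_mod_cast hn
  exact mul_neg_of_pos_of_neg (div_pos hδ hh) (mul_neg_of_pos_of_neg hn0 (by linarith))

/-- The two-copy point is a mixture of the five points, with weight `1/5` on three of them and the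
remaining weight distributed over `point d 2 (.inl 0)` and `point d 2 (.inl 2)`. -/
theorem wernerUndistillable_two_iff (hd : 3 ≤ d) :
    WernerUndistillable d 2 ↔
      ∀ ε : ℝ, 0 < ε →
        ¬ SeparableOp (invState d (n := 2)
          (![(d : ℝ) * (2 * d - 3) / (5 * (d - 1) * ((d : ℝ) ^ 2 - d - 1)),
              1 / (5 * ((d : ℝ) ^ 2 - d - 1))],
            ![2 * ((d : ℝ) - 2) / (15 * d),
              (5 * (d : ℝ) - 6) / (30 * d * (d - 1)) + ε,
              2 / (15 * (d : ℝ) * (d - 1))])) := by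
  have h2 := sub_two_pos_of_three_le hd
  have h1 : (0 : ℝ) < d - 1 := by linarith
  have h0 : (0 : ℝ) < d := by linarith
  have h3 : (0 : ℝ) < (d : ℝ) ^ 2 - d - 1 := by nlinarith
  have h4 : (0 : ℝ) < (d : ℝ) ^ 2 - 3 := by nlinarith
  have h3' : (d : ℝ) * (d - 1) - 1 ≠ 0 := by
    rw [mul_sub, mul_one, ← sq]
    exact h3.ne'
  have key := wernerUndistillable_iff_forall_sum_smul_point (d := d) (n := 2) hd (by norm_num)
    (w := Sum.elim ![((d : ℝ) ^ 2 - 3) / (5 * (d ^ 2 - d - 1)), 1 / 5,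
      ((d : ℝ) - 1) ^ 2 / (5 * (d ^ 2 - d - 1))] ![1 / 5, 1 / 5])
    (by
      rintro (k | k)
      · fin_cases k
        · simp only [Sum.elim_inl]
          exact div_pos h4 (by positivity)
        · norm_num
        · simp only [Sum.elim_inl]
          exact div_pos (by positivity) (by positivity)
      · fin_cases k <;> norm_num)
    (by
      simp [Fin.sum_univ_succ]
      field_simp
      ring)
  rw [key]
  refine forall₂_congr fun ε _ => ?_
  have hS : ∀ p q : Coord 2, p = q →
      (¬ SeparableOp (invState d p) ↔ ¬ SeparableOp (invState d q)) := by
    rintro p q rfl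
    rfl
  refine hS _ _ (Prod.ext (funext fun j => ?_) (funext fun i => ?_))
  · fin_cases j
    · simp [addX1, Fin.sum_univ_succ, point, pointY, Nat.choose]
      field_simp
      ring
    · simp [addX1, Fin.sum_univ_succ, point, pointY, Nat.choose]
      field_simp
  · fin_cases i <;> simp [addX1, Fin.sum_univ_succ, point, pointX, Nat.choose] <;> field_simp
    all_goals ring

end BasePoints

/-! ### One copy -/

section OneCopy

variable {d : ℕ}

/-- `X ⊗ Y`, with `X` acting on the pair of qubits and `Y` on a single further pair. -/
noncomputable def onePairOp (X : Matrix (Fin 2 × Fin 2) (Fin 2 × Fin 2) ℂ)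
    (Y : Matrix (Fin d × Fin d) (Fin d × Fin d) ℂ) : Op d 1 :=
  withQubits X (pairTensor fun _ => Y)

theorem onePairOp_apply (X : Matrix (Fin 2 × Fin 2) (Fin 2 × Fin 2) ℂ)
    (Y : Matrix (Fin d × Fin d) (Fin d × Fin d) ℂ) (p q : Party d 1 × Party d 1) :
    onePairOp X Y p q =
      X (p.1.1, p.2.1) (q.1.1, q.2.1) * Y (p.1.2 0, p.2.2 0) (q.1.2 0, q.2.2 0) := by
  simp [onePairOp, withQubits, pairTensor]

theorem onePairOp_mul (X X' : Matrix (Fin 2 × Fin 2) (Fin 2 × Fin 2) ℂ)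
    (Y Y' : Matrix (Fin d × Fin d) (Fin d × Fin d) ℂ) :
    onePairOp X Y * onePairOp X' Y' = onePairOp (X * X') (Y * Y') := by
  rw [onePairOp, onePairOp, withQubits_mul, pairTensor_mul, onePairOp]

theorem onePairOp_conjTranspose (X : Matrix (Fin 2 × Fin 2) (Fin 2 × Fin 2) ℂ)
    (Y : Matrix (Fin d × Fin d) (Fin d × Fin d) ℂ) :
    (onePairOp X Y)ᴴ = onePairOp Xᴴ Yᴴ := by
  rw [onePairOp, withQubits_conjTranspose, pairTensor_conjTranspose, onePairOp]

theorem trace_onePairOp (X : Matrix (Fin 2 × Fin 2) (Fin 2 × Fin 2) ℂ)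
    (Y : Matrix (Fin d × Fin d) (Fin d × Fin d) ℂ) :
    (onePairOp X Y).trace = X.trace * Y.trace := by
  rw [onePairOp, trace_withQubits, trace_pairTensor]
  simp

open scoped MatrixOrder in
theorem onePairOp_posSemidef {X : Matrix (Fin 2 × Fin 2) (Fin 2 × Fin 2) ℂ}
    {Y : Matrix (Fin d × Fin d) (Fin d × Fin d) ℂ} (hX : X.PosSemidef) (hY : Y.PosSemidef) :
    (onePairOp X Y).PosSemidef := by
  obtain ⟨X', rfl⟩ := CStarAlgebra.nonneg_iff_eq_star_mul_self.mp hX.nonneg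
  obtain ⟨Y', rfl⟩ := CStarAlgebra.nonneg_iff_eq_star_mul_self.mp hY.nonneg
  rw [star_eq_conjTranspose, star_eq_conjTranspose, ← onePairOp_mul, ← onePairOp_conjTranspose]
  exact posSemidef_conjTranspose_mul_self _

theorem trace_flip (d : ℕ) : (flip d).trace = d := by
  simp only [trace, diag_apply, flip, Fintype.sum_prod_type]
  have : ∀ a b : Fin d, (a = b ∧ b = a) ↔ a = b := fun a b => ⟨And.left, fun h => ⟨h, h.symm⟩⟩
  simp [this]

/-- `1 + F` for `s = 1` and `1 - F` for `s = -1`: twice the projector onto the (anti)symmetric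
subspace. -/
noncomputable def signProj (d : ℕ) (s : ℤˣ) : Matrix (Fin d × Fin d) (Fin d × Fin d) ℂ :=
  1 + ((s : ℤ) : ℂ) • flip d

theorem signProj_posSemidef (d : ℕ) (s : ℤˣ) : (signProj d s).PosSemidef := by
  rcases Int.units_eq_one_or s with rfl | rfl
  · simpa [signProj] using one_add_flip_posSemidef d
  · simpa [signProj, ← sub_eq_add_neg] using one_sub_flip_posSemidef d

theorem signProj_mul (d : ℕ) (s t : ℤˣ) :
    signProj d s * signProj d t = if s = t then (2 : ℂ) • signProj d s else 0 := by
  have h : signProj d s * signProj d t = (1 + ((s : ℤ) : ℂ) * ((t : ℤ) : ℂ)) • 1 +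
      (((s : ℤ) : ℂ) + ((t : ℤ) : ℂ)) • flip d := by
    simp only [signProj, Matrix.add_mul, Matrix.mul_add, Matrix.smul_mul, Matrix.mul_smul,
      flip_mul_self, Matrix.one_mul, Matrix.mul_one]
    module
  rw [h]
  rcases Int.units_eq_one_or s with rfl | rfl <;> rcases Int.units_eq_one_or t with rfl | rfl <;>
    simp [signProj] <;> module

theorem trace_signProj_re_pos (hd : 2 ≤ d) (s : ℤˣ) : 0 < (signProj d s).trace.re := by
  have h2 : (2 : ℝ) ≤ d := by exact_mod_cast hd
  have : (signProj d s).trace = (((d : ℝ) ^ 2 + ((s : ℤ) : ℝ) * d : ℝ) : ℂ) := by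
    rw [signProj, trace_add, trace_smul, trace_flip, trace_one]
    simp
    ring
  rw [this, Complex.ofReal_re]
  rcases Int.units_eq_one_or s with rfl | rfl
  · simp
    positivity
  · simp
    nlinarith

theorem trace_signProj_im (s : ℤˣ) : (signProj d s).trace.im = 0 := by
  rw [signProj, trace_add, trace_smul, trace_flip, trace_one]
  simp

/-- The operators `(1 ± F) ⊗ (1 ± F)` are positive and mutually orthogonal. -/
theorem sum_signProj_posSemidef_iff (hd : 2 ≤ d) (a : ℤˣ → ℤˣ → ℝ) :
    (∑ s, ∑ t, (a s t : ℂ) • onePairOp (signProj 2 s) (signProj d t)).PosSemidef ↔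
      ∀ s t, 0 ≤ a s t := by
  constructor
  · intro h s t
    have h1 := h.mul_mul_conjTranspose_same (onePairOp (signProj 2 s) (signProj d t))
    have h2 : onePairOp (signProj 2 s) (signProj d t) *
        (∑ s, ∑ t, (a s t : ℂ) • onePairOp (signProj 2 s) (signProj d t)) *
        (onePairOp (signProj 2 s) (signProj d t))ᴴ =
        ((16 * a s t : ℝ) : ℂ) • onePairOp (signProj 2 s) (signProj d t) := by
      rw [onePairOp_conjTranspose, (signProj_posSemidef 2 s).1.eq, (signProj_posSemidef d t).1.eq,
        Matrix.mul_sum, Matrix.sum_mul, Finset.sum_eq_single s, Matrix.mul_sum, Matrix.sum_mul,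
        Finset.sum_eq_single t]
      · simp only [Matrix.mul_smul, Matrix.smul_mul, onePairOp_mul, signProj_mul, if_true]
        ext p q
        simp only [onePairOp_apply, Matrix.smul_apply, smul_eq_mul]
        push_cast
        ring
      · intro t' _ ht
        simp only [Matrix.mul_smul, Matrix.smul_mul, onePairOp_mul, signProj_mul, if_neg ht.symm]
        ext p q
        simp [onePairOp_apply]
      · exact fun h => absurd (Finset.mem_univ _) h
      · intro s' _ hs
        have h0 : ∀ Y : Matrix (Fin d × Fin d) (Fin d × Fin d) ℂ, onePairOp 0 Y = 0 := fun Y => by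
          ext p q
          simp [onePairOp_apply]
        simp only [Matrix.mul_sum, Matrix.mul_smul, onePairOp_mul, signProj_mul, if_neg hs.symm,
          h0, smul_zero, Finset.sum_const_zero, Matrix.zero_mul]
      · exact fun h => absurd (Finset.mem_univ _) h
    rw [h2] at h1
    have h3 := (Complex.le_def.1 h1.trace_nonneg).1
    rw [trace_smul, smul_eq_mul, Complex.re_ofReal_mul, trace_onePairOp, Complex.mul_re,
      trace_signProj_im, trace_signProj_im, mul_zero, sub_zero, Complex.zero_re] at h3
    have h4 := mul_pos (trace_signProj_re_pos le_rfl s) (trace_signProj_re_pos hd t)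
    have := nonneg_of_mul_nonneg_left h3 h4
    linarith
  · intro h
    refine posSemidef_sum _ fun s _ => posSemidef_sum _ fun t _ => ?_
    exact (onePairOp_posSemidef (signProj_posSemidef 2 s) (signProj_posSemidef d t)).smul
      (by exact_mod_cast h s t)

theorem partialTranspose_maxEnt_eq_signProj {m : ℕ} :
    partialTranspose (maxEnt m) = (1 / (2 * m) : ℂ) • (signProj m 1 - signProj m (-1)) := by
  rw [partialTranspose_maxEnt, signProj, signProj]
  push_cast
  module

theorem partialTranspose_complEnt {m : ℕ} (hm : 2 ≤ m) : partialTranspose (complEnt m) =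
    (1 / (2 * m) : ℂ) •
      ((1 / (m + 1) : ℂ) • signProj m 1 + (1 / (m - 1) : ℂ) • signProj m (-1)) := by
  have h0 : (m : ℂ) ≠ 0 := by
    have : m ≠ 0 := by omega
    exact_mod_cast this
  have h := sq_sub_one_ne_zero hm
  have h1 : (m : ℂ) + 1 ≠ 0 := by exact_mod_cast Nat.succ_ne_zero m
  have h2 : (m : ℂ) - 1 ≠ 0 := by exact_mod_cast cast_sub_one_ne_zero hm
  have h3 : (m : ℂ) ^ 2 - 1 = (m + 1) * (m - 1) := by ring
  rw [complEnt, partialTranspose_smul, partialTranspose_sub, partialTranspose_one,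
    partialTranspose_maxEnt, signProj, signProj, h3]
  ext p q
  simp only [Matrix.add_apply, Matrix.sub_apply, Matrix.smul_apply, smul_eq_mul]
  push_cast
  field_simp
  ring

theorem invState_one_eq (x y z : ℝ) : invState d (n := 1) (![y], ![x, z]) =
    onePairOp (complEnt 2) (complEnt d) + (y : ℂ) • onePairOp (complEnt 2) (maxEnt d) +
      (x : ℂ) • onePairOp (maxEnt 2) (complEnt d) + (z : ℂ) • onePairOp (maxEnt 2) (maxEnt d) := by
  have h0 : layer d 1 0 = pairTensor fun _ => complEnt d := by simp [layer]
  have h1 : layer d 1 1 = pairTensor fun _ => maxEnt d := by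
    rw [layer, show Finset.powersetCard 1 (Finset.univ : Finset (Fin 1)) = {Finset.univ} by rfl]
    simp only [Finset.sum_singleton, Finset.mem_univ, if_true]
  ext p q
  simp [invState, onePairOp, Fin.sum_univ_succ, h0, h1, withQubits]
  ring

/-- The coefficients of `(1 ± F) ⊗ (1 ± F)` in the partial transpose, up to the factor `8 d`. -/
noncomputable def ptCoeff (d : ℕ) (x y z : ℝ) (s t : ℤˣ) : ℝ :=
  if s = 1 then
    if t = 1 then (1 / (d + 1) + y) / 3 + x / (d + 1) + z
    else (1 / (d - 1) - y) / 3 + x / (d - 1) - z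
  else
    if t = 1 then 1 / (d + 1) + y - x / (d + 1) - z
    else 1 / (d - 1) - y - x / (d - 1) + z

theorem sum_units_int {M : Type} [AddCommMonoid M] (f : ℤˣ → M) : ∑ s, f s = f 1 + f (-1) := by
  rw [show (Finset.univ : Finset ℤˣ) = {1, -1} by rfl, Finset.sum_pair (by decide)]

theorem partialTranspose_invState_one (hd : 2 ≤ d) (x y z : ℝ) :
    partialTranspose (invState d (n := 1) (![y], ![x, z])) =
      ∑ s, ∑ t, ((ptCoeff d x y z s t / (8 * d) : ℝ) : ℂ) •
        onePairOp (signProj 2 s) (signProj d t) := by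
  have h0 : (d : ℂ) ≠ 0 := by
    have : d ≠ 0 := by omega
    exact_mod_cast this
  have h1 : (d : ℂ) + 1 ≠ 0 := by exact_mod_cast Nat.succ_ne_zero d
  have h2 : (d : ℂ) - 1 ≠ 0 := by exact_mod_cast cast_sub_one_ne_zero hd
  have hE : ∀ (X : Matrix (Fin 2 × Fin 2) (Fin 2 × Fin 2) ℂ)
      (Y : Matrix (Fin d × Fin d) (Fin d × Fin d) ℂ), partialTranspose (onePairOp X Y) =
        onePairOp (partialTranspose X) (partialTranspose Y) := fun _ _ => rfl
  rw [invState_one_eq]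
  simp only [partialTranspose_add, partialTranspose_smul, hE, partialTranspose_maxEnt_eq_signProj,
    partialTranspose_complEnt hd, partialTranspose_complEnt le_rfl, sum_units_int, ptCoeff]
  ext p q
  simp only [onePairOp_apply, Matrix.add_apply, Matrix.sub_apply, Matrix.smul_apply, smul_eq_mul,
    if_true, show (-1 : ℤˣ) ≠ 1 by decide, if_false]
  push_cast
  field_simp
  ring

/-- Three of the four coefficients give the three inequalities; the one of `(1 + F) ⊗ (1 + F)` is
never negative. -/
theorem partialTranspose_invState_one_posSemidef_iff (hd : 2 ≤ d) {x y z : ℝ} (hx : 0 ≤ x)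
    (hy : 0 ≤ y) (hz : 0 ≤ z) :
    (partialTranspose (invState d (n := 1) (![y], ![x, z]))).PosSemidef ↔
      3 * z ≤ (1 + 3 * x) / ((d : ℝ) - 1) - y ∧
      z ≤ (1 - x) / ((d : ℝ) + 1) + y ∧
      (x - 1) / ((d : ℝ) - 1) + y ≤ z := by
  have h2 : (2 : ℝ) ≤ d := by exact_mod_cast hd
  have h8 : (0 : ℝ) < 8 * d := by linarith
  have hneg : (-1 : ℤˣ) ≠ 1 := by decide
  rw [partialTranspose_invState_one hd, sum_signProj_posSemidef_iff hd]
  simp only [le_div_iff₀ h8, zero_mul]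
  have hpp : 0 ≤ ptCoeff d x y z 1 1 := by
    simp only [ptCoeff, if_true]
    positivity
  have e1 : ptCoeff d x y z 1 (-1) = ((1 + 3 * x) / ((d : ℝ) - 1) - y - 3 * z) / 3 := by
    simp only [ptCoeff, if_true, hneg, if_false]
    ring
  have e2 : ptCoeff d x y z (-1) 1 = (1 - x) / ((d : ℝ) + 1) + y - z := by
    simp only [ptCoeff, if_true, hneg, if_false]
    ring
  have e3 : ptCoeff d x y z (-1) (-1) = z - ((x - 1) / ((d : ℝ) - 1) + y) := by
    simp only [ptCoeff, hneg, if_false]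
    ring
  constructor
  · intro h
    have a1 := h 1 (-1)
    have a2 := h (-1) 1
    have a3 := h (-1) (-1)
    rw [e1] at a1
    rw [e2] at a2
    rw [e3] at a3
    exact ⟨by linarith, by linarith, by linarith⟩
  · rintro ⟨a1, a2, a3⟩ s t
    rcases Int.units_eq_one_or s with rfl | rfl <;> rcases Int.units_eq_one_or t with rfl | rfl
    · exact hpp
    · rw [e1]; linarith
    · rw [e2]; linarith
    · rw [e3]; linarith

theorem qform_one {α : Type} [Fintype α] [DecidableEq α] (M : Matrix α α ℂ) :
    qform 1 M = (Mᴴ * M).trace := by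
  simp only [qform, one_mulVec, dotProduct, vecOf, Pi.star_apply, Fintype.sum_prod_type, trace,
    diag_apply, mul_apply, conjTranspose_apply]
  exact Finset.sum_comm

/-- Since `|tr M|² ≤ 2 tr (M† M)` for matrices of rank two, one copy of the Werner state with
`β = -1/2` is undistillable. -/
theorem blockPositive_one (hd : 2 ≤ d) : BlockPositive d 1 := by
  refine blockPositive_of_forall_rank_two hd fun M hM => ?_
  obtain ⟨A, B, φ, hA, -, hφ⟩ := exists_factorization hM
  have h0 : (d : ℂ) ≠ 0 := by
    have : d ≠ 0 := by omega
    exact_mod_cast this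
  have hK : (pairTensor fun _ : Fin 1 => halfX d) = 1 - (1 / 2 : ℂ) •
      vecMulVec (vecOf (1 : Matrix (Fin 1 → Fin d) (Fin 1 → Fin d) ℂ)) (star (vecOf 1)) := by
    ext ⟨a, b⟩ ⟨a', b'⟩
    have hab : ∀ a b : Fin 1 → Fin d, a = b ↔ a 0 = b 0 := fun a b =>
      ⟨fun h => by rw [h], fun h => funext fun i => by rw [Subsingleton.elim i 0, h]⟩
    simp only [pairTensor, Finset.univ_unique, Fin.default_eq_zero, Finset.prod_singleton, halfX,
      Matrix.add_apply, Matrix.sub_apply, Matrix.smul_apply, one_apply, maxEnt, Prod.mk.injEq,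
      vecMulVec_apply, vecOf, Pi.star_apply, apply_ite star, star_one, star_zero, smul_eq_mul, hab]
    by_cases h1 : a 0 = b 0 <;> by_cases h2 : a' 0 = b' 0 <;> simp [h1, h2]
    field_simp
    ring
  have hq : qform (pairTensor fun _ : Fin 1 => halfX d) M =
      (Mᴴ * M).trace - 1 / 2 * (star M.trace * M.trace) := by
    have h1 : star (vecOf (1 : Matrix (Fin 1 → Fin d) (Fin 1 → Fin d) ℂ)) ⬝ᵥ vecOf M =
        M.trace := by
      simp [dotProduct, vecOf, Fintype.sum_prod_type, one_apply, apply_ite star, trace]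
    have h2 : star (vecOf M) ⬝ᵥ vecOf (1 : Matrix (Fin 1 → Fin d) (Fin 1 → Fin d) ℂ) =
        star M.trace := by
      simp [dotProduct, vecOf, Fintype.sum_prod_type, one_apply, trace]
    rw [hK, ← qform_one, qform, qform, sub_mulVec, dotProduct_sub, smul_mulVec, dotProduct_smul,
      vecMulVec_mulVec, h1]
    simp [h2]
    ring
  -- with `P` the projector onto the range of `M`, which has trace two, the claim is that
  -- `M - (tr M / 2) P` has nonnegative norm
  set P := Aᴴ * A with hP
  have hPM : P * M = M := by
    rw [hφ, hP]
    simp only [Matrix.mul_assoc]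
    rw [← Matrix.mul_assoc A, hA, Matrix.one_mul]
  have hPP : P * P = P := by
    rw [hP, Matrix.mul_assoc, ← Matrix.mul_assoc A, hA, Matrix.one_mul]
  have hPH : Pᴴ = P := by rw [hP, conjTranspose_mul, conjTranspose_conjTranspose]
  have hPt : P.trace = 2 := by
    rw [hP, trace_mul_comm, hA]
    simp
  have hMP : Mᴴ * P = Mᴴ := by
    rw [← hPH, ← conjTranspose_mul, hPM]
  have hsq : (Mᴴ * M).trace - 1 / 2 * (star M.trace * M.trace) =
      ((M - (M.trace / 2) • P)ᴴ * (M - (M.trace / 2) • P)).trace := by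
    rw [conjTranspose_sub, conjTranspose_smul, hPH, Matrix.sub_mul, Matrix.mul_sub, Matrix.mul_sub,
      Matrix.mul_smul, Matrix.smul_mul, Matrix.smul_mul, Matrix.mul_smul, hMP, hPM, hPP]
    simp only [trace_sub, trace_smul, hPt, trace_conjTranspose, smul_eq_mul, star_div₀]
    simp
    ring
  rw [hq, hsq]
  exact (Complex.le_def.1 (posSemidef_conjTranspose_mul_self _).trace_nonneg).1

theorem witnessValue_one (x y z : ℝ) :
    witnessValue d (n := 1) (![y], ![x, z]) = x - (d / 2 - 1) * z := by
  simp [witnessValue, Fin.sum_univ_succ]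
  ring

theorem not_separableOp_one (hd : 3 ≤ d) {x y z : ℝ} (h : 2 * x / ((d : ℝ) - 2) < z) :
    ¬ SeparableOp (invState d (n := 1) (![y], ![x, z])) := by
  refine (blockPositive_one (by omega)).not_separableOp (by omega) ?_
  rw [div_lt_iff₀ (sub_two_pos_of_three_le hd)] at h
  rw [witnessValue_one]
  linarith

theorem tetrahedron_eq (o a b c : ℝ) :
    o • ((![0], ![0, 0]) : Coord 1) + a • (![1 / ((d : ℝ) - 1)], ![0, 0]) +
      b • (![0], ![0, 1 / (3 * ((d : ℝ) - 1))]) +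
      c • (![0], ![((d : ℝ) - 2) / (3 * d), 2 / (3 * (d : ℝ))]) =
    (![a * (1 / ((d : ℝ) - 1))], ![c * (((d : ℝ) - 2) / (3 * d)),
      b * (1 / (3 * ((d : ℝ) - 1))) + c * (2 / (3 * (d : ℝ)))]) := by
  ext i <;> fin_cases i <;> simp

/-- The vertices `O`, `A`, `C` are the twirled product vectors for one copy. -/
theorem tetrahedron_eq_sum_point (o a c : ℝ) :
    o • ((![0], ![0, 0]) : Coord 1) + a • (![1 / ((d : ℝ) - 1)], ![0, 0]) +
      (0 : ℝ) • (![0], ![0, 1 / (3 * ((d : ℝ) - 1))]) +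
      c • (![0], ![((d : ℝ) - 2) / (3 * d), 2 / (3 * (d : ℝ))]) =
    ∑ k, (Sum.elim ![o, a] ![c] : Fin 2 ⊕ Fin 1 → ℝ) k • point d 1 k := by
  ext i <;> fin_cases i <;> simp [Fin.sum_univ_succ, point, pointY, pointX]

/-- Every state off the face `OAC` is detected by the witness. -/
theorem tetrahedron_ppt_and_separable_iff (hd : 3 ≤ d) {o a b c : ℝ} (ho : 0 ≤ o) (ha : 0 ≤ a)
    (hb : 0 ≤ b) (hc : 0 ≤ c) (h : o + a + b + c = 1) {p : Coord 1}
    (hp : p = o • (![0], ![0, 0]) + a • (![1 / ((d : ℝ) - 1)], ![0, 0]) +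
      b • (![0], ![0, 1 / (3 * ((d : ℝ) - 1))]) +
      c • (![0], ![((d : ℝ) - 2) / (3 * d), 2 / (3 * (d : ℝ))])) :
    (partialTranspose (invState d p)).PosSemidef ∧ (SeparableOp (invState d p) ↔ b = 0) := by
  have h2 := sub_two_pos_of_three_le hd
  have h1 : (0 : ℝ) < d - 1 := by linarith
  have h0 : (0 : ℝ) < d := by linarith
  refine ⟨?_, ⟨fun hsep => ?_, fun hb0 => ?_⟩⟩
  · rw [hp, tetrahedron_eq, partialTranspose_invState_one_posSemidef_iff (by omega)
      (by positivity) (by positivity) (by positivity)]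
    refine ⟨?_, ?_, ?_⟩
    · rw [← sub_nonneg]
      have : (1 + 3 * (c * (((d : ℝ) - 2) / (3 * d)))) / (d - 1) - a * (1 / ((d : ℝ) - 1)) -
          3 * (b * (1 / (3 * ((d : ℝ) - 1))) + c * (2 / (3 * (d : ℝ)))) =
          (1 - a - b - c) / (d - 1) := by
        field_simp
        ring
      rw [this]
      exact div_nonneg (by linarith) h1.le
    · rw [← sub_nonneg]
      have : (1 - c * (((d : ℝ) - 2) / (3 * d))) / (d + 1) + a * (1 / ((d : ℝ) - 1)) -
          (b * (1 / (3 * ((d : ℝ) - 1))) + c * (2 / (3 * (d : ℝ)))) =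
          (1 - b - c) / (d + 1) + a / (d - 1) + 2 * b * (d - 2) / (3 * (d - 1) * (d + 1)) := by
        field_simp
        ring
      rw [this]
      have : 0 ≤ 1 - b - c := by linarith
      positivity
    · rw [← sub_nonneg]
      have : b * (1 / (3 * ((d : ℝ) - 1))) + c * (2 / (3 * (d : ℝ))) -
          ((c * (((d : ℝ) - 2) / (3 * d)) - 1) / (d - 1) + a * (1 / ((d : ℝ) - 1))) =
          b / (3 * (d - 1)) + c * (2 / (3 * d)) + (1 - a - c) / (d - 1) +
            c * (2 * (d + 1) / (3 * d)) / (d - 1) := by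
        field_simp
        ring
      rw [this]
      have : 0 ≤ 1 - a - c := by linarith
      positivity
  · by_contra hb0
    have hbpos : 0 < b := lt_of_le_of_ne hb (Ne.symm hb0)
    rw [hp, tetrahedron_eq] at hsep
    refine not_separableOp_one hd ?_ hsep
    have : 2 * (c * (((d : ℝ) - 2) / (3 * d))) / (d - 2) = c * (2 / (3 * (d : ℝ))) := by
      field_simp
    rw [this]
    have : 0 < b * (1 / (3 * ((d : ℝ) - 1))) := by positivity
    linarith
  · subst hb0
    rw [hp, tetrahedron_eq_sum_point, invState_sum _ (by simpa [Fin.sum_univ_succ] using h)]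
    refine SeparableOp.sum fun k => (point_separableOp (by omega) k).smul ?_
    rcases k with k | k <;> fin_cases k <;> simpa

end OneCopy

end Distill

theorem mainTheorem1 (d : ℕ) (hd : 3 ≤ d) :
    (∀ n : ℕ, 1 ≤ n →
      -- the formulations of `n`-copy undistillability
      [ WernerUndistillable d n,
        ¬ NDistillable n (werner d (-1 / 2)),
        ∀ᶠ β in 𝓝[>] (-1 / 2 : ℝ), ¬ NDistillable n (werner d β),
        ¬ ∃ M : Matrix (Fin n → Fin d) (Fin n → Fin d) ℂ, M.rank = 2 ∧
          (star (fun p : (Fin n → Fin d) × (Fin n → Fin d) => M p.1 p.2) ⬝ᵥ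
            (pairTensor (fun _ : Fin n => partialTranspose (werner d (-1 / 2)))) *ᵥ
              (fun p : (Fin n → Fin d) × (Fin n → Fin d) => M p.1 p.2)).re < 0 ].TFAE ∧
      -- the `2n + 1` twirled product vectors are separable, and they span the hyperplane
      (∀ k, (∃ t : ℝ, 0 < t ∧ IsTwirl (productState d n k) ((t : ℂ) • invState d (point d n k))) ∧
        SeparableOp (invState d (point d n k))) ∧
      AffineIndependent ℝ (point d n) ∧
      (affineSpan ℝ (Set.range (point d n)) : Set (Coord n)) =
        {c | (witness d n * invState d c).trace = 0} ∧
      -- the equivalence for every interior point of their convex hull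
      (∀ w : Fin (n + 1) ⊕ Fin n → ℝ, (∀ k, 0 < w k) → ∑ k, w k = 1 →
        (WernerUndistillable d n ↔
          ∀ δ : ℝ, 0 < δ →
            ¬ SeparableOp (invState d (addX1 (∑ k, w k • point d n k) δ)))) ∧
      -- the equivalence in explicit normalised coordinates
      (∃ ε₀ : ℝ, 0 < ε₀ ∧ ∀ ε : ℝ, 0 < ε → ε < ε₀ →
        (WernerUndistillable d n ↔
          ∀ δ : ℝ, 0 < δ →
            ¬ SeparableOp (invState d (ofNormalised d (addX1 (basePoint n ε) δ))))) ∧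
      -- the implication that holds when all the normalised coordinates are equal
      (WernerUndistillable d n → ∀ ε δ : ℝ, 0 < ε → 0 < δ →
        ¬ SeparableOp (invState d (ofNormalised d (addX1 (constPoint n ε) δ))))) ∧
    -- one copy, explicitly
    (∀ x y z : ℝ, 0 ≤ x → 0 ≤ y → 0 ≤ z →
      ((partialTranspose (invState d (n := 1) (![y], ![x, z]))).PosSemidef ↔
        3 * z ≤ (1 + 3 * x) / ((d : ℝ) - 1) - y ∧
        z ≤ (1 - x) / ((d : ℝ) + 1) + y ∧
        (x - 1) / ((d : ℝ) - 1) + y ≤ z) ∧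
      (2 * x / ((d : ℝ) - 2) < z → ¬ SeparableOp (invState d (n := 1) (![y], ![x, z])))) ∧
    (∀ o a b c : ℝ, 0 ≤ o → 0 ≤ a → 0 ≤ b → 0 ≤ c → o + a + b + c = 1 →
      ∀ p : Coord 1,
        p = o • (![0], ![0, 0]) + a • (![1 / ((d : ℝ) - 1)], ![0, 0]) +
          b • (![0], ![0, 1 / (3 * ((d : ℝ) - 1))]) +
          c • (![0], ![((d : ℝ) - 2) / (3 * d), 2 / (3 * (d : ℝ))]) →
        (partialTranspose (invState d p)).PosSemidef ∧
          (SeparableOp (invState d p) ↔ b = 0)) ∧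
    -- two copies, explicitly
    (WernerUndistillable d 2 ↔
      ∀ ε : ℝ, 0 < ε →
        ¬ SeparableOp (invState d (n := 2)
          (![(d : ℝ) * (2 * d - 3) / (5 * (d - 1) * ((d : ℝ) ^ 2 - d - 1)),
              1 / (5 * ((d : ℝ) ^ 2 - d - 1))],
            ![2 * ((d : ℝ) - 2) / (15 * d),
              (5 * (d : ℝ) - 6) / (30 * d * (d - 1)) + ε,
              2 / (15 * (d : ℝ) * (d - 1))]))) := by
  have hd2 : 2 ≤ d := by omega
  refine ⟨fun n hn => ⟨wernerUndistillable_tfae hd2 n, fun k =>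
    ⟨isTwirl_productState hd2 k, point_separableOp hd2 k⟩, affineIndependent_point hd, ?_,
    fun w hw hw1 => wernerUndistillable_iff_forall_sum_smul_point hd hn hw hw1,
    ⟨((d : ℝ) - 2) / (5 * d - 2), ?_,
      fun ε hε hε' => wernerUndistillable_iff_basePoint hd hn hε hε'⟩,
    fun h ε δ _ hδ => not_separableOp_constPoint hd hn h ε hδ⟩,
    fun x y z hx hy hz => ⟨partialTranspose_invState_one_posSemidef_iff hd2 hx hy hz,
      not_separableOp_one hd⟩,
    fun o a b c ho ha hb hc h p hp => tetrahedron_ppt_and_separable_iff hd ho ha hb hc h hp,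
    wernerUndistillable_two_iff hd⟩
  · rw [affineSpan_point hd hn]
    ext c
    rw [Set.mem_ofPred_eq, Set.mem_ofPred_eq, trace_witness_invState hd2, Complex.ofReal_eq_zero]
  · have := sub_two_pos_of_three_le hd
    exact div_pos this (by linarith)
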